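/- Let $d\ge 1$ and let $(M,\omega)$ be a $2d$-dimensional smooth (Hausdorff, second countable) symplectic manifold without boundary which is exact, $\omega=d\lambda$ for a smooth $1$-form $\lambda$. Let $X$ be the Liouville vector field, $\iota_X\omega=\lambda$, and let $\mu_t$ be its (possibly only locally defined) flow. For $T>0$, a smooth function $H:[0,T]\times M\to\mathbb{R}$, such that the supports of all $H_t=H(t,\cdot)$, $t\in[0,T]$, lie in a common compact set, is said to generate the smooth isotopy $(\phi^t)_{t\in[0,T]}$ of $M$ if $\phi^0=\mathrm{Id}$ and $\frac{d}{dt}\phi^t=X_{H_t}\circ\phi^t$, where $\iota_{X_{H_t}}\omega=dH_t$. Let $\mathrm{Ham}_c(M,\omega)$ be the group of the diffeomorphisms $\phi=\phi^1$ that are time one maps of such isotopies with $T=1$, and put $$\mathrm{Cal}(\phi)=\int_0^1\int_M H(t,x)\,\omega^d\,dt ,$$ where $H$ generates such an isotopy with time one map $\phi$, and $M$ is oriented by $\omega^d$. Let $\phi\in\mathrm{Ham}_c(M,\omega)$. For $\delta>0$ so small that $\mu_t$ and $\mu_t^{-1}$ are defined on $\mathrm{Supp}(\phi)$ for all $t\in[0,\delta]$,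 let $[\mu_t,\phi]=\mu_t\circ\phi\circ\mu_t^{-1}\circ\phi^{-1}$, where $\mu_t\circ\phi\circ\mu_t^{-1}$ is defined on $\mu_t(\mathrm{Supp}(\phi))$ and extended by the identity. Then: 1. $\mathrm{Cal}(\phi)$ does not depend on the choice of the generating function $H$; 2. there is such a $\delta>0$ for which $([\mu_t,\phi])_{t\in[0,\delta]}$ is a smooth isotopy generated by a function $H_{\lambda,\phi}:[0,\delta]\times M\to\mathbb{R}$ as above; 3. for every such $\delta>0$ and every function $H_{\lambda,\phi}$ that generates $([\mu_t,\phi])_{t\in[0,\delta]}$, $$\mathrm{Cal}(\phi)=\frac{1}{d+1}\int_M H_{\lambda,\phi}(0,x)\,\omega^d .$$ -/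

import Mathlib

open scoped Manifold ContDiff
open Set MeasureTheory

noncomputable section

namespace Calabi

variable {d : ℕ} {M : Type*} [TopologicalSpace M]
  [ChartedSpace (EuclideanSpace ℝ (Fin (2 * d))) M]

/-! ### Differential forms in coordinates -/

/-- The coordinate expression of a 1-form in the chart `c`, i.e. its pullback by `c.symm`. -/
def coordOneForm (lam : (x : M) → TangentSpace (𝓡 (2 * d)) x →L[ℝ] ℝ)
    (c : OpenPartialHomeomorph M (EuclideanSpace ℝ (Fin (2 * d))))
    (y : EuclideanSpace ℝ (Fin (2 * d))) : EuclideanSpace ℝ (Fin (2 * d)) →L[ℝ] ℝ :=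
  (lam (c.symm y)).comp (mfderiv (𝓡 (2 * d)) (𝓡 (2 * d)) c.symm y)

/-- The coordinate expression of a field of bilinear forms in the chart `c`, i.e. its pullback by
`c.symm`. -/
def coordTwoForm
    (Ω : (x : M) → TangentSpace (𝓡 (2 * d)) x →L[ℝ] TangentSpace (𝓡 (2 * d)) x →L[ℝ] ℝ)
    (c : OpenPartialHomeomorph M (EuclideanSpace ℝ (Fin (2 * d))))
    (y u v : EuclideanSpace ℝ (Fin (2 * d))) : ℝ :=
  Ω (c.symm y) (mfderiv (𝓡 (2 * d)) (𝓡 (2 * d)) c.symm y u)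
    (mfderiv (𝓡 (2 * d)) (𝓡 (2 * d)) c.symm y v)

/-- `(M, Ω)` is an exact symplectic manifold with Liouville form `lam`: the 1-form `lam` is smooth,
`Ω = d lam` (in every chart, `dλ(u, v) = D_u λ (v) - D_v λ (u)`), and `Ω` is nondegenerate. It
follows that `Ω` is skew-symmetric, smooth and closed. -/
structure IsExactSymplectic
    (Ω : (x : M) → TangentSpace (𝓡 (2 * d)) x →L[ℝ] TangentSpace (𝓡 (2 * d)) x →L[ℝ] ℝ)
    (lam : (x : M) → TangentSpace (𝓡 (2 * d)) x →L[ℝ] ℝ) : Prop where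
  smooth : ∀ c ∈ atlas (EuclideanSpace ℝ (Fin (2 * d))) M,
    ContDiffOn ℝ ∞ (coordOneForm lam c) c.target
  eq_d : ∀ c ∈ atlas (EuclideanSpace ℝ (Fin (2 * d))) M, ∀ y ∈ c.target,
    ∀ u v : EuclideanSpace ℝ (Fin (2 * d)),
      coordTwoForm Ω c y u v =
        fderiv ℝ (coordOneForm lam c) y u v - fderiv ℝ (coordOneForm lam c) y v u
  nondegenerate : ∀ (x : M) (u : TangentSpace (𝓡 (2 * d)) x), (∀ v, Ω x u v = 0) → u = 0

/-! ### The measure `Ω ^ d` -/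

/-- The value on the vectors `v₀, …, v_{2d-1}` of the `d`-fold wedge product of a 2-form `B`. -/
def wedgePower {V : Type*} (B : V → V → ℝ) (v : Fin (2 * d) → V) : ℝ :=
  (1 / 2 ^ d : ℝ) * ∑ σ : Equiv.Perm (Fin (2 * d)), ((Equiv.Perm.sign σ : ℤ) : ℝ) *
    ∏ i : Fin d, B (v (σ ⟨2 * i, by omega⟩)) (v (σ ⟨2 * i + 1, by omega⟩))

/-- The absolute value of the density of `Ω ^ d` with respect to Lebesgue measure in the
chart `c`. -/
def density
    (Ω : (x : M) → TangentSpace (𝓡 (2 * d)) x →L[ℝ] TangentSpace (𝓡 (2 * d)) x →L[ℝ] ℝ)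
    (c : OpenPartialHomeomorph M (EuclideanSpace ℝ (Fin (2 * d))))
    (y : EuclideanSpace ℝ (Fin (2 * d))) : ℝ :=
  |wedgePower (coordTwoForm Ω c y) (fun i => EuclideanSpace.single i (1 : ℝ))|

/-- The part carried by `A` (a subset of the domain of the chart `c`) of the measure `Ω ^ d`. -/
def chartMeasure [MeasurableSpace M]
    (Ω : (x : M) → TangentSpace (𝓡 (2 * d)) x →L[ℝ] TangentSpace (𝓡 (2 * d)) x →L[ℝ] ℝ)
    (c : OpenPartialHomeomorph M (EuclideanSpace ℝ (Fin (2 * d)))) (A : Set M) : Measure M :=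
  Measure.map c.symm
    ((volume.restrict (c.target ∩ c.symm ⁻¹' A)).withDensity
      (fun y => ENNReal.ofReal (density Ω c y)))

/-- A nonempty second countable manifold is covered by a sequence of preferred charts. -/
theorem exists_chart_cover [SecondCountableTopology M] [Nonempty M] :
    ∃ p : ℕ → M,
      ⋃ n, (chartAt (EuclideanSpace ℝ (Fin (2 * d))) (p n)).source = univ := by
  obtain ⟨s, hs, hU⟩ := TopologicalSpace.countable_cover_nhds
    (fun x : M => chart_source_mem_nhds (EuclideanSpace ℝ (Fin (2 * d))) x)
  have hne : s.Nonempty := by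
    by_contra h
    rw [Set.not_nonempty_iff_eq_empty] at h
    subst h
    simp only [mem_empty_iff_false, iUnion_of_empty, iUnion_empty] at hU
    exact Set.empty_ne_univ hU
  obtain ⟨p, rfl⟩ := hs.exists_eq_range hne
  exact ⟨p, by simpa using hU⟩

open Classical in
/-- The Borel measure on `M` given by the volume form `Ω ^ d`, where `M` is oriented by `Ω ^ d`, so
that `∫ x, f x ∂(liouvilleMeasure Ω)` is the integral over `M` of `f Ω ^ d`. It is glued from the
coordinate expressions along a sequence of charts that covers `M` (the result does not depend on
the sequence, by the change of variables formula); it is `0` when `M` is empty. -/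
def liouvilleMeasure [MeasurableSpace M]
    (Ω : (x : M) → TangentSpace (𝓡 (2 * d)) x →L[ℝ] TangentSpace (𝓡 (2 * d)) x →L[ℝ] ℝ) :
    Measure M :=
  if h : ∃ p : ℕ → M,
      ⋃ n, (chartAt (EuclideanSpace ℝ (Fin (2 * d))) (p n)).source = univ then
    Measure.sum fun n =>
      chartMeasure Ω (chartAt (EuclideanSpace ℝ (Fin (2 * d))) (h.choose n))
        (disjointed (fun k => (chartAt (EuclideanSpace ℝ (Fin (2 * d))) (h.choose k)).source) n)
  else 0

/-! ### Hamiltonian isotopies and the Calabi invariant -/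

/-- `Y` is the Hamiltonian vector field of `f`: `ι_Y Ω = df`. -/
def IsHamiltonianField
    (Ω : (x : M) → TangentSpace (𝓡 (2 * d)) x →L[ℝ] TangentSpace (𝓡 (2 * d)) x →L[ℝ] ℝ)
    (f : M → ℝ) (Y : (x : M) → TangentSpace (𝓡 (2 * d)) x) : Prop :=
  ∀ (x : M) (v : TangentSpace (𝓡 (2 * d)) x),
    Ω x (Y x) v = mfderiv (𝓡 (2 * d)) 𝓘(ℝ, ℝ) f x v

/-- The smooth function `H` on `[0, T] × M`, whose supports at fixed times lie in a common compact
set, generates the smooth isotopy `(Φ t)` with `t ∈ [0, T]`: this isotopy starts at the identity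
and is the flow of the time dependent Hamiltonian vector field of `H`. Values at times outside
`[0, T]` are irrelevant. -/
structure Generates
    (Ω : (x : M) → TangentSpace (𝓡 (2 * d)) x →L[ℝ] TangentSpace (𝓡 (2 * d)) x →L[ℝ] ℝ)
    (T : ℝ) (H : ℝ → M → ℝ) (Φ : ℝ → M → M) : Prop where
  smooth_ham : ContMDiffOn (𝓘(ℝ, ℝ).prod (𝓡 (2 * d))) 𝓘(ℝ, ℝ) ∞
    (fun p : ℝ × M => H p.1 p.2) (Icc 0 T ×ˢ univ)
  compact_support : ∃ K : Set M, IsCompact K ∧ ∀ t ∈ Icc 0 T, tsupport (H t) ⊆ K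
  smooth_isotopy : ContMDiffOn (𝓘(ℝ, ℝ).prod (𝓡 (2 * d))) (𝓡 (2 * d)) ∞
    (fun p : ℝ × M => Φ p.1 p.2) (Icc 0 T ×ˢ univ)
  initial : ∀ x, Φ 0 x = x
  flow : ∃ Y : ℝ → (x : M) → TangentSpace (𝓡 (2 * d)) x,
    (∀ t ∈ Icc 0 T, IsHamiltonianField Ω (H t) (Y t)) ∧
    ∀ t ∈ Icc 0 T, ∀ x, HasMFDerivWithinAt 𝓘(ℝ, ℝ) (𝓡 (2 * d)) (fun s => Φ s x) (Icc 0 T) t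
      ((1 : ℝ →L[ℝ] ℝ).smulRight (Y t (Φ t x)))

/-- `H` generates the diffeomorphism `φ`: `φ` is the time one map of the flow of `H`. -/
def GeneratesDiffeo
    (Ω : (x : M) → TangentSpace (𝓡 (2 * d)) x →L[ℝ] TangentSpace (𝓡 (2 * d)) x →L[ℝ] ℝ)
    (H : ℝ → M → ℝ) (φ : M ≃ₘ^∞⟮𝓡 (2 * d), 𝓡 (2 * d)⟯ M) : Prop :=
  ∃ Φ : ℝ → M → M, Generates Ω 1 H Φ ∧ ∀ x, Φ 1 x = φ x

/-- The set of compactly supported Hamiltonian diffeomorphisms. -/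
def HamC
    (Ω : (x : M) → TangentSpace (𝓡 (2 * d)) x →L[ℝ] TangentSpace (𝓡 (2 * d)) x →L[ℝ] ℝ) :
    Set (M ≃ₘ^∞⟮𝓡 (2 * d), 𝓡 (2 * d)⟯ M) :=
  {φ | ∃ H : ℝ → M → ℝ, GeneratesDiffeo Ω H φ}

/-- The integral of `H` over `[0, 1] × M` with respect to `Ω ^ d` and `dt`. -/
def calabiIntegral [MeasurableSpace M]
    (Ω : (x : M) → TangentSpace (𝓡 (2 * d)) x →L[ℝ] TangentSpace (𝓡 (2 * d)) x →L[ℝ] ℝ)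
    (H : ℝ → M → ℝ) : ℝ :=
  ∫ t in (0 : ℝ)..1, ∫ x, H t x ∂(liouvilleMeasure Ω)

open Classical in
/-- The Calabi invariant of `φ`: the integral over `[0, 1] × M` of a Hamiltonian function that
generates `φ` (junk value `0` if `φ` is not a compactly supported Hamiltonian diffeomorphism). -/
def cal [MeasurableSpace M]
    (Ω : (x : M) → TangentSpace (𝓡 (2 * d)) x →L[ℝ] TangentSpace (𝓡 (2 * d)) x →L[ℝ] ℝ)
    (φ : M ≃ₘ^∞⟮𝓡 (2 * d), 𝓡 (2 * d)⟯ M) : ℝ :=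
  if h : ∃ H : ℝ → M → ℝ, GeneratesDiffeo Ω H φ then calabiIntegral Ω h.choose else 0

/-! ### The Liouville flow and the commutator isotopy -/

/-- `X` is the Liouville vector field of `lam`: `ι_X Ω = lam`. -/
def IsLiouvilleField
    (Ω : (x : M) → TangentSpace (𝓡 (2 * d)) x →L[ℝ] TangentSpace (𝓡 (2 * d)) x →L[ℝ] ℝ)
    (lam : (x : M) → TangentSpace (𝓡 (2 * d)) x →L[ℝ] ℝ)
    (X : (x : M) → TangentSpace (𝓡 (2 * d)) x) : Prop :=
  ∀ (x : M) (v : TangentSpace (𝓡 (2 * d)) x), Ω x (X x) v = lam x v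

/-- The points at which the time `t` map of the flow of `X` is defined. -/
def flowDomain (X : (x : M) → TangentSpace (𝓡 (2 * d)) x) (t : ℝ) : Set M :=
  {x | ∃ γ : ℝ → M, γ 0 = x ∧ IsMIntegralCurveOn γ X (uIcc 0 t)}

open Classical in
/-- The time `t` map of the flow of `X` (junk value `x` where it is not defined). -/
def flow (X : (x : M) → TangentSpace (𝓡 (2 * d)) x) (t : ℝ) (x : M) : M :=
  if h : ∃ γ : ℝ → M, γ 0 = x ∧ IsMIntegralCurveOn γ X (uIcc 0 t) then h.choose t else x

/-- The support of a map from `M` to itself. -/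
def mapSupport (f : M → M) : Set M := closure {x | f x ≠ x}

/-- For all `t ∈ [0, δ]`, the maps `μ_t` and `μ_t⁻¹` are defined on the support of `f`, where `μ` is
the flow of `X`. -/
def FlowDefinedOnSupport (X : (x : M) → TangentSpace (𝓡 (2 * d)) x) (f : M → M) (δ : ℝ) : Prop :=
  ∀ t ∈ Icc 0 δ, mapSupport f ⊆ flowDomain X t ∩ flowDomain X (-t)

open Classical in
/-- The conjugate `μ_t ∘ f ∘ μ_t⁻¹` of `f` by the flow of `X`, on the image by `μ_t` of the support
of `f`, extended by the identity. -/
def flowConj (X : (x : M) → TangentSpace (𝓡 (2 * d)) x) (f : M → M) (t : ℝ) (y : M) : M :=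
  if y ∈ flow X t '' mapSupport f then flow X t (f (flow X (-t) y)) else y

/-- The commutator `[μ_t, φ] = μ_t ∘ φ ∘ μ_t⁻¹ ∘ φ⁻¹`. -/
def flowCommutator (X : (x : M) → TangentSpace (𝓡 (2 * d)) x)
    (φ : M ≃ₘ^∞⟮𝓡 (2 * d), 𝓡 (2 * d)⟯ M) (t : ℝ) (x : M) : M :=
  flowConj X φ t (φ.symm x)

end Calabi

end

/-!
# The Calabi invariant as an integral over the commutator with the Liouville flow

Let `φ` be the time one map of the Hamiltonian isotopy `Φ_t` generated by `H`, and let `Y_t` be the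
Hamiltonian vector field of `H_t`. The function `A_t = ∫_0^t (H_s + lam(Y_s)) ∘ Φ_s ds` satisfies
`Φ_t^* lam - lam = dA_t` (`IsHamIsotopy.lam_comp_mfderiv`), and `A = A_1` is smooth and compactly
supported. All three assertions are obtained from `A`.

The Liouville field `X` expands `Ω ^ d` at the rate `d`, that is `∫ df(X) = -d ∫ f` for `f` with
compact support (`integral_differential_liouvilleField`). As `lam(Y_t) = -dH_t(X)`, and as `Φ_t`
preserves `Ω ^ d`, differentiating `∫ A_t` gives `∫ A = (d + 1) ∫_0^1 ∫ H_t dt`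
(`IsHamIsotopy.integral_primitive`). The differential of `A` depends on `φ` only. Two compactly
supported functions with the same differential have the same integral, again by the formula for
`∫ df(X)`, so the integral of `H` does not depend on the choice of `H`.

The conjugate `ψ_t = μ_t ∘ φ ∘ μ_{-t}` satisfies `ψ_t^* lam = lam + d(e^t A ∘ μ_{-t})` because
`μ_t^* lam = e^t lam`. Its velocity field is `X - ψ_{t*} X`, whose contraction with `Ω` is therefore
`d(e^t A ∘ φ⁻¹ ∘ μ_{-t})`. Hence the commutator isotopy is generated by `e^t A ∘ φ⁻¹ ∘ μ_{-t}`
(`IsExactDiffeo.generates_flowCommutator`). At `t = 0` this function is `A ∘ φ⁻¹`, and its integral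
is the one of `A`. Every other generating function of the commutator isotopy has the same
differential at `t = 0`, hence the same integral.

Three general facts are established on the way. A compactly supported smooth vector field has a
smooth flow (`exists_isFlow`), by the implicit function theorem in a space of continuous curves; it
is applied to Hamiltonian fields and to `X` multiplied by a bump function. A diffeomorphism with
`ψ^* Ω = a Ω` scales the measure `Ω ^ d` by `a ^ d` (`integral_comp_diffeo`). The pullback of
`Ω = d lam` to a vector space is computed from the pullback of `lam`
(`twoForm_eq_fderiv_pullOneForm`); this replaces Cartan's formula and Lie derivatives.
-/

noncomputable section

namespace Calabi

open Filter Topology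

set_option linter.unusedSectionVars false

/-! ### Smooth dependence of solutions of differential equations on initial values -/

section Nemytskii

variable {K : Type*} [TopologicalSpace K] [CompactSpace K]
  {E F : Type} [NormedAddCommGroup E] [NormedSpace ℝ E] [NormedAddCommGroup F] [NormedSpace ℝ F]

/-- The pointwise evaluation of a continuous family of linear maps on a continuous family of
vectors, as a continuous bilinear map for the norms of uniform convergence. -/
def pointwiseApply : C(K, E →L[ℝ] F) →L[ℝ] C(K, E) →L[ℝ] C(K, F) :=
  LinearMap.mkContinuous₂
    (LinearMap.mk₂ ℝ (fun (A : C(K, E →L[ℝ] F)) (h : C(K, E)) =>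
        (⟨fun t => A t (h t), by fun_prop⟩ : C(K, F)))
      (fun _ _ _ => by ext; simp) (fun _ _ _ => by ext; simp)
      (fun _ _ _ => by ext; simp) (fun _ _ _ => by ext; simp)) 1
    (fun A h => by
      rw [ContinuousMap.norm_le _ (by positivity)]
      intro t
      simp only [LinearMap.mk₂_apply, ContinuousMap.coe_mk, one_mul]
      exact (A t).le_of_opNorm_le_of_le (A.norm_coe_le_norm t) (h.norm_coe_le_norm t))

@[simp]
lemma pointwiseApply_apply (A : C(K, E →L[ℝ] F)) (h : C(K, E)) (t : K) :
    pointwiseApply A h t = A t (h t) := rfl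

/-- The derivative of `β ↦ f ∘ β` at `α` is multiplication by `f' ∘ α`; the remainder is uniformly
small by the uniform continuity of `f'` near the range of `α`. -/
lemma hasFDerivAt_postcomp {f : C(E, F)} {f' : C(E, E →L[ℝ] F)}
    (hf : ∀ x, HasFDerivAt f (f' x) x) (α : C(K, E)) :
    HasFDerivAt (fun β : C(K, E) => f.comp β) (pointwiseApply (f'.comp α)) α := by
  rw [hasFDerivAt_iff_isLittleO_nhds_zero, Asymptotics.isLittleO_iff]
  intro ε hε
  have hK : IsCompact (range α) := isCompact_range α.continuous
  have hu := hK.uniformContinuousAt_of_continuousAt f' (fun x _ => f'.continuous.continuousAt)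
    (Metric.dist_mem_uniformity hε)
  obtain ⟨δ, hδ, hu⟩ := Metric.mem_uniformity_dist.1 hu
  filter_upwards [Metric.ball_mem_nhds (0 : C(K, E)) hδ] with h hh
  rw [mem_ball_zero_iff] at hh
  rw [ContinuousMap.norm_le _ (by positivity)]
  intro t
  have hmem : ∀ y ∈ Metric.ball (α t) δ, ‖f' y - f' (α t)‖ ≤ ε := by
    intro y hy
    have := @hu (α t) y (by rwa [dist_comm]) (mem_range_self t)
    rw [← dist_eq_norm, dist_comm]
    exact le_of_lt this
  have ht : ‖h t‖ ≤ ‖h‖ := h.norm_coe_le_norm t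
  have := (convex_ball (α t) δ).norm_image_sub_le_of_norm_hasFDerivWithin_le'
    (f := f) (f' := fun y => f' y) (φ := f' (α t)) (C := ε) (x := α t) (y := α t + h t)
    (fun y _ => (hf y).hasFDerivWithinAt) hmem (Metric.mem_ball_self hδ)
    (by simpa [mem_ball_iff_norm] using ht.trans_lt hh)
  simp only [add_sub_cancel_left] at this
  simp only [ContinuousMap.coe_sub, ContinuousMap.coe_comp, Pi.sub_apply, Function.comp_apply,
    ContinuousMap.coe_add, Pi.add_apply, pointwiseApply_apply]
  exact this.trans (by gcongr)

/-- Composition with a smooth map is a smooth operation on continuous maps on a compact space. -/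
theorem contDiff_postcomp (n : ℕ) : ∀ {F : Type} [NormedAddCommGroup F] [NormedSpace ℝ F]
    (f : C(E, F)), ContDiff ℝ ∞ f → ContDiff ℝ n (fun β : C(K, E) => f.comp β) := by
  induction n with
  | zero =>
    intro F _ _ f _
    simpa [contDiff_zero] using f.continuous_postcomp
  | succ n ih =>
    intro F _ _ f hf
    have hf' := (contDiff_infty_iff_fderiv.1 hf)
    let f' : C(E, E →L[ℝ] F) := ⟨fderiv ℝ f, hf'.2.continuous⟩
    push_cast
    rw [contDiff_succ_iff_hasFDerivAt]
    refine ⟨fun α => pointwiseApply (f'.comp α), ?_, fun α =>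
      hasFDerivAt_postcomp (f' := f') (fun x => (hf'.1 x).hasFDerivAt) α⟩
    exact pointwiseApply.contDiff.comp (ih f' hf'.2)

end Nemytskii

section Flow

variable {E : Type} [NormedAddCommGroup E]

/-- The extension of a curve `α` on `[-1, 1]` to `ℝ`, constant on both sides of the interval. -/
def extendCurve (α : C(Icc (-1 : ℝ) 1, E)) (t : ℝ) : E :=
  α (projIcc (-1) 1 (by norm_num) t)

lemma continuous_extendCurve (α : C(Icc (-1 : ℝ) 1, E)) : Continuous (extendCurve α) :=
  α.continuous.comp continuous_projIcc

lemma extendCurve_coe (α : C(Icc (-1 : ℝ) 1, E)) (t : Icc (-1 : ℝ) 1) :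
    extendCurve α t = α t := by simp [extendCurve]

variable [NormedSpace ℝ E]

/-- The integration operator `α ↦ (t ↦ ∫₀ᵗ α)` on continuous curves. -/
def primitiveCLM : C(Icc (-1 : ℝ) 1, E) →L[ℝ] C(Icc (-1 : ℝ) 1, E) :=
  LinearMap.mkContinuous
    { toFun := fun α => ⟨fun t => ∫ s in (0 : ℝ)..t, extendCurve α s,
        (intervalIntegral.continuous_primitive
          (fun a b => (continuous_extendCurve α).intervalIntegrable a b) 0).comp
            continuous_subtype_val⟩
      map_add' := fun α β => by
        ext t
        simp only [ContinuousMap.coe_mk, ContinuousMap.add_apply]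
        rw [← intervalIntegral.integral_add ((continuous_extendCurve α).intervalIntegrable _ _)
          ((continuous_extendCurve β).intervalIntegrable _ _)]
        rfl
      map_smul' := fun c α => by
        ext t
        simp only [ContinuousMap.coe_mk, ContinuousMap.smul_apply, RingHom.id_apply]
        rw [← intervalIntegral.integral_smul]
        rfl } 1
    (fun α => by
      rw [ContinuousMap.norm_le _ (by positivity)]
      intro t
      have h := intervalIntegral.norm_integral_le_of_norm_le_const (a := 0) (b := (t : ℝ))
        (f := extendCurve α) (C := ‖α‖) (fun s _ => α.norm_coe_le_norm _)
      have ht : |(t : ℝ) - 0| ≤ 1 := by rw [sub_zero, abs_le]; exact t.2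
      calc _ ≤ ‖α‖ * |(t : ℝ) - 0| := h
        _ ≤ ‖α‖ * 1 := by gcongr
        _ = 1 * ‖α‖ := by ring)

lemma primitiveCLM_apply (α : C(Icc (-1 : ℝ) 1, E)) (t : Icc (-1 : ℝ) 1) :
    primitiveCLM α t = ∫ s in (0 : ℝ)..t, extendCurve α s := rfl

/-- A map whose zeroes are the solutions `α` on `[-1, 1]` of `α' = s • f(α)`, `α(0) = x`. -/
def odeDefect (f : C(E, E)) (u : (ℝ × E) × C(Icc (-1 : ℝ) 1, E)) : C(Icc (-1 : ℝ) 1, E) :=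
  u.2 - ContinuousLinearMap.const ℝ (Icc (-1 : ℝ) 1) u.1.2 - u.1.1 • primitiveCLM (f.comp u.2)

lemma contDiff_odeDefect {f : C(E, E)} (hf : ContDiff ℝ ∞ f) : ContDiff ℝ ∞ (odeDefect f) := by
  have h : ContDiff ℝ ∞ (fun β : C(Icc (-1 : ℝ) 1, E) => f.comp β) :=
    contDiff_infty.2 fun n => contDiff_postcomp n f hf
  unfold odeDefect
  fun_prop

lemma fderiv_odeDefect_inr {f : C(E, E)} (hf : ContDiff ℝ ∞ f) (x : E)
    (α : C(Icc (-1 : ℝ) 1, E)) :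
    fderiv ℝ (odeDefect f) ((0, x), α) ∘L .inr ℝ (ℝ × E) C(Icc (-1 : ℝ) 1, E) = .id ℝ _ := by
  have h1 : HasFDerivAt (odeDefect f) _ ((0, x), α) :=
    ((contDiff_odeDefect hf).differentiable (by simp) _).hasFDerivAt
  have h2 : HasFDerivAt (fun β => odeDefect f ((0, x), β)) _ α :=
    h1.comp α (hasFDerivAt_prodMk_right (0, x) α)
  refine h2.unique ?_
  simp only [odeDefect, zero_smul, sub_zero]
  exact (hasFDerivAt_id α).sub_const _

variable [CompleteSpace E]

/-- The solutions `α` on `[-1, 1]` of `α' = s • f(α)`, `α(0) = x`, for small `s` and `x` near `x₀`,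
depend smoothly on `(s, x)` as elements of the space of continuous curves. -/
theorem exists_contDiffOn_curves {f : C(E, E)} (hf : ContDiff ℝ ∞ f) (x₀ : E) :
    ∃ ε > 0, ∃ α : ℝ × E → C(Icc (-1 : ℝ) 1, E),
      ContDiffOn ℝ ∞ α (Ioo (-ε) ε ×ˢ Metric.ball x₀ ε) ∧
      ∀ z ∈ Ioo (-ε) ε ×ˢ Metric.ball x₀ ε, odeDefect f (z, α z) = 0 := by
  set α₀ : C(Icc (-1 : ℝ) 1, E) := ContinuousLinearMap.const ℝ _ x₀
  have hsmooth := contDiff_odeDefect hf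
  have h0 : odeDefect f ((0, x₀), α₀) = 0 := by simp [odeDefect, α₀]
  have hcd : ∀ u, ContDiffAt ℝ ∞ (odeDefect f) u := fun u => hsmooth.contDiffAt
  have hinv0 : (fderiv ℝ (odeDefect f) ((0, x₀), α₀) ∘L .inr ℝ (ℝ × E) _).IsInvertible := by
    rw [fderiv_odeDefect_inr hf]
    exact ⟨.refl ℝ _, rfl⟩
  have htop : (∞ : ℕ∞ω) ≠ 0 := by simp
  set g := (hcd ((0, x₀), α₀)).implicitFunction htop hinv0 with hg
  have hg0 : g (0, x₀) = α₀ := (hcd ((0, x₀), α₀)).implicitFunction_apply_self htop hinv0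
  have hgc : ∀ᶠ z in 𝓝 ((0 : ℝ), x₀), ContinuousAt g z := by
    have h1 : ContDiffAt ℝ 1 g (0, x₀) :=
      ((hcd ((0, x₀), α₀)).contDiffAt_implicitFunction htop hinv0).of_le (by norm_cast)
    filter_upwards [h1.eventually (by simp)] with z hz using hz.continuousAt
  have hiff : ∀ᶠ v in 𝓝 ((0, x₀), α₀), odeDefect f v = 0 ↔ g v.1 = v.2 := by
    have := (hcd ((0, x₀), α₀)).eventually_apply_eq_iff_implicitFunction htop hinv0
    rwa [h0] at this
  have hzero : ∀ᶠ z in 𝓝 (0, x₀), odeDefect f (z, g z) = 0 := by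
    have := (hcd ((0, x₀), α₀)).eventually_apply_implicitFunction htop hinv0
    rwa [h0] at this
  have hc0 : ContinuousAt (fun z => (z, g z)) ((0 : ℝ), x₀) :=
    continuousAt_id.prodMk hgc.self_of_nhds
  have hinv : ∀ᶠ z in 𝓝 ((0 : ℝ), x₀),
      (fderiv ℝ (odeDefect f) (z, g z) ∘L .inr ℝ (ℝ × E) _).IsInvertible := by
    have hcont : ContinuousAt (fun z =>
        fderiv ℝ (odeDefect f) (z, g z) ∘L .inr ℝ (ℝ × E) C(Icc (-1 : ℝ) 1, E)) (0, x₀) :=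
      ((hsmooth.continuous_fderiv (by simp)).clm_comp continuous_const).continuousAt.comp hc0
    have hmem : range ((↑) : (C(Icc (-1 : ℝ) 1, E) ≃L[ℝ] C(Icc (-1 : ℝ) 1, E)) → _) ∈
        𝓝 (fderiv ℝ (odeDefect f) ((0, x₀), g (0, x₀)) ∘L
          .inr ℝ (ℝ × E) C(Icc (-1 : ℝ) 1, E)) := by
      rw [fderiv_odeDefect_inr hf]
      exact ContinuousLinearEquiv.nhds (.refl ℝ _)
    exact hcont.eventually hmem
  have hgood : ∀ᶠ z in 𝓝 ((0 : ℝ), x₀), ContDiffAt ℝ ∞ g z ∧ odeDefect f (z, g z) = 0 := by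
    have hiff' : ∀ᶠ z in 𝓝 ((0 : ℝ), x₀), ∀ᶠ v in 𝓝 (z, g z),
        odeDefect f v = 0 ↔ g v.1 = v.2 := by
      have := hiff.eventually_nhds
      rw [← hg0] at this
      exact hc0.eventually this
    filter_upwards [hgc, hinv, hzero, hiff', hgc.eventually_nhds, hzero.eventually_nhds]
      with z hz hzi hz0 hv hgcz hz0'
    refine ⟨?_, hz0⟩
    -- near `z`, the map `g` is also the implicit function based at `(z, g z)`
    have hloc := (hcd (z, g z)).eventually_apply_eq_iff_implicitFunction htop hzi
    have hcz : ContinuousAt (fun z => (z, g z)) z := continuousAt_id.prodMk hz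
    have heq : (hcd (z, g z)).implicitFunction htop hzi =ᶠ[𝓝 z] g := by
      filter_upwards [hcz.eventually hloc, hz0'] with w hw hw0
      exact hw.1 (hw0.trans hz0.symm)
    exact ((hcd (z, g z)).contDiffAt_implicitFunction htop hzi).congr_of_eventuallyEq heq.symm
  obtain ⟨ε, hε, hball⟩ := Metric.eventually_nhds_iff_ball.1 hgood
  have hsub : ∀ z ∈ Ioo (-ε) ε ×ˢ Metric.ball x₀ ε, z ∈ Metric.ball ((0 : ℝ), x₀) ε := by
    rintro ⟨s, x⟩ ⟨hs, hx⟩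
    rw [← ball_prod_same]
    exact ⟨by simpa [Real.ball_eq_Ioo] using hs, hx⟩
  exact ⟨ε, hε, g, fun z hz => (hball z (hsub z hz)).1.contDiffWithinAt,
    fun z hz => (hball z (hsub z hz)).2⟩

lemma extendCurve_of_odeDefect_eq_zero {f : C(E, E)} {s : ℝ} {x : E}
    {α : C(Icc (-1 : ℝ) 1, E)} (h : odeDefect f ((s, x), α) = 0) :
    extendCurve α 0 = x ∧
      ∀ t ∈ Ioo (-1 : ℝ) 1, HasDerivAt (extendCurve α) (s • f (extendCurve α t)) t := by
  have key : ∀ t ∈ Icc (-1 : ℝ) 1,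
      extendCurve α t = x + s • ∫ r in (0 : ℝ)..t, f (extendCurve α r) := by
    intro t ht
    have := congrArg (fun β : C(Icc (-1 : ℝ) 1, E) => β ⟨t, ht⟩) h
    simp only [odeDefect, ContinuousMap.sub_apply, ContinuousMap.smul_apply, primitiveCLM_apply,
      ContinuousLinearMap.const_apply_apply, ContinuousMap.zero_apply] at this
    rw [sub_sub, sub_eq_zero] at this
    rw [show extendCurve α t = α ⟨t, ht⟩ from extendCurve_coe α ⟨t, ht⟩, this]
    rfl
  refine ⟨by simpa using key 0 (by norm_num), fun t ht => ?_⟩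
  have hc : Continuous fun r => f (extendCurve α r) :=
    f.continuous.comp (continuous_extendCurve α)
  have hd : HasDerivAt (fun t => x + s • ∫ r in (0 : ℝ)..t, f (extendCurve α r))
      (s • f (extendCurve α t)) t :=
    ((intervalIntegral.integral_hasDerivAt_right (hc.intervalIntegrable _ _)
      (hc.stronglyMeasurableAtFilter _ _) hc.continuousAt).const_smul s).const_add x
  refine hd.congr_of_eventuallyEq ?_
  filter_upwards [Ioo_mem_nhds ht.1 ht.2] with r hr using key r (Ioo_subset_Icc_self hr)

/-- The local flow of a smooth and globally Lipschitz vector field is smooth. -/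
theorem exists_contDiffOn_localFlow {f : E → E} (hf : ContDiff ℝ ∞ f) {C : NNReal}
    (hC : LipschitzWith C f) (x₀ : E) :
    ∃ ε > 0, ∃ g : ℝ × E → E, ContDiffOn ℝ ∞ g (Ioo (-ε) ε ×ˢ Metric.ball x₀ ε) ∧
      ∀ x ∈ Metric.ball x₀ ε, g (0, x) = x ∧
        ∀ t ∈ Ioo (-ε) ε, HasDerivAt (fun s => g (s, x)) (f (g (t, x))) t := by
  let f' : C(E, E) := ⟨f, hf.continuous⟩
  obtain ⟨ε, hε, α, hα, hz⟩ := exists_contDiffOn_curves (f := f') hf x₀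
  -- the solution of `α' = s • f(α)` at time `1` is the solution of `α' = f(α)` at time `s`
  have hone : (1 : ℝ) ∈ Icc (-1 : ℝ) 1 := by norm_num
  let ev : C(Icc (-1 : ℝ) 1, E) →L[ℝ] E := ContinuousMap.evalCLM ℝ ⟨1, hone⟩
  have hη : 0 < ε / 2 := by positivity
  have hηε : ε / 2 ∈ Ioo (-ε) ε := ⟨by linarith, by linarith⟩
  refine ⟨ε / 2, hη, fun z => ev (α z), ?_, ?_⟩
  · refine (ev.contDiff.comp_contDiffOn hα).mono (prod_mono ?_ (Metric.ball_subset_ball ?_))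
    · exact Ioo_subset_Ioo (by linarith) (by linarith)
    · linarith
  intro x hx
  have hx' : x ∈ Metric.ball x₀ ε := Metric.ball_subset_ball (by linarith) hx
  have hev : ∀ z, ev (α z) = extendCurve (α z) 1 := fun z =>
    (extendCurve_coe (α z) ⟨1, hone⟩).symm
  obtain ⟨hy0, hy⟩ := extendCurve_of_odeDefect_eq_zero (hz (ε / 2, x) ⟨hηε, hx'⟩)
  set y : ℝ → E := fun t => extendCurve (α (ε / 2, x)) (t / (ε / 2)) with hydef
  have hyd : ∀ t ∈ Ioo (-(ε / 2)) (ε / 2), HasDerivAt y (f (y t)) t := by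
    intro t ht
    have ht' : t / (ε / 2) ∈ Ioo (-1 : ℝ) 1 := by
      constructor
      · rw [lt_div_iff₀ hη]; linarith [ht.1]
      · rw [div_lt_iff₀ hη]; linarith [ht.2]
    have := (hy _ ht').scomp t ((hasDerivAt_id t).div_const (ε / 2))
    rw [smul_smul, one_div_mul_cancel hη.ne', one_smul] at this
    exact this
  have heq : ∀ s ∈ Ioo (-(ε / 2)) (ε / 2), ev (α (s, x)) = y s := by
    intro s hs
    have hs' : s ∈ Ioo (-ε) ε := ⟨by linarith [hs.1], by linarith [hs.2]⟩
    obtain ⟨hw0, hw⟩ := extendCurve_of_odeDefect_eq_zero (hz (s, x) ⟨hs', hx'⟩)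
    have hlip : ∀ t ∈ Ioo (-1 : ℝ) 1,
        LipschitzOnWith (‖s‖₊ * C) ((fun (_ : ℝ) z => s • f z) t) ((fun _ => univ) t) := by
      intro t _
      exact ((lipschitzWith_smul s).comp hC).lipschitzOnWith
    have hyc : Continuous y := (continuous_extendCurve _).comp (by fun_prop)
    have hst : ∀ t ∈ Ioo (-1 : ℝ) 1, s * t ∈ Ioo (-(ε / 2)) (ε / 2) := by
      intro t ht
      rw [mem_Ioo, ← abs_lt] at ht hs ⊢
      rw [abs_mul]
      calc |s| * |t| ≤ |s| * 1 := by gcongr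
        _ < ε / 2 := by simpa using hs
    have := ODE_solution_unique_of_mem_Icc (v := fun _ z => s • f z) (s := fun _ => univ)
      (a := -1) (b := 1) (t₀ := 0) (f := extendCurve (α (s, x))) (g := fun t => y (s * t))
      hlip (by norm_num) (continuous_extendCurve _).continuousOn hw (fun _ _ => mem_univ _)
      (by fun_prop)
      (fun t ht => by
        have h := (hyd _ (hst t ht)).scomp t ((hasDerivAt_id t).const_mul s)
        simpa [Function.comp_def] using h)
      (fun _ _ => mem_univ _) (by simp [hw0, hydef, hy0]) hone
    rw [hev, this]
    simp only [mul_one]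
  refine ⟨(heq 0 ⟨by linarith, hη⟩).trans (by simp [hydef, hy0]), fun t ht => ?_⟩
  show HasDerivAt (fun s => ev (α (s, x))) (f (ev (α (t, x)))) t
  rw [heq t ht]
  refine (hyd t ht).congr_of_eventuallyEq ?_
  filter_upwards [Ioo_mem_nhds ht.1 ht.2] with s hs using heq s hs

end Flow

/-! ### Flows of compactly supported vector fields -/

section ManifoldFlow

variable {E : Type} [NormedAddCommGroup E] [NormedSpace ℝ E]
  {M : Type*} [TopologicalSpace M] [ChartedSpace E M]

/-- The derivative of a curve with velocity vector `v`. -/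
abbrev velocity {x : M} (v : TangentSpace 𝓘(ℝ, E) x) : ℝ →L[ℝ] TangentSpace 𝓘(ℝ, E) x :=
  (1 : ℝ →L[ℝ] ℝ).smulRight v

lemma comp_smulRight_one {V W : Type*} [NormedAddCommGroup V] [NormedSpace ℝ V]
    [NormedAddCommGroup W] [NormedSpace ℝ W] (L : V →L[ℝ] W) (v : V) :
    L ∘L ((1 : ℝ →L[ℝ] ℝ).smulRight v) = (1 : ℝ →L[ℝ] ℝ).smulRight (L v) := by
  ext
  simp

/-- The velocity of the image of a curve. -/
lemma _root_.HasMFDerivAt.comp_velocity {E' H' : Type*} [NormedAddCommGroup E'] [NormedSpace ℝ E']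
    [TopologicalSpace H'] {I' : ModelWithCorners ℝ E' H'} {N : Type*} [TopologicalSpace N]
    [ChartedSpace H' N] {γ : ℝ → M} {t : ℝ} {v : TangentSpace 𝓘(ℝ, E) (γ t)}
    (hγ : HasMFDerivAt 𝓘(ℝ, ℝ) 𝓘(ℝ, E) γ t (velocity v)) {F : M → N}
    (hF : MDifferentiableAt 𝓘(ℝ, E) I' F (γ t)) :
    HasMFDerivAt 𝓘(ℝ, ℝ) I' (fun s => F (γ s)) t
      ((1 : ℝ →L[ℝ] ℝ).smulRight (mfderiv 𝓘(ℝ, E) I' F (γ t) v)) :=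
  (hF.hasMFDerivAt.comp t hγ).congr_mfderiv
    (comp_smulRight_one (V := E) (W := E') (mfderiv 𝓘(ℝ, E) I' F (γ t)) v)

/-- The group law extends the smoothness of a flow from short times to all times. -/
lemma contMDiff_of_contMDiffOn_short_time {μ : ℝ → M → M} {ε : ℝ} (hε : 0 < ε)
    (h : ContMDiffOn (𝓘(ℝ, ℝ).prod 𝓘(ℝ, E)) 𝓘(ℝ, E) ∞ (fun q : ℝ × M => μ q.1 q.2)
      (Ioo (-ε) ε ×ˢ univ))
    (hadd : ∀ s t x, μ (s + t) x = μ s (μ t x)) :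
    ContMDiff (𝓘(ℝ, ℝ).prod 𝓘(ℝ, E)) 𝓘(ℝ, E) ∞ (fun q : ℝ × M => μ q.1 q.2) := by
  have key : ∀ n : ℕ, ContMDiffOn (𝓘(ℝ, ℝ).prod 𝓘(ℝ, E)) 𝓘(ℝ, E) ∞
      (fun q : ℝ × M => μ q.1 q.2) (Ioo (-(2 ^ n * ε)) (2 ^ n * ε) ×ˢ univ) := by
    intro n
    induction n with
    | zero => simpa using h
    | succ n ih =>
      have hhalf : ContMDiffOn (𝓘(ℝ, ℝ).prod 𝓘(ℝ, E)) 𝓘(ℝ, ℝ) ∞ (fun q : ℝ × M => q.1 / 2)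
          (Ioo (-(2 ^ (n + 1) * ε)) (2 ^ (n + 1) * ε) ×ˢ univ) :=
        ((contDiff_id.div_const (2 : ℝ)).contMDiff.comp contMDiff_fst).contMDiffOn
      have hmaps : ∀ q ∈ Ioo (-(2 ^ (n + 1) * ε)) (2 ^ (n + 1) * ε) ×ˢ (univ : Set M),
          q.1 / 2 ∈ Ioo (-(2 ^ n * ε)) (2 ^ n * ε) := by
        rintro q ⟨hq, -⟩
        rw [pow_succ] at hq
        constructor <;> linarith [hq.1, hq.2]
      have h1 := ih.comp (hhalf.prodMk contMDiffOn_snd) (fun q hq => ⟨hmaps q hq, mem_univ _⟩)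
      have h2 := ih.comp (hhalf.prodMk h1) (fun q hq => ⟨hmaps q hq, mem_univ _⟩)
      refine h2.congr fun q _ => ?_
      simp only [Function.comp_apply]
      rw [← hadd, add_halves]
  intro q
  obtain ⟨n, hn⟩ := pow_unbounded_of_one_lt (|q.1| / ε) (one_lt_two : (1 : ℝ) < 2)
  rw [div_lt_iff₀ hε, abs_lt] at hn
  exact (key n).contMDiffAt ((isOpen_Ioo.prod isOpen_univ).mem_nhds ⟨hn, mem_univ _⟩)

/-- `μ` is a smooth flow of the vector field `Z`, defined for all times. -/
structure IsFlow (Z : (x : M) → TangentSpace 𝓘(ℝ, E) x) (μ : ℝ → M → M) : Prop where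
  smooth : ContMDiff (𝓘(ℝ, ℝ).prod 𝓘(ℝ, E)) 𝓘(ℝ, E) ∞ (fun q : ℝ × M => μ q.1 q.2)
  zero : ∀ x, μ 0 x = x
  deriv : ∀ x t, HasMFDerivAt 𝓘(ℝ, ℝ) 𝓘(ℝ, E) (fun s => μ s x) t (velocity (Z (μ t x)))
  add : ∀ s t x, μ (s + t) x = μ s (μ t x)

lemma IsFlow.contMDiff {Z : (x : M) → TangentSpace 𝓘(ℝ, E) x} {μ : ℝ → M → M}
    (h : IsFlow Z μ) (t : ℝ) : ContMDiff 𝓘(ℝ, E) 𝓘(ℝ, E) ∞ (μ t) :=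
  h.smooth.comp (contMDiff_const.prodMk contMDiff_id)

/-- The time `t` map of a complete flow, as a diffeomorphism. -/
def IsFlow.diffeo {Z : (x : M) → TangentSpace 𝓘(ℝ, E) x} {μ : ℝ → M → M}
    (h : IsFlow Z μ) (t : ℝ) : M ≃ₘ^∞⟮𝓘(ℝ, E), 𝓘(ℝ, E)⟯ M where
  toFun := μ t
  invFun := μ (-t)
  left_inv x := by rw [← h.add, neg_add_cancel, h.zero]
  right_inv x := by rw [← h.add, add_neg_cancel, h.zero]
  contMDiff_toFun := h.contMDiff t
  contMDiff_invFun := h.contMDiff (-t)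

variable [IsManifold 𝓘(ℝ, E) ∞ M]

/-- The coordinate expression of a smooth vector field in the chart at `p` is smooth. -/
lemma contDiffOn_mpullback_chart [CompleteSpace E] {Z : (x : M) → TangentSpace 𝓘(ℝ, E) x}
    (hZ : ContMDiff 𝓘(ℝ, E) 𝓘(ℝ, E).tangent ∞ (fun x => (⟨x, Z x⟩ : TangentBundle 𝓘(ℝ, E) M)))
    (p : M) :
    ContDiffOn ℝ ∞ (VectorField.mpullback 𝓘(ℝ, E) 𝓘(ℝ, E) (chartAt E p).symm Z : E → E)
      (chartAt E p).target := by
  intro y hy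
  refine (ContDiffAt.contDiffWithinAt ?_)
  rw [← contMDiffAt_vectorSpace_iff_contDiffAt]
  refine ContMDiffAt.mpullback_vectorField_preimage (n := ∞) (hZ _) ?_ ?_ le_rfl
  · exact contMDiffOn_chart_symm.contMDiffAt ((chartAt E p).open_target.mem_nhds hy)
  · exact ⟨(mdifferentiable_chart p).symm.mfderiv hy, rfl⟩

lemma mfderiv_chart_symm_mpullback {Z : (x : M) → TangentSpace 𝓘(ℝ, E) x} {p : M} {y : E}
    (hy : y ∈ (chartAt E p).target) :
    mfderiv 𝓘(ℝ, E) 𝓘(ℝ, E) (chartAt E p).symm y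
      (VectorField.mpullback 𝓘(ℝ, E) 𝓘(ℝ, E) (chartAt E p).symm Z y) =
        Z ((chartAt E p).symm y) := by
  rw [VectorField.mpullback_apply]
  have h : (mfderiv 𝓘(ℝ, E) 𝓘(ℝ, E) (chartAt E p).symm y).IsInvertible :=
    ⟨(mdifferentiable_chart (I := 𝓘(ℝ, E)) p).symm.mfderiv hy, rfl⟩
  exact congrArg (fun L => L (Z ((chartAt E p).symm y))) h.self_comp_inverse

variable [FiniteDimensional ℝ E]

/-- A smooth vector field has a smooth local flow. -/
theorem exists_flowBox {Z : (x : M) → TangentSpace 𝓘(ℝ, E) x}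
    (hZ : ContMDiff 𝓘(ℝ, E) 𝓘(ℝ, E).tangent ∞ (fun x => (⟨x, Z x⟩ : TangentBundle 𝓘(ℝ, E) M)))
    (p : M) :
    ∃ ε > 0, ∃ U : Set M, IsOpen U ∧ p ∈ U ∧ ∃ g : ℝ → M → M,
      ContMDiffOn (𝓘(ℝ, ℝ).prod 𝓘(ℝ, E)) 𝓘(ℝ, E) ∞ (fun q : ℝ × M => g q.1 q.2)
        (Ioo (-ε) ε ×ˢ U) ∧
      ∀ x ∈ U, g 0 x = x ∧ ∀ t ∈ Ioo (-ε) ε,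
        HasMFDerivAt 𝓘(ℝ, ℝ) 𝓘(ℝ, E) (fun s => g s x) t (velocity (Z (g t x))) := by
  set c := chartAt E p with hc
  set W : E → E := VectorField.mpullback 𝓘(ℝ, E) 𝓘(ℝ, E) c.symm Z with hW
  have hWs : ContDiffOn ℝ ∞ W c.target := contDiffOn_mpullback_chart hZ p
  have hpt : c p ∈ c.target := mem_chart_target E p
  obtain ⟨r, hr, hball⟩ := Metric.isOpen_iff.1 c.open_target _ hpt
  -- cut off the coordinate expression, to obtain a Lipschitz vector field on `E`
  let b : ContDiffBump (c p) := ⟨r / 4, r / 2, by positivity, by linarith⟩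
  have hbsupp : tsupport b ⊆ c.target := by
    rw [b.tsupport_eq]
    exact (Metric.closedBall_subset_ball (by show r / 2 < r; linarith)).trans hball
  set f : E → E := fun y => b y • W y with hf
  have hfs : ContDiff ℝ ∞ f := by
    rw [contDiff_iff_contDiffAt]
    intro y
    by_cases hy : y ∈ tsupport b
    · exact b.contDiff.contDiffAt.smul
        (hWs.contDiffAt (c.open_target.mem_nhds (hbsupp hy)))
    · have : f =ᶠ[𝓝 y] fun _ => 0 := by
        filter_upwards [(isClosed_tsupport b).isOpen_compl.mem_nhds hy] with z hz
        simp [hf, image_eq_zero_of_notMem_tsupport hz]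
      exact contDiffAt_const.congr_of_eventuallyEq this
  have hfc : HasCompactSupport f := b.hasCompactSupport.smul_right
  obtain ⟨C, hC⟩ := ContDiff.lipschitzWith_of_hasCompactSupport hfc hfs (by simp)
  obtain ⟨ε, hε, g, hg, hgf⟩ := exists_contDiffOn_localFlow hfs hC (c p)
  have hop : IsOpen (Ioo (-ε) ε ×ˢ Metric.ball (c p) ε) := isOpen_Ioo.prod Metric.isOpen_ball
  have hmem : ((0 : ℝ), c p) ∈ Ioo (-ε) ε ×ˢ Metric.ball (c p) ε :=
    ⟨⟨by linarith, hε⟩, Metric.mem_ball_self hε⟩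
  have hgc : ContinuousAt g (0, c p) := (hg.continuousOn.continuousAt (hop.mem_nhds hmem))
  have hev : ∀ᶠ z in 𝓝 ((0 : ℝ), c p), g z ∈ Metric.ball (c p) (r / 4) := by
    have h0 := (hgf (c p) (Metric.mem_ball_self hε)).1
    refine hgc.eventually (p := fun y => y ∈ Metric.ball (c p) (r / 4)) ?_
    rw [h0]
    exact Metric.ball_mem_nhds _ (by positivity)
  obtain ⟨δ, hδ, hδg⟩ := Metric.eventually_nhds_iff_ball.1 hev
  set η := min ε δ with hη
  have hη0 : 0 < η := lt_min hε hδ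
  have hgr : ∀ t ∈ Ioo (-η) η, ∀ y ∈ Metric.ball (c p) η, g (t, y) ∈ Metric.ball (c p) (r / 4) := by
    intro t ht y hy
    refine hδg (t, y) ?_
    rw [← ball_prod_same]
    refine ⟨?_, Metric.ball_subset_ball (min_le_right _ _) hy⟩
    rw [Real.ball_eq_Ioo, zero_sub, zero_add]
    exact ⟨by linarith [ht.1, min_le_right ε δ], by linarith [ht.2, min_le_right ε δ]⟩
  have hsub : Ioo (-η) η ⊆ Ioo (-ε) ε :=
    Ioo_subset_Ioo (by linarith [min_le_left ε δ]) (min_le_left _ _)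
  have hsubb : Metric.ball (c p) η ⊆ Metric.ball (c p) ε :=
    Metric.ball_subset_ball (min_le_left _ _)
  have hr4 : Metric.ball (c p) (r / 4) ⊆ c.target :=
    (Metric.ball_subset_ball (by linarith)).trans hball
  refine ⟨η, hη0, c.source ∩ c ⁻¹' Metric.ball (c p) η,
    c.continuousOn.isOpen_inter_preimage c.open_source Metric.isOpen_ball,
    ⟨mem_chart_source E p, Metric.mem_ball_self hη0⟩, fun t x => c.symm (g (t, c x)), ?_, ?_⟩
  · have h1 : ContMDiffOn (𝓘(ℝ, ℝ).prod 𝓘(ℝ, E)) 𝓘(ℝ, ℝ × E) ∞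
        (fun q : ℝ × M => (q.1, c q.2)) (Ioo (-η) η ×ˢ (c.source ∩ c ⁻¹' Metric.ball (c p) η)) := by
      refine contMDiffOn_fst.prodMk_space ?_
      exact (contMDiffOn_chart (n := ∞) (x := p)).comp contMDiffOn_snd (fun q hq => hq.2.1)
    have h2 : ContMDiffOn (𝓘(ℝ, ℝ).prod 𝓘(ℝ, E)) 𝓘(ℝ, E) ∞
        (fun q : ℝ × M => g (q.1, c q.2))
        (Ioo (-η) η ×ˢ (c.source ∩ c ⁻¹' Metric.ball (c p) η)) :=
      (contMDiffOn_iff_contDiffOn.2 hg).comp h1 (fun q hq => ⟨hsub hq.1, hsubb hq.2.2⟩)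
    exact (contMDiffOn_chart_symm (n := ∞) (x := p)).comp h2
      (fun q hq => hr4 (hgr _ hq.1 _ hq.2.2))
  · rintro x ⟨hxs, hxb⟩
    obtain ⟨h0, hd⟩ := hgf (c x) (hsubb hxb)
    refine ⟨(congrArg c.symm h0).trans (c.left_inv hxs), fun t ht => ?_⟩
    have hin := hgr t ht _ hxb
    have hd' : HasMFDerivAt 𝓘(ℝ, ℝ) 𝓘(ℝ, E) (fun s => g (s, c x)) t
        (velocity (E := E) (W (g (t, c x)))) := by
      have h := hd t (hsub ht)
      have hb : f (g (t, c x)) = W (g (t, c x)) := by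
        have : b (g (t, c x)) = 1 := b.one_of_mem_closedBall (Metric.ball_subset_closedBall hin)
        simp [hf, this]
      rw [hb] at h
      exact h.hasFDerivAt.hasMFDerivAt
    have hs := ((mdifferentiable_chart (I := 𝓘(ℝ, E)) p).symm.mdifferentiableAt (hr4 hin))
    have := hd'.comp_velocity hs
    erw [mfderiv_chart_symm_mpullback (hr4 hin)] at this
    exact this

variable [T2Space M]

/-- A compactly supported smooth vector field has a smooth flow, defined for all times. -/
theorem exists_isFlow {Z : (x : M) → TangentSpace 𝓘(ℝ, E) x}
    (hZ : ContMDiff 𝓘(ℝ, E) 𝓘(ℝ, E).tangent ∞ (fun x => (⟨x, Z x⟩ : TangentBundle 𝓘(ℝ, E) M)))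
    {S : Set M} (hS : IsCompact S) (hZS : ∀ x ∉ S, Z x = 0) :
    ∃ μ : ℝ → M → M, IsFlow Z μ ∧ ∀ x ∉ S, ∀ t, μ t x = x := by
  have hZ1 : ContMDiff 𝓘(ℝ, E) 𝓘(ℝ, E).tangent 1
      (fun x => (⟨x, Z x⟩ : TangentBundle 𝓘(ℝ, E) M)) := hZ.of_le (by norm_cast)
  choose e he U hUo hpU g hg hgx using fun p => exists_flowBox hZ p
  obtain ⟨T, -, hT⟩ := hS.elim_nhds_subcover U (fun p _ => (hUo p).mem_nhds (hpU p))
  obtain ⟨ε, hε, hεe⟩ : ∃ ε > 0, ∀ p ∈ T, ε ≤ e p := by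
    rcases T.eq_empty_or_nonempty with rfl | hne
    · exact ⟨1, one_pos, by simp⟩
    · exact ⟨T.inf' hne e, (Finset.lt_inf'_iff hne).2 fun p _ => he p,
        fun p hp => Finset.inf'_le e hp⟩
  have hsub : ∀ p ∈ T, Ioo (-ε) ε ⊆ Ioo (-e p) (e p) := fun p hp =>
    Ioo_subset_Ioo (neg_le_neg (hεe p hp)) (hεe p hp)
  have hbox : ∀ p ∈ T, ∀ x ∈ U p, IsMIntegralCurveOn (fun t => g p t x) Z (Ioo (-ε) ε) :=
    fun p hp x hx t ht => ((hgx p x hx).2 t (hsub p hp ht)).hasMFDerivWithinAt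
  have hshort : ∀ x : M, ∃ γ : ℝ → M, γ 0 = x ∧ IsMIntegralCurveOn γ Z (Ioo (-ε) ε) := by
    intro x
    by_cases hx : x ∈ S
    · obtain ⟨p, hp, hxp⟩ := mem_iUnion₂.1 (hT hx)
      exact ⟨fun t => g p t x, (hgx p x hxp).1, hbox p hp x hxp⟩
    · exact ⟨fun _ => x, rfl, (isMIntegralCurve_const (hZS x hx)).isMIntegralCurveOn _⟩
  choose γ hγ0 hγ using exists_isMIntegralCurve_of_isMIntegralCurveOn hZ1 hε hshort
  have hout : ∀ x ∉ S, ∀ t, γ x t = x := by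
    intro x hx t
    exact congrFun (isMIntegralCurve_Ioo_eq_of_contMDiff_boundaryless (t₀ := 0) hZ1 (hγ x)
      (isMIntegralCurve_const (hZS x hx)) (hγ0 x)) t
  have hadd : ∀ s t x, γ x (s + t) = γ (γ x t) s := by
    intro s t x
    exact congrFun (isMIntegralCurve_Ioo_eq_of_contMDiff_boundaryless (t₀ := 0) hZ1
      ((hγ x).comp_add t) (hγ (γ x t)) (by simp [hγ0])) s
  refine ⟨fun t x => γ x t, ⟨?_, hγ0, hγ, hadd⟩, hout⟩
  refine contMDiff_of_contMDiffOn_short_time (μ := fun t x => γ x t) hε ?_ hadd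
  rintro ⟨t, x⟩ ⟨ht, -⟩
  refine ContMDiffAt.contMDiffWithinAt ?_
  by_cases hx : x ∈ S
  · obtain ⟨p, hp, hxp⟩ := mem_iUnion₂.1 (hT hx)
    have hop : Ioo (-ε) ε ×ˢ U p ∈ 𝓝 (t, x) := (isOpen_Ioo.prod (hUo p)).mem_nhds ⟨ht, hxp⟩
    have h1 := ((hg p).mono (prod_mono_left (hsub p hp))).contMDiffAt hop
    refine h1.congr_of_eventuallyEq ?_
    filter_upwards [hop] with q hq
    exact isMIntegralCurveOn_Ioo_eqOn_of_contMDiff_boundaryless (t₀ := 0) ⟨by linarith, hε⟩ hZ1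
      ((hγ q.2).isMIntegralCurveOn _) (hbox p hp q.2 hq.2)
      ((hγ0 _).trans (hgx p q.2 hq.2).1.symm) hq.1
  · refine contMDiffAt_snd.congr_of_eventuallyEq ?_
    filter_upwards [(isOpen_univ.prod hS.isClosed.isOpen_compl).mem_nhds
      (show (t, x) ∈ univ ×ˢ Sᶜ from ⟨mem_univ _, hx⟩)] with q hq
    exact hout q.2 hq.2 q.1

end ManifoldFlow

variable {d : ℕ}

/-! ### The top exterior power of a bilinear form -/

section Wedge

variable {V : Type*} [AddCommGroup V] [Module ℝ V]

/-- The product of the values of a bilinear form on consecutive pairs of vectors, as a multilinear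
map. -/
def pairProduct (d : ℕ) (B : V →ₗ[ℝ] V →ₗ[ℝ] ℝ) : MultilinearMap ℝ (fun _ : Fin (2 * d) => V) ℝ :=
  let F := fun (v : Fin (2 * d) → V) (i : Fin d) =>
    B (v ⟨2 * i, by omega⟩) (v ⟨2 * i + 1, by omega⟩)
  have hne : ∀ (v : Fin (2 * d) → V) (j : Fin (2 * d)) (x : V) (i : Fin d),
      i ≠ ⟨j / 2, by omega⟩ → F (Function.update v j x) i = F v i := by
    intro v j x i hi
    have h1 : (⟨2 * i, by omega⟩ : Fin (2 * d)) ≠ j := by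
      rintro rfl; exact hi (by ext; simp)
    have h2 : (⟨2 * i + 1, by omega⟩ : Fin (2 * d)) ≠ j := by
      rintro rfl; exact hi (by ext; simp; omega)
    simp only [F, Function.update_of_ne h1, Function.update_of_ne h2]
  have hprod : ∀ (v : Fin (2 * d) → V) (j : Fin (2 * d)) (x : V),
      ∏ i, F (Function.update v j x) i =
        F (Function.update v j x) ⟨j / 2, by omega⟩ *
          ∏ i ∈ Finset.univ.erase (⟨j / 2, by omega⟩ : Fin d), F v i := by
    intro v j x
    rw [← Finset.mul_prod_erase _ _ (Finset.mem_univ (⟨j / 2, by omega⟩ : Fin d))]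
    congr 1
    exact Finset.prod_congr rfl fun i hi => hne v j x i (Finset.ne_of_mem_erase hi)
  have hpar : ∀ j : Fin (2 * d), (j = ⟨2 * (j / 2), by omega⟩ ∧
        (⟨2 * (j / 2) + 1, by omega⟩ : Fin (2 * d)) ≠ j) ∨
      ((⟨2 * (j / 2), by omega⟩ : Fin (2 * d)) ≠ j ∧ j = ⟨2 * (j / 2) + 1, by omega⟩) := by
    intro j
    simp only [ne_eq, Fin.ext_iff]
    omega
  MultilinearMap.mk' (fun v => ∏ i, F v i)
    (by
      intro v j x y
      rw [hprod, hprod, hprod, ← add_mul]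
      congr 1
      rcases hpar j with ⟨h1, h2⟩ | ⟨h1, h2⟩
      · simp only [F, Function.update_of_ne h2]
        rw [← h1]
        simp
      · simp only [F, Function.update_of_ne h1]
        rw [← h2]
        simp)
    (by
      intro v j c x
      rw [hprod, hprod, smul_eq_mul, ← mul_assoc]
      congr 1
      rcases hpar j with ⟨h1, h2⟩ | ⟨h1, h2⟩
      · simp only [F, Function.update_of_ne h2]
        rw [← h1]
        simp
      · simp only [F, Function.update_of_ne h1]
        rw [← h2]
        simp)

/-- The wedge power is an alternating form, so that it transforms with the determinant. -/
lemma wedgePower_eq_alternatization (B : V →ₗ[ℝ] V →ₗ[ℝ] ℝ) (v : Fin (2 * d) → V) :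
    wedgePower (fun x y => B x y) v =
      (1 / 2 ^ d : ℝ) * MultilinearMap.alternatization (pairProduct d B) v := by
  rw [wedgePower, MultilinearMap.alternatization_apply]
  congr 1
  refine Finset.sum_congr rfl fun σ _ => ?_
  rw [Units.smul_def, zsmul_eq_mul]
  rfl

lemma wedgePower_comp_linearMap (b : Module.Basis (Fin (2 * d)) ℝ V)
    (B : V →ₗ[ℝ] V →ₗ[ℝ] ℝ) (A : V →ₗ[ℝ] V) :
    wedgePower (fun x y => B (A x) (A y)) b =
      LinearMap.det A * wedgePower (fun x y => B x y) b := by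
  have h : wedgePower (fun x y => B (A x) (A y)) b = wedgePower (fun x y => B x y) (A ∘ b) := rfl
  rw [h, wedgePower_eq_alternatization, wedgePower_eq_alternatization]
  set f : V [⋀^Fin (2 * d)]→ₗ[ℝ] ℝ := MultilinearMap.alternatization (pairProduct d B)
  rw [f.eq_smul_basis_det b]
  simp only [AlternatingMap.smul_apply, Module.Basis.det_comp, Module.Basis.det_self, smul_eq_mul]
  ring

lemma wedgePower_const_mul {V : Type*} (B : V → V → ℝ) (a : ℝ) (v : Fin (2 * d) → V) :
    wedgePower (fun x y => a * B x y) v = a ^ d * wedgePower B v := by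
  simp only [wedgePower, Finset.prod_mul_distrib, Finset.prod_const, Finset.card_univ,
    Fintype.card_fin, Finset.mul_sum]
  exact Finset.sum_congr rfl fun σ _ => by ring

end Wedge

/-! ### The measure `Ω ^ d` in charts -/

section Measure

variable {M : Type*} [TopologicalSpace M] [ChartedSpace (EuclideanSpace ℝ (Fin (2 * d))) M]
  {Ω : (x : M) → TangentSpace (𝓡 (2 * d)) x →L[ℝ] TangentSpace (𝓡 (2 * d)) x →L[ℝ] ℝ}

local notation "𝔼" => EuclideanSpace ℝ (Fin (2 * d))

lemma wedgePower_comp_clm (B : 𝔼 →L[ℝ] 𝔼 →L[ℝ] ℝ) (A : 𝔼 →L[ℝ] 𝔼) :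
    wedgePower (fun x y => B (A x) (A y)) (fun i => EuclideanSpace.single i (1 : ℝ)) =
      A.det * wedgePower (fun x y => B x y) (fun i => EuclideanSpace.single i (1 : ℝ)) := by
  have := wedgePower_comp_linearMap (EuclideanSpace.basisFun (Fin (2 * d)) ℝ).toBasis
    (LinearMap.mk₂ ℝ (fun x y => B x y) (by simp) (by simp) (by simp) (by simp)) A.toLinearMap
  have hb : ⇑(EuclideanSpace.basisFun (Fin (2 * d)) ℝ).toBasis =
      fun i => EuclideanSpace.single i (1 : ℝ) := by
    ext1 i; simp
  rw [hb] at this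
  exact this

lemma coordTwoForm_of_comp {e c : OpenPartialHomeomorph M 𝔼} {y y' : 𝔼} {A : 𝔼 →L[ℝ] 𝔼}
    (hy : e.symm y = c.symm y')
    (hA : (mfderiv (𝓡 (2 * d)) (𝓡 (2 * d)) e.symm y : 𝔼 →L[ℝ] 𝔼) =
      (mfderiv (𝓡 (2 * d)) (𝓡 (2 * d)) c.symm y' : 𝔼 →L[ℝ] 𝔼) ∘L A) (u v : 𝔼) :
    coordTwoForm Ω e y u v = coordTwoForm Ω c y' (A u) (A v) := by
  unfold coordTwoForm
  have h1 : ∀ w : 𝔼, (mfderiv (𝓡 (2 * d)) (𝓡 (2 * d)) e.symm y : 𝔼 →L[ℝ] 𝔼) w =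
      (mfderiv (𝓡 (2 * d)) (𝓡 (2 * d)) c.symm y' : 𝔼 →L[ℝ] 𝔼) (A w) := fun w => by rw [hA]; rfl
  have h2 : ∀ (x x' : M) (hx : x = x') (a b : 𝔼),
      (Ω x : 𝔼 →L[ℝ] 𝔼 →L[ℝ] ℝ) a b = (Ω x' : 𝔼 →L[ℝ] 𝔼 →L[ℝ] ℝ) a b := by
    rintro x _ rfl a b; rfl
  refine (h2 _ _ hy _ _).trans ?_
  exact congrArg₂ (fun a b => (Ω (c.symm y') : 𝔼 →L[ℝ] 𝔼 →L[ℝ] ℝ) a b) (h1 u) (h1 v)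

lemma density_of_comp {e c : OpenPartialHomeomorph M 𝔼} {y y' : 𝔼} {A : 𝔼 →L[ℝ] 𝔼}
    (h : ∀ u v, coordTwoForm Ω e y u v = coordTwoForm Ω c y' (A u) (A v)) :
    density Ω e y = |A.det| * density Ω c y' := by
  have h1 : coordTwoForm Ω e y = fun u v => coordTwoForm Ω c y' (A u) (A v) := by
    ext u v; exact h u v
  let L : 𝔼 →L[ℝ] 𝔼 := mfderiv (𝓡 (2 * d)) (𝓡 (2 * d)) c.symm y'
  let B : 𝔼 →L[ℝ] 𝔼 →L[ℝ] ℝ := Ω (c.symm y')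
  have h2 := wedgePower_comp_clm (B.bilinearComp L L) A
  rw [density, density, ← abs_mul, h1]
  exact congrArg abs h2

omit [ChartedSpace 𝔼 M] in
lemma measurableSet_target_inter_preimage [MeasurableSpace M] [BorelSpace M]
    (e : OpenPartialHomeomorph M 𝔼) {A : Set M} (hA : MeasurableSet A) :
    MeasurableSet (e.target ∩ e.symm ⁻¹' A) := by
  have h : Measurable (e.target.domRestrict e.symm) :=
    (continuousOn_iff_continuous_domRestrict.1 e.continuousOn_symm).measurable
  have h2 := e.open_target.measurableSet.subtype_image (h hA)
  convert h2 using 1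
  ext y
  simp [Set.domRestrict, and_comm]

lemma chartMeasure_apply [MeasurableSpace M] [BorelSpace M] (c : OpenPartialHomeomorph M 𝔼)
    {D A : Set M} (hD : MeasurableSet D) (hA : MeasurableSet A) :
    chartMeasure Ω c D A =
      ∫⁻ y in c.target ∩ c.symm ⁻¹' (D ∩ A), ENNReal.ofReal (density Ω c y) := by
  have hms := measurableSet_target_inter_preimage c hD
  have hmeas : AEMeasurable c.symm ((volume.restrict (c.target ∩ c.symm ⁻¹' D)).withDensity
      (fun y => ENNReal.ofReal (density Ω c y))) :=
    ((c.continuousOn_symm.mono inter_subset_left).aemeasurable hms).mono_ac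
      (withDensity_absolutelyContinuous _ _)
  have hsub : ((volume.restrict (c.target ∩ c.symm ⁻¹' D)).withDensity
      (fun y => ENNReal.ofReal (density Ω c y))) (c.symm ⁻¹' A) =
      ((volume.restrict (c.target ∩ c.symm ⁻¹' D)).withDensity
      (fun y => ENNReal.ofReal (density Ω c y))) (c.target ∩ c.symm ⁻¹' A) := by
    refine measure_congr ?_
    have : ∀ᵐ y ∂((volume.restrict (c.target ∩ c.symm ⁻¹' D)).withDensity
      (fun y => ENNReal.ofReal (density Ω c y))), y ∈ c.target := by
      refine (withDensity_absolutelyContinuous _ _).ae_le ?_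
      filter_upwards [ae_restrict_mem hms] with y hy using hy.1
    filter_upwards [this] with y hy
    simp only [eq_iff_iff]
    exact ⟨fun h => ⟨hy, h⟩, fun h => h.2⟩
  rw [chartMeasure, Measure.map_apply_of_aemeasurable hmeas hA, hsub,
    withDensity_apply _ (measurableSet_target_inter_preimage c hA),
    Measure.restrict_restrict (measurableSet_target_inter_preimage c hA)]
  congr 2
  ext y
  simp only [mem_inter_iff, mem_preimage]
  tauto

open IsManifold in
/-- The density of `Ω ^ d` transforms with the Jacobian determinant under a change of charts. -/
lemma density_change {e c : OpenPartialHomeomorph M 𝔼} (he : e ∈ maximalAtlas (𝓡 (2 * d)) ∞ M)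
    (hc : c ∈ maximalAtlas (𝓡 (2 * d)) ∞ M) {y : 𝔼} (hy : y ∈ e.target)
    (hyc : e.symm y ∈ c.source) :
    DifferentiableAt ℝ (fun z => c (e.symm z)) y ∧
    density Ω e y = |(fderiv ℝ (fun z => c (e.symm z)) y).det| * density Ω c (c (e.symm y)) := by
  have h1 : MDifferentiableAt (𝓡 (2 * d)) (𝓡 (2 * d)) e.symm y :=
    (contMDiffAt_symm_of_mem_maximalAtlas he hy).mdifferentiableAt (by simp)
  have h2 : MDifferentiableAt (𝓡 (2 * d)) (𝓡 (2 * d)) c (e.symm y) :=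
    (contMDiffAt_of_mem_maximalAtlas hc hyc).mdifferentiableAt (by simp)
  have h3 : MDifferentiableAt (𝓡 (2 * d)) (𝓡 (2 * d)) c.symm (c (e.symm y)) :=
    (contMDiffAt_symm_of_mem_maximalAtlas hc (c.map_source hyc)).mdifferentiableAt (by simp)
  have hT : DifferentiableAt ℝ (fun z => c (e.symm z)) y :=
    mdifferentiableAt_iff_differentiableAt.1 (h2.comp y h1)
  refine ⟨hT, density_of_comp (coordTwoForm_of_comp (c.left_inv hyc).symm ?_)⟩
  have heq : e.symm =ᶠ[𝓝 y] fun z => c.symm (c (e.symm z)) := by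
    have : ∀ᶠ z in 𝓝 y, e.symm z ∈ c.source :=
      h1.continuousAt.eventually (c.open_source.mem_nhds hyc)
    filter_upwards [this] with z hz using (c.left_inv hz).symm
  rw [heq.mfderiv_eq, ← mfderiv_eq_fderiv]
  exact mfderiv_comp y h3 (hT.mdifferentiableAt)

open IsManifold in
lemma setLIntegral_density_change [MeasurableSpace M] [BorelSpace M]
    {e c : OpenPartialHomeomorph M 𝔼} (he : e ∈ maximalAtlas (𝓡 (2 * d)) ∞ M)
    (hc : c ∈ maximalAtlas (𝓡 (2 * d)) ∞ M) {D : Set M} (hD : MeasurableSet D)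
    (hDe : D ⊆ e.source) (hDc : D ⊆ c.source) :
    ∫⁻ y in c.target ∩ c.symm ⁻¹' D, ENNReal.ofReal (density Ω c y) =
      ∫⁻ y in e.target ∩ e.symm ⁻¹' D, ENNReal.ofReal (density Ω e y) := by
  have himg : (fun z => c (e.symm z)) '' (e.target ∩ e.symm ⁻¹' D) = c.target ∩ c.symm ⁻¹' D := by
    ext y
    constructor
    · rintro ⟨z, ⟨-, hz⟩, rfl⟩
      exact ⟨c.map_source (hDc hz), by simpa [c.left_inv (hDc hz)] using hz⟩
    · rintro ⟨hy, hyD⟩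
      refine ⟨e (c.symm y), ⟨e.map_source (hDe hyD), ?_⟩, ?_⟩
      · simpa [e.left_inv (hDe hyD)] using hyD
      · simp [e.left_inv (hDe hyD), c.right_inv hy]
  rw [← himg, lintegral_image_eq_lintegral_abs_det_fderiv_mul volume
    (measurableSet_target_inter_preimage e hD)
    (f' := fun y => fderiv ℝ (fun z => c (e.symm z)) y)]
  · refine setLIntegral_congr_fun (measurableSet_target_inter_preimage e hD) fun y hy => ?_
    rw [(density_change he hc hy.1 (hDc hy.2)).2, ENNReal.ofReal_mul (abs_nonneg _)]
  · exact fun y hy =>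
      (density_change (Ω := Ω) he hc hy.1 (hDc hy.2)).1.hasFDerivAt.hasFDerivWithinAt
  · intro y hy z hz hyz
    have := c.injOn (hDc hy.2) (hDc hz.2) hyz
    exact e.symm.injOn hy.1 hz.1 this

variable [IsManifold (𝓡 (2 * d)) ∞ M]

open IsManifold in
/-- The measure `Ω ^ d` is computed by its density in any smooth chart. -/
theorem liouvilleMeasure_apply [SecondCountableTopology M] [MeasurableSpace M] [BorelSpace M]
    {e : OpenPartialHomeomorph M 𝔼} (he : e ∈ maximalAtlas (𝓡 (2 * d)) ∞ M)
    {A : Set M} (hA : MeasurableSet A) (hAe : A ⊆ e.source) :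
    liouvilleMeasure Ω A = ∫⁻ y in e.target ∩ e.symm ⁻¹' A, ENNReal.ofReal (density Ω e y) := by
  rcases isEmpty_or_nonempty M with hM | hM
  · have : e.target ∩ e.symm ⁻¹' A = ∅ := by
      ext y; exact ⟨fun _ => hM.elim (e.symm y), fun h => h.elim⟩
    rw [this, Set.eq_empty_of_isEmpty A]
    simp
  have h := exists_chart_cover (d := d) (M := M)
  rw [liouvilleMeasure, dif_pos h, Measure.sum_apply _ hA]
  set p := h.choose
  have hcov := h.choose_spec
  set D := disjointed (fun k => (chartAt 𝔼 (p k)).source) with hDdef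
  have hDm : ∀ n, MeasurableSet (D n) := fun n =>
    MeasurableSet.disjointed (fun k => (chartAt 𝔼 (p k)).open_source.measurableSet) n
  have hDs : ∀ n, D n ⊆ (chartAt 𝔼 (p n)).source := fun n => disjointed_subset _ n
  have hUn : ⋃ n, D n = univ := by rw [hDdef, iUnion_disjointed]; exact hcov
  have hterm : ∀ n, chartMeasure Ω (chartAt 𝔼 (p n)) (D n) A =
      ∫⁻ y in e.target ∩ e.symm ⁻¹' (D n ∩ A), ENNReal.ofReal (density Ω e y) := fun n => by
    rw [chartMeasure_apply _ (hDm n) hA]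
    exact setLIntegral_density_change he (chart_mem_maximalAtlas _) ((hDm n).inter hA)
      (inter_subset_right.trans hAe) (inter_subset_left.trans (hDs n))
  have hAU : e.target ∩ e.symm ⁻¹' A = ⋃ n, e.target ∩ e.symm ⁻¹' (D n ∩ A) := by
    rw [← inter_iUnion, ← preimage_iUnion, ← iUnion_inter, hUn, univ_inter]
  rw [hAU, lintegral_iUnion
    (fun n => measurableSet_target_inter_preimage e ((hDm n).inter hA))]
  · exact tsum_congr hterm
  · intro m n hmn
    have : Disjoint (D m) (D n) := disjoint_disjointed _ hmn
    refine Disjoint.mono inter_subset_right inter_subset_right ?_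
    exact (this.mono inter_subset_left inter_subset_left).preimage _

open IsManifold in
lemma trans_chart_mem_maximalAtlas (ψ : M ≃ₘ^∞⟮𝓡 (2 * d), 𝓡 (2 * d)⟯ M) (q : M) :
    ψ.toHomeomorph.toOpenPartialHomeomorph.trans (chartAt 𝔼 q) ∈
      maximalAtlas (𝓡 (2 * d)) ∞ M := by
  refine OpenPartialHomeomorph.mem_maximalAtlas_of_contMDiffOn _ ?_ ?_
  · exact (contMDiffOn_chart (I := 𝓡 (2 * d)) (n := ∞) (x := q)).comp ψ.contMDiff.contMDiffOn
      (fun x hx => by simpa using hx)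
  · exact ψ.symm.contMDiff.comp_contMDiffOn
      ((contMDiffOn_chart_symm (I := 𝓡 (2 * d)) (n := ∞) (x := q)).mono (by simp))

variable [SecondCountableTopology M] [MeasurableSpace M] [BorelSpace M]

/-- A diffeomorphism that multiplies `Ω` by `a` on `A` multiplies `Ω ^ d` by `a ^ d` there. -/
theorem liouvilleMeasure_image (ψ : M ≃ₘ^∞⟮𝓡 (2 * d), 𝓡 (2 * d)⟯ M) {a : ℝ} (ha : 0 < a)
    {A : Set M} (hA : MeasurableSet A)
    (hψ : ∀ x ∈ A, ∀ u v, Ω (ψ x) (mfderiv (𝓡 (2 * d)) (𝓡 (2 * d)) ψ x u)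
      (mfderiv (𝓡 (2 * d)) (𝓡 (2 * d)) ψ x v) = a * Ω x u v) :
    liouvilleMeasure Ω (ψ '' A) = ENNReal.ofReal (a ^ d) * liouvilleMeasure Ω A := by
  have himg : ∀ B : Set M, MeasurableSet B → MeasurableSet (ψ '' B) := fun B hB =>
    ψ.toHomeomorph.measurableEmbedding.measurableSet_image.2 hB
  -- the case of a set whose image lies in the domain of a chart
  have key : ∀ (q : M) (B : Set M), MeasurableSet B → B ⊆ A → B ⊆ ψ ⁻¹' (chartAt 𝔼 q).source →
      liouvilleMeasure Ω (ψ '' B) = ENNReal.ofReal (a ^ d) * liouvilleMeasure Ω B := by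
    intro q B hB hBA hBq
    set c := chartAt 𝔼 q
    set e := ψ.toHomeomorph.toOpenPartialHomeomorph.trans c with he
    have hem := trans_chart_mem_maximalAtlas ψ q
    have hesymm : ∀ y, e.symm y = ψ.symm (c.symm y) := fun y => rfl
    rw [liouvilleMeasure_apply (IsManifold.chart_mem_maximalAtlas q) (himg B hB)
        (image_subset_iff.2 hBq),
      liouvilleMeasure_apply hem hB (fun x hx => by simpa using hBq hx)]
    have hset : c.target ∩ c.symm ⁻¹' (ψ '' B) = e.target ∩ e.symm ⁻¹' B := by
      ext y
      simp only [mem_inter_iff, mem_preimage, hesymm]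
      have h1 : y ∈ e.target ↔ y ∈ c.target := by simp [he]
      rw [h1]
      refine and_congr_right fun _ => ⟨?_, fun h => ⟨_, h, ψ.apply_symm_apply _⟩⟩
      rintro ⟨x, hx, hxy⟩
      rwa [← hxy, ψ.symm_apply_apply]
    change ∫⁻ y in c.target ∩ c.symm ⁻¹' (ψ '' B), _ = _
    rw [hset, ← lintegral_const_mul' _ _ ENNReal.ofReal_ne_top]
    refine setLIntegral_congr_fun (measurableSet_target_inter_preimage e hB) fun y hy => ?_
    have hyc : y ∈ c.target := by rw [← hset] at hy; exact hy.1
    change ENNReal.ofReal (density Ω c y) = ENNReal.ofReal (a ^ d) * ENNReal.ofReal (density Ω e y)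
    rw [← ENNReal.ofReal_mul (by positivity)]
    congr 1
    have hcs : MDifferentiableAt (𝓡 (2 * d)) (𝓡 (2 * d)) c.symm y :=
      ((contMDiffOn_chart_symm (n := ∞) (x := q)).contMDiffAt
        (c.open_target.mem_nhds hyc)).mdifferentiableAt (by simp)
    have hes : MDifferentiableAt (𝓡 (2 * d)) (𝓡 (2 * d)) e.symm y :=
      (ψ.symm.mdifferentiable (by simp) _).comp y hcs
    have hpt : c.symm y = ψ (e.symm y) := by rw [hesymm, ψ.apply_symm_apply]
    have hd : (mfderiv (𝓡 (2 * d)) (𝓡 (2 * d)) c.symm y : 𝔼 →L[ℝ] 𝔼) =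
        (mfderiv (𝓡 (2 * d)) (𝓡 (2 * d)) ψ (e.symm y) : 𝔼 →L[ℝ] 𝔼) ∘L
          (mfderiv (𝓡 (2 * d)) (𝓡 (2 * d)) e.symm y : 𝔼 →L[ℝ] 𝔼) := by
      have h1 : (c.symm : 𝔼 → M) = ψ ∘ e.symm := by
        ext z; simp [hesymm]
      rw [h1]
      exact mfderiv_comp y (ψ.mdifferentiable (by simp) _) hes
    have hform : coordTwoForm Ω c y = fun u v => a * coordTwoForm Ω e y u v := by
      ext u v
      refine Eq.trans ?_ (hψ (e.symm y) (hBA hy.2) _ _)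
      have h2 : ∀ (x x' : M) (_ : x = x') (L L' : 𝔼 →L[ℝ] 𝔼) (_ : L = L'),
          (Ω x : 𝔼 →L[ℝ] 𝔼 →L[ℝ] ℝ) (L u) (L v) =
            (Ω x' : 𝔼 →L[ℝ] 𝔼 →L[ℝ] ℝ) (L' u) (L' v) := by
        rintro x _ rfl L _ rfl; rfl
      exact h2 _ _ hpt _ _ hd
    rw [density, density, hform, wedgePower_const_mul, abs_mul, abs_of_pos (by positivity)]
  rcases isEmpty_or_nonempty M with hM | hM
  · simp [Set.eq_empty_of_isEmpty A]
  obtain ⟨p, hp⟩ := exists_chart_cover (d := d) (M := M)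
  set D := disjointed (fun k => (chartAt 𝔼 (p k)).source) with hDdef
  have hDm : ∀ n, MeasurableSet (D n) := fun n =>
    MeasurableSet.disjointed (fun k => (chartAt 𝔼 (p k)).open_source.measurableSet) n
  have hUn : ⋃ n, D n = univ := by rw [hDdef, iUnion_disjointed]; exact hp
  have hBm : ∀ n, MeasurableSet (A ∩ ψ ⁻¹' D n) := fun n =>
    hA.inter (ψ.continuous.measurable (hDm n))
  have hdisj : Pairwise (Function.onFun Disjoint fun n => A ∩ ψ ⁻¹' D n) := fun m n hmn =>
    ((disjoint_disjointed _ hmn).preimage ψ).mono inter_subset_right inter_subset_right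
  have hAU : A = ⋃ n, A ∩ ψ ⁻¹' D n := by
    rw [← inter_iUnion, ← preimage_iUnion, hUn, preimage_univ, inter_univ]
  rw [hAU, image_iUnion, measure_iUnion hdisj hBm, measure_iUnion _ fun n => himg _ (hBm n),
    ← ENNReal.tsum_mul_left]
  · exact tsum_congr fun n => key (p n) _ (hBm n) inter_subset_left
      (inter_subset_right.trans (preimage_mono (disjointed_subset _ n)))
  · exact fun m n hmn => (disjoint_image_iff ψ.injective).2 (hdisj hmn)

/-- Change of variables for a diffeomorphism that multiplies `Ω` by `a` on an open set which
contains the preimage of the support of the integrand. -/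
theorem integral_comp_diffeo (ψ : M ≃ₘ^∞⟮𝓡 (2 * d), 𝓡 (2 * d)⟯ M) {a : ℝ} (ha : 0 < a)
    {U : Set M} (hU : IsOpen U)
    (hψ : ∀ x ∈ U, ∀ u v, Ω (ψ x) (mfderiv (𝓡 (2 * d)) (𝓡 (2 * d)) ψ x u)
      (mfderiv (𝓡 (2 * d)) (𝓡 (2 * d)) ψ x v) = a * Ω x u v)
    {f : M → ℝ} (hf : ∀ x ∉ U, f (ψ x) = 0) :
    ∫ x, f x ∂(liouvilleMeasure Ω) = a ^ d * ∫ x, f (ψ x) ∂(liouvilleMeasure Ω) := by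
  have hemb := ψ.toHomeomorph.measurableEmbedding
  have hmap : (liouvilleMeasure Ω).restrict (ψ '' U) =
      ENNReal.ofReal (a ^ d) • Measure.map ψ ((liouvilleMeasure Ω).restrict U) := by
    ext B hB
    have hB' : MeasurableSet (ψ ⁻¹' B) := ψ.continuous.measurable hB
    rw [Measure.restrict_apply hB, Measure.smul_apply, smul_eq_mul,
      Measure.map_apply ψ.continuous.measurable hB, Measure.restrict_apply hB',
      ← liouvilleMeasure_image ψ ha (hB'.inter hU.measurableSet) fun x hx => hψ x hx.2,
      image_preimage_inter]
  have h1 : ∫ x in ψ '' U, f x ∂(liouvilleMeasure Ω) = ∫ x, f x ∂(liouvilleMeasure Ω) := by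
    refine setIntegral_eq_integral_of_forall_compl_eq_zero fun y hy => ?_
    rw [← ψ.apply_symm_apply y]
    exact hf _ fun h => hy ⟨_, h, ψ.apply_symm_apply y⟩
  have h2 : ∫ x in U, f (ψ x) ∂(liouvilleMeasure Ω) = ∫ x, f (ψ x) ∂(liouvilleMeasure Ω) :=
    setIntegral_eq_integral_of_forall_compl_eq_zero hf
  rw [← h1, ← h2, hmap, integral_smul_measure, ENNReal.toReal_ofReal (by positivity), smul_eq_mul]
  congr 1
  exact hemb.integral_map f

omit [SecondCountableTopology M] [MeasurableSpace M] [BorelSpace M] [IsManifold (𝓡 (2 * d)) ∞ M] in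
lemma continuousOn_density {lam : (x : M) → TangentSpace (𝓡 (2 * d)) x →L[ℝ] ℝ}
    (hΩ : IsExactSymplectic Ω lam) {c : OpenPartialHomeomorph M 𝔼} (hc : c ∈ atlas 𝔼 M) :
    ContinuousOn (density Ω c) c.target := by
  have hfd : ContinuousOn (fderiv ℝ (coordOneForm lam c)) c.target :=
    (hΩ.smooth c hc).continuousOn_fderiv_of_isOpen c.open_target (by simp)
  have hB : ∀ u v, ContinuousOn (fun y => coordTwoForm Ω c y u v) c.target := by
    intro u v
    refine ContinuousOn.congr ?_ fun y hy => hΩ.eq_d c hc y hy u v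
    fun_prop
  refine ContinuousOn.abs ?_
  unfold wedgePower
  refine continuousOn_const.mul (continuousOn_finsetSum _ fun σ _ => continuousOn_const.mul ?_)
  exact continuousOn_finsetProd _ fun i _ => hB _ _

theorem isFiniteMeasureOnCompacts_liouvilleMeasure
    {lam : (x : M) → TangentSpace (𝓡 (2 * d)) x →L[ℝ] ℝ} (hΩ : IsExactSymplectic Ω lam) :
    IsFiniteMeasureOnCompacts (liouvilleMeasure Ω) := by
  have : IsLocallyFiniteMeasure (liouvilleMeasure Ω) := by
    refine ⟨fun x => ?_⟩
    set c := chartAt 𝔼 x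
    obtain ⟨r, hr, hball⟩ := Metric.nhds_basis_closedBall.mem_iff.1
      (c.open_target.mem_nhds (mem_chart_target 𝔼 x))
    have hcont : ContinuousOn (fun y => ENNReal.ofReal (density Ω c y))
        (Metric.closedBall (c x) r) :=
      (ENNReal.continuous_ofReal.comp_continuousOn
        ((continuousOn_density hΩ (chart_mem_atlas 𝔼 x)).mono hball))
    obtain ⟨y₀, -, hy₀⟩ := (isCompact_closedBall (c x) r).exists_isMaxOn
      ⟨c x, Metric.mem_closedBall_self hr.le⟩ hcont
    have hopen : IsOpen (c.source ∩ c ⁻¹' Metric.ball (c x) r) :=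
      c.continuousOn.isOpen_inter_preimage c.open_source Metric.isOpen_ball
    refine ⟨c.source ∩ c ⁻¹' Metric.ball (c x) r,
      hopen.mem_nhds ⟨mem_chart_source 𝔼 x, Metric.mem_ball_self hr⟩, ?_⟩
    rw [liouvilleMeasure_apply (IsManifold.chart_mem_maximalAtlas x) hopen.measurableSet
      inter_subset_left]
    have hsub : c.target ∩ c.symm ⁻¹' (c.source ∩ c ⁻¹' Metric.ball (c x) r) ⊆
        Metric.closedBall (c x) r := by
      rintro y ⟨hy, -, hy2⟩
      rw [mem_preimage, c.right_inv hy] at hy2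
      exact Metric.ball_subset_closedBall hy2
    refine lt_of_le_of_lt (lintegral_mono_set hsub) ?_
    refine lt_of_le_of_lt (setLIntegral_mono' Metric.isClosed_closedBall.measurableSet
      fun y hy => hy₀ hy) ?_
    rw [setLIntegral_const]
    exact ENNReal.mul_lt_top ENNReal.ofReal_lt_top measure_closedBall_lt_top
  infer_instance

end Measure

/-! ### Pullbacks of the Liouville form -/

section Pullback

variable {d : ℕ} {M : Type*} [TopologicalSpace M]
  [ChartedSpace (EuclideanSpace ℝ (Fin (2 * d))) M]
  {Ω : (x : M) → TangentSpace (𝓡 (2 * d)) x →L[ℝ] TangentSpace (𝓡 (2 * d)) x →L[ℝ] ℝ}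
  {lam : (x : M) → TangentSpace (𝓡 (2 * d)) x →L[ℝ] ℝ}
  {V : Type*} [NormedAddCommGroup V] [NormedSpace ℝ V]

local notation "𝔼" => EuclideanSpace ℝ (Fin (2 * d))

/-- The pullback of a 1-form by a map from a normed space. -/
def pullOneForm (lam : (x : M) → TangentSpace (𝓡 (2 * d)) x →L[ℝ] ℝ) (σ : V → M) (z : V) :
    V →L[ℝ] ℝ :=
  (lam (σ z)).comp (mfderiv 𝓘(ℝ, V) (𝓡 (2 * d)) σ z)

lemma pullOneForm_apply (σ : V → M) (z v : V) :
    pullOneForm lam σ z v = lam (σ z) (mfderiv 𝓘(ℝ, V) (𝓡 (2 * d)) σ z v) := rfl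

/-- Transport along an equality of base points. All tangent spaces are equal to the model space, so
that the same vector can be used at both points. -/
lemma oneForm_congr (lam : (x : M) → TangentSpace (𝓡 (2 * d)) x →L[ℝ] ℝ) {x x' : M} (hx : x = x')
    {u u' : 𝔼} (hu : u = u') : (lam x : 𝔼 →L[ℝ] ℝ) u = (lam x' : 𝔼 →L[ℝ] ℝ) u' := by
  subst hx hu; rfl

/-- Transport along an equality of base points, as in `oneForm_congr`. -/
lemma twoForm_congr
    (Ω : (x : M) → TangentSpace (𝓡 (2 * d)) x →L[ℝ] TangentSpace (𝓡 (2 * d)) x →L[ℝ] ℝ)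
    {x x' : M} (hx : x = x') {u u' v v' : 𝔼} (hu : u = u') (hv : v = v') :
    (Ω x : 𝔼 →L[ℝ] 𝔼 →L[ℝ] ℝ) u v = (Ω x' : 𝔼 →L[ℝ] 𝔼 →L[ℝ] ℝ) u' v' := by
  subst hx hu hv; rfl

variable [IsManifold (𝓡 (2 * d)) ∞ M]

lemma mfderiv_eq_chart {σ : V → M} {z : V} (hσ : MDifferentiableAt 𝓘(ℝ, V) (𝓡 (2 * d)) σ z)
    {c : OpenPartialHomeomorph M 𝔼} (hc : c ∈ atlas 𝔼 M) (hz : σ z ∈ c.source) (v : V) :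
    (mfderiv 𝓘(ℝ, V) (𝓡 (2 * d)) σ z v : 𝔼) =
      (mfderiv (𝓡 (2 * d)) (𝓡 (2 * d)) c.symm (c (σ z)) : 𝔼 →L[ℝ] 𝔼)
        (fderiv ℝ (fun w => c (σ w)) z v) := by
  have h2 : MDifferentiableAt (𝓡 (2 * d)) (𝓡 (2 * d)) c (σ z) := mdifferentiableAt_atlas hc hz
  have h3 : MDifferentiableAt (𝓡 (2 * d)) (𝓡 (2 * d)) c.symm (c (σ z)) :=
    mdifferentiableAt_atlas_symm hc (c.map_source hz)
  have hT : MDifferentiableAt 𝓘(ℝ, V) (𝓡 (2 * d)) (fun w => c (σ w)) z := h2.comp z hσ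
  have heq : σ =ᶠ[𝓝 z] fun w => c.symm (c (σ w)) := by
    filter_upwards [hσ.continuousAt.eventually (c.open_source.mem_nhds hz)] with w hw
      using (c.left_inv hw).symm
  have h4 : (mfderiv 𝓘(ℝ, V) (𝓡 (2 * d)) σ z : V →L[ℝ] 𝔼) =
      (mfderiv (𝓡 (2 * d)) (𝓡 (2 * d)) c.symm (c (σ z)) : 𝔼 →L[ℝ] 𝔼) ∘L
        (mfderiv 𝓘(ℝ, V) (𝓡 (2 * d)) (fun w => c (σ w)) z : V →L[ℝ] 𝔼) := by
    rw [heq.mfderiv_eq]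
    exact mfderiv_comp z h3 hT
  rw [← mfderiv_eq_fderiv]
  exact congrArg (fun L : V →L[ℝ] 𝔼 => L v) h4

lemma pullOneForm_eq_chart {σ : V → M} {z : V}
    (hσ : MDifferentiableAt 𝓘(ℝ, V) (𝓡 (2 * d)) σ z)
    {c : OpenPartialHomeomorph M 𝔼} (hc : c ∈ atlas 𝔼 M) (hz : σ z ∈ c.source) :
    pullOneForm lam σ z =
      (coordOneForm lam c (c (σ z))).comp (fderiv ℝ (fun w => c (σ w)) z) := by
  ext v
  refine (oneForm_congr lam (c.left_inv hz).symm (mfderiv_eq_chart hσ hc hz v))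

lemma eventually_pullOneForm_eq_chart {σ : V → M} {z : V}
    (hσ : ContMDiffAt 𝓘(ℝ, V) (𝓡 (2 * d)) ∞ σ z)
    {c : OpenPartialHomeomorph M 𝔼} (hc : c ∈ atlas 𝔼 M) (hz : σ z ∈ c.source) :
    ∀ᶠ w in 𝓝 z, pullOneForm lam σ w =
      (coordOneForm lam c (c (σ w))).comp (fderiv ℝ (fun w => c (σ w)) w) := by
  have h1 : ∀ᶠ w in 𝓝 z, ContMDiffAt 𝓘(ℝ, V) (𝓡 (2 * d)) 1 σ w :=
    (contMDiffAt_iff_contMDiffAt_nhds (by simp)).1 (hσ.of_le (by norm_cast))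
  filter_upwards [h1, hσ.continuousAt.eventually (c.open_source.mem_nhds hz)] with w hw hwc
  exact pullOneForm_eq_chart (hw.mdifferentiableAt (by simp)) hc hwc

lemma contDiffAt_chart_comp {σ : V → M} {z : V} (hσ : ContMDiffAt 𝓘(ℝ, V) (𝓡 (2 * d)) ∞ σ z)
    {c : OpenPartialHomeomorph M 𝔼} (hc : c ∈ atlas 𝔼 M) (hz : σ z ∈ c.source) :
    ContDiffAt ℝ ∞ (fun w => c (σ w)) z :=
  contMDiffAt_iff_contDiffAt.1 ((contMDiffAt_of_mem_maximalAtlas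
    (IsManifold.subset_maximalAtlas hc) hz).comp z hσ)

/-- The pullback of the Liouville form by a smooth map is smooth. -/
lemma contDiffAt_pullOneForm (hΩ : IsExactSymplectic Ω lam) {σ : V → M} {z : V}
    (hσ : ContMDiffAt 𝓘(ℝ, V) (𝓡 (2 * d)) ∞ σ z) : ContDiffAt ℝ ∞ (pullOneForm lam σ) z := by
  have hc := chart_mem_atlas 𝔼 (σ z)
  have hz := mem_chart_source 𝔼 (σ z)
  set c := chartAt 𝔼 (σ z)
  refine ContDiffAt.congr_of_eventuallyEq ?_ (eventually_pullOneForm_eq_chart hσ hc hz)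
  have hF := contDiffAt_chart_comp hσ hc hz
  have hl : ContDiffAt ℝ ∞ (coordOneForm lam c) (c (σ z)) :=
    (hΩ.smooth c hc).contDiffAt (c.open_target.mem_nhds (c.map_source hz))
  exact (hl.comp z hF).clm_comp (hF.fderiv_right (m := ∞) (by simp))

/-- Naturality of the exterior derivative: the pullback of `Ω` by a smooth map `σ` is the exterior
derivative of the pullback of the Liouville form. -/
theorem twoForm_eq_fderiv_pullOneForm (hΩ : IsExactSymplectic Ω lam) {σ : V → M} {z : V}
    (hσ : ContMDiffAt 𝓘(ℝ, V) (𝓡 (2 * d)) ∞ σ z) (u v : V) :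
    Ω (σ z) (mfderiv 𝓘(ℝ, V) (𝓡 (2 * d)) σ z u) (mfderiv 𝓘(ℝ, V) (𝓡 (2 * d)) σ z v) =
      fderiv ℝ (pullOneForm lam σ) z u v - fderiv ℝ (pullOneForm lam σ) z v u := by
  have hc := chart_mem_atlas 𝔼 (σ z)
  have hz := mem_chart_source 𝔼 (σ z)
  set c := chartAt 𝔼 (σ z)
  set F : V → 𝔼 := fun w => c (σ w)
  set l : 𝔼 → 𝔼 →L[ℝ] ℝ := coordOneForm lam c with hl
  have hF : ContDiffAt ℝ ∞ F z := contDiffAt_chart_comp hσ hc hz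
  have hFd : HasFDerivAt F (fderiv ℝ F z) z := (hF.differentiableAt (by simp)).hasFDerivAt
  have hFd2 : HasFDerivAt (fderiv ℝ F) (fderiv ℝ (fderiv ℝ F) z) z :=
    ((hF.fderiv_right (m := ∞) (by simp)).differentiableAt (by simp)).hasFDerivAt
  have hld : HasFDerivAt l (fderiv ℝ l (F z)) (F z) :=
    (((hΩ.smooth c hc).contDiffAt (c.open_target.mem_nhds (c.map_source hz))).differentiableAt
      (by simp)).hasFDerivAt
  have hd : ∀ u v, fderiv ℝ (pullOneForm lam σ) z u v =
      l (F z) (fderiv ℝ (fderiv ℝ F) z u v) + fderiv ℝ l (F z) (fderiv ℝ F z u)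
        (fderiv ℝ F z v) := by
    intro u v
    have h1 : pullOneForm lam σ =ᶠ[𝓝 z] fun w => (l (F w)).comp (fderiv ℝ F w) :=
      eventually_pullOneForm_eq_chart hσ hc hz
    have h2 := (hld.comp z hFd).clm_comp hFd2
    rw [h1.fderiv_eq]
    erw [h2.fderiv]
    simp
  have hsymm : fderiv ℝ (fderiv ℝ F) z u v = fderiv ℝ (fderiv ℝ F) z v u :=
    hF.isSymmSndFDerivAt (by simpa using (by norm_cast : (2 : ℕ∞ω) ≤ ∞)) u v
  rw [hd, hd, hsymm, add_sub_add_left_eq_sub, ← hΩ.eq_d c hc (F z) (c.map_source hz)]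
  have hσd := hσ.mdifferentiableAt (by simp)
  exact twoForm_congr Ω (c.left_inv hz).symm (mfderiv_eq_chart hσd hc hz u)
    (mfderiv_eq_chart hσd hc hz v)

end Pullback

/-! ### Families of maps and symplectic forms -/

section Families

variable {d : ℕ} {M : Type*} [TopologicalSpace M]
  [ChartedSpace (EuclideanSpace ℝ (Fin (2 * d))) M]
  {Ω : (x : M) → TangentSpace (𝓡 (2 * d)) x →L[ℝ] TangentSpace (𝓡 (2 * d)) x →L[ℝ] ℝ}
  {lam : (x : M) → TangentSpace (𝓡 (2 * d)) x →L[ℝ] ℝ}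

local notation "𝔼" => EuclideanSpace ℝ (Fin (2 * d))

/-- The differential of a real function. -/
abbrev differential (A : M → ℝ) (x : M) : TangentSpace (𝓡 (2 * d)) x →L[ℝ] ℝ :=
  mfderiv (𝓡 (2 * d)) 𝓘(ℝ, ℝ) A x

lemma exists_chart_symm_eq (x : M) :
    ∃ c ∈ atlas 𝔼 M, ∃ y ∈ c.target, c.symm y = x :=
  ⟨chartAt 𝔼 x, chart_mem_atlas 𝔼 x, _, mem_chart_target 𝔼 x,
    (chartAt 𝔼 x).left_inv (mem_chart_source 𝔼 x)⟩

lemma contMDiff_slice {Φ : ℝ → M → M}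
    (hΦ : ContMDiff (𝓘(ℝ, ℝ).prod (𝓡 (2 * d))) (𝓡 (2 * d)) ∞ (fun p : ℝ × M => Φ p.1 p.2)) (t : ℝ) :
    ContMDiff (𝓡 (2 * d)) (𝓡 (2 * d)) ∞ (Φ t) :=
  hΦ.comp (contMDiff_const.prodMk contMDiff_id)

variable [IsManifold (𝓡 (2 * d)) ∞ M]

lemma contMDiffAt_atlas_symm {c : OpenPartialHomeomorph M 𝔼} (hc : c ∈ atlas 𝔼 M) {y : 𝔼}
    (hy : y ∈ c.target) : ContMDiffAt (𝓡 (2 * d)) (𝓡 (2 * d)) ∞ c.symm y :=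
  contMDiffAt_symm_of_mem_maximalAtlas (IsManifold.subset_maximalAtlas hc) hy

lemma mfderiv_atlas_symm_surjective {c : OpenPartialHomeomorph M 𝔼} (hc : c ∈ atlas 𝔼 M) {y : 𝔼}
    (hy : y ∈ c.target) :
    Function.Surjective (mfderiv (𝓡 (2 * d)) (𝓡 (2 * d)) c.symm y) :=
  (mdifferentiable_of_mem_atlas (I := 𝓡 (2 * d)) hc).symm.mfderiv_surjective hy

/-- `Ω` is alternating. -/
lemma twoForm_self (hΩ : IsExactSymplectic Ω lam) (x : M) (u : TangentSpace (𝓡 (2 * d)) x) :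
    Ω x u u = 0 := by
  obtain ⟨c, hc, y, hy, rfl⟩ := exists_chart_symm_eq (d := d) x
  obtain ⟨w, rfl⟩ := mfderiv_atlas_symm_surjective hc hy u
  have := hΩ.eq_d c hc y hy w w
  rwa [sub_self] at this

lemma twoForm_antisymm (hΩ : IsExactSymplectic Ω lam) (x : M) (u v : TangentSpace (𝓡 (2 * d)) x) :
    Ω x u v = - Ω x v u := by
  have h := twoForm_self hΩ x (u + v)
  simp only [map_add, _root_.add_apply, twoForm_self hΩ, zero_add, add_zero] at h
  linarith

/-- If `ψ` pulls back the Liouville form to `a • lam + dA`, then it pulls back `Ω` to `a • Ω`. -/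
theorem twoForm_comp_mfderiv (hΩ : IsExactSymplectic Ω lam) {ψ : M → M} {A : M → ℝ} {a : ℝ} {x : M}
    (hψ : ContMDiffAt (𝓡 (2 * d)) (𝓡 (2 * d)) ∞ ψ x)
    (hA : ContMDiffAt (𝓡 (2 * d)) 𝓘(ℝ, ℝ) ∞ A x)
    (h : ∀ᶠ x' in 𝓝 x, ∀ v, lam (ψ x') (mfderiv (𝓡 (2 * d)) (𝓡 (2 * d)) ψ x' v) =
      a * lam x' v + differential A x' v)
    (u v : TangentSpace (𝓡 (2 * d)) x) :
    Ω (ψ x) (mfderiv (𝓡 (2 * d)) (𝓡 (2 * d)) ψ x u) (mfderiv (𝓡 (2 * d)) (𝓡 (2 * d)) ψ x v) =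
      a * Ω x u v := by
  obtain ⟨c, hc, y, hy, rfl⟩ := exists_chart_symm_eq (d := d) x
  obtain ⟨(u : 𝔼), rfl⟩ := mfderiv_atlas_symm_surjective hc hy u
  obtain ⟨(v : 𝔼), rfl⟩ := mfderiv_atlas_symm_surjective hc hy v
  have hcs := contMDiffAt_atlas_symm hc hy
  have hσ : ContMDiffAt (𝓡 (2 * d)) (𝓡 (2 * d)) ∞ (fun z => ψ (c.symm z)) y := hψ.comp y hcs
  have hAc : ContDiffAt ℝ ∞ (fun z => A (c.symm z)) y :=
    contMDiffAt_iff_contDiffAt.1 (hA.comp y hcs)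
  have hψd : ∀ᶠ x' in 𝓝 (c.symm y), MDifferentiableAt (𝓡 (2 * d)) (𝓡 (2 * d)) ψ x' ∧
      MDifferentiableAt (𝓡 (2 * d)) 𝓘(ℝ, ℝ) A x' := by
    have h1 := (contMDiffAt_iff_contMDiffAt_nhds (n := 1) (by simp)).1
      (hψ.of_le (by norm_cast))
    have h2 := (contMDiffAt_iff_contMDiffAt_nhds (n := 1) (by simp)).1
      (hA.of_le (by norm_cast))
    filter_upwards [h1, h2] with x' h3 h4
      using ⟨h3.mdifferentiableAt (by simp), h4.mdifferentiableAt (by simp)⟩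
  have hpull : pullOneForm lam (fun z => ψ (c.symm z)) =ᶠ[𝓝 y]
      fun z => a • pullOneForm lam c.symm z + fderiv ℝ (fun z => A (c.symm z)) z := by
    filter_upwards [hcs.continuousAt.eventually h, hcs.continuousAt.eventually hψd,
      c.open_target.mem_nhds hy] with z hz hz' hzt
    have hcz := (contMDiffAt_atlas_symm hc hzt).mdifferentiableAt (by simp)
    ext w
    have h1 := mfderiv_comp_apply z hz'.1 hcz w
    have h2 := mfderiv_comp_apply z hz'.2 hcz w
    rw [← mfderiv_eq_fderiv]
    refine (oneForm_congr lam rfl h1).trans ((hz _).trans ?_)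
    exact congrArg₂ (· + ·) rfl h2.symm
  have hl : ContDiffAt ℝ ∞ (pullOneForm lam c.symm) y := contDiffAt_pullOneForm hΩ hcs
  have hA2 : ContDiffAt ℝ ∞ (fderiv ℝ (fun z => A (c.symm z))) y :=
    hAc.fderiv_right (m := ∞) (by simp)
  have hd : ∀ u v, fderiv ℝ (pullOneForm lam (fun z => ψ (c.symm z))) y u v =
      a * fderiv ℝ (pullOneForm lam c.symm) y u v +
        fderiv ℝ (fderiv ℝ (fun z => A (c.symm z))) y u v := by
    intro u v
    have h1 := ((hl.differentiableAt (by simp)).hasFDerivAt.const_smul a).add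
      (hA2.differentiableAt (by simp)).hasFDerivAt
    rw [(h1.congr_of_eventuallyEq hpull).fderiv]
    simp
  have hsymm := hAc.isSymmSndFDerivAt (by simpa using (by norm_cast : (2 : ℕ∞ω) ≤ ∞)) u v
  have h1 := twoForm_eq_fderiv_pullOneForm hΩ hσ u v
  have h2 := twoForm_eq_fderiv_pullOneForm hΩ hcs u v
  have hψy := hψ.mdifferentiableAt (by simp)
  have hcy := hcs.mdifferentiableAt (by simp)
  have h3 := twoForm_congr Ω (rfl : ψ (c.symm y) = _) (mfderiv_comp_apply y hψy hcy u)
    (mfderiv_comp_apply y hψy hcy v)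
  refine h3.symm.trans (h1.trans (Eq.trans ?_ (congrArg (a * ·) h2).symm))
  rw [hd, hd, hsymm]
  ring

lemma contMDiffAt_family {Φ : ℝ → M → M}
    (hΦ : ContMDiff (𝓘(ℝ, ℝ).prod (𝓡 (2 * d))) (𝓡 (2 * d)) ∞ (fun p : ℝ × M => Φ p.1 p.2))
    {c : OpenPartialHomeomorph M 𝔼} (hc : c ∈ atlas 𝔼 M) {t : ℝ} {y : 𝔼}
    (hy : y ∈ c.target) :
    ContMDiffAt 𝓘(ℝ, ℝ × 𝔼) (𝓡 (2 * d)) ∞ (fun z : ℝ × 𝔼 => Φ z.1 (c.symm z.2)) (t, y) := by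
  have h1 : ContMDiffAt 𝓘(ℝ, ℝ × 𝔼) 𝓘(ℝ, ℝ) ∞ (fun z : ℝ × 𝔼 => z.1) (t, y) :=
    contDiff_fst.contMDiff.contMDiffAt
  have h2 : ContMDiffAt 𝓘(ℝ, ℝ × 𝔼) 𝓘(ℝ, 𝔼) ∞ (fun z : ℝ × 𝔼 => z.2) (t, y) :=
    contDiff_snd.contMDiff.contMDiffAt
  have h3 : ContMDiffAt 𝓘(ℝ, ℝ × 𝔼) (𝓡 (2 * d)) ∞ (fun z : ℝ × 𝔼 => c.symm z.2) (t, y) :=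
    (contMDiffAt_atlas_symm hc hy).comp (t, y) h2
  exact hΦ.contMDiffAt.comp (t, y) (h1.prodMk h3)

lemma mfderiv_family_time {Φ : ℝ → M → M}
    (hΦ : ContMDiff (𝓘(ℝ, ℝ).prod (𝓡 (2 * d))) (𝓡 (2 * d)) ∞ (fun p : ℝ × M => Φ p.1 p.2))
    {c : OpenPartialHomeomorph M 𝔼} (hc : c ∈ atlas 𝔼 M) {t : ℝ} {y : 𝔼}
    (hy : y ∈ c.target) {Y : TangentSpace (𝓡 (2 * d)) (Φ t (c.symm y))}
    (hY : HasMFDerivAt 𝓘(ℝ, ℝ) (𝓡 (2 * d)) (fun s => Φ s (c.symm y)) t (velocity Y)) :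
    mfderiv 𝓘(ℝ, ℝ × 𝔼) (𝓡 (2 * d)) (fun z : ℝ × 𝔼 => Φ z.1 (c.symm z.2)) (t, y)
      ((1 : ℝ), (0 : 𝔼)) = Y := by
  have h1 : HasMFDerivAt 𝓘(ℝ, ℝ) 𝓘(ℝ, ℝ × 𝔼) (fun s : ℝ => (s, y)) t
      (.inl ℝ ℝ 𝔼 : ℝ →L[ℝ] ℝ × 𝔼) := (hasFDerivAt_prodMk_left t y).hasMFDerivAt
  have h2 := (((contMDiffAt_family hΦ hc hy).mdifferentiableAt (by simp)).hasMFDerivAt).comp t h1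
  have h3 := hasMFDerivAt_unique hY h2
  have h4 := congrArg (fun L : ℝ →L[ℝ] 𝔼 => L 1) h3
  simp only [velocity] at h4
  exact h4.symm.trans (one_smul ℝ (Y : 𝔼))

lemma mfderiv_family_space {Φ : ℝ → M → M}
    (hΦ : ContMDiff (𝓘(ℝ, ℝ).prod (𝓡 (2 * d))) (𝓡 (2 * d)) ∞ (fun p : ℝ × M => Φ p.1 p.2))
    {c : OpenPartialHomeomorph M 𝔼} (hc : c ∈ atlas 𝔼 M) {t : ℝ} {y : 𝔼}
    (hy : y ∈ c.target) (w : 𝔼) :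
    mfderiv 𝓘(ℝ, ℝ × 𝔼) (𝓡 (2 * d)) (fun z : ℝ × 𝔼 => Φ z.1 (c.symm z.2)) (t, y)
      ((0 : ℝ), w) = mfderiv (𝓡 (2 * d)) (𝓡 (2 * d)) (Φ t) (c.symm y)
        (mfderiv (𝓡 (2 * d)) (𝓡 (2 * d)) c.symm y w) := by
  have h1 : HasMFDerivAt 𝓘(ℝ, 𝔼) 𝓘(ℝ, ℝ × 𝔼) (fun z : 𝔼 => (t, z)) y
      (.inr ℝ ℝ 𝔼 : 𝔼 →L[ℝ] ℝ × 𝔼) := (hasFDerivAt_prodMk_right t y).hasMFDerivAt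
  have h2 := (((contMDiffAt_family hΦ hc hy).mdifferentiableAt (by simp)).hasMFDerivAt).comp y h1
  have hcs := ((contMDiffAt_atlas_symm hc hy).mdifferentiableAt (by simp)).hasMFDerivAt
  have h3 := (((contMDiff_slice hΦ t).mdifferentiable (by simp) (c.symm y)).hasMFDerivAt).comp y hcs
  have h4 := hasMFDerivAt_unique h2 h3
  exact congrArg (fun L : 𝔼 →L[ℝ] 𝔼 => L w) h4

end Families

/-- Differentiation under the integral sign, for an integral over a compact interval. -/
lemma hasFDerivAt_intervalIntegral_param {E : Type*} [NormedAddCommGroup E] [NormedSpace ℝ E]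
    [FiniteDimensional ℝ E] {g : ℝ × E → ℝ} {O : Set E} (hO : IsOpen O)
    (hg : ContDiffOn ℝ 1 g (univ ×ˢ O)) {y : E} (hy : y ∈ O) (a b : ℝ) :
    HasFDerivAt (fun z => ∫ s in a..b, g (s, z))
      (∫ s in a..b, fderiv ℝ g (s, y) ∘L .inr ℝ ℝ E) y := by
  have hop : IsOpen ((univ : Set ℝ) ×ˢ O) := isOpen_univ.prod hO
  obtain ⟨r, hr, hball⟩ := Metric.nhds_basis_closedBall.mem_iff.1 (hO.mem_nhds hy)
  have hcd : ContinuousOn (fun z : ℝ × E => fderiv ℝ g z ∘L .inr ℝ ℝ E) (univ ×ˢ O) :=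
    (hg.continuousOn_fderiv_of_isOpen hop (by simp)).clm_comp continuousOn_const
  have hslice : ∀ z ∈ O, Continuous fun s : ℝ => (s, z) := fun z _ => by fun_prop
  have hgs : ∀ z ∈ O, Continuous fun s : ℝ => g (s, z) := fun z hz =>
    hg.continuousOn.comp_continuous (hslice z hz) fun s => ⟨mem_univ _, hz⟩
  have hgd : ∀ z ∈ O, Continuous fun s : ℝ => fderiv ℝ g (s, z) ∘L .inr ℝ ℝ E := fun z hz =>
    hcd.comp_continuous (hslice z hz) fun s => ⟨mem_univ _, hz⟩
  have hK : IsCompact (uIcc a b ×ˢ Metric.closedBall y r) :=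
    isCompact_uIcc.prod (isCompact_closedBall y r)
  obtain ⟨C, hC⟩ := hK.exists_bound_of_continuousOn
    (hcd.mono (prod_mono (subset_univ _) hball))
  refine intervalIntegral.hasFDerivAt_integral_of_dominated_of_fderiv_le
    (F := fun z s => g (s, z)) (F' := fun z s => fderiv ℝ g (s, z) ∘L .inr ℝ ℝ E)
    (bound := fun _ => C) (Metric.ball_mem_nhds y hr) ?_ ?_ ?_ ?_ ?_ ?_
  · filter_upwards [hO.mem_nhds hy] with z hz using (hgs z hz).aestronglyMeasurable
  · exact (hgs y hy).intervalIntegrable _ _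
  · exact (hgd y hy).aestronglyMeasurable
  · exact Eventually.of_forall fun s hs z hz =>
      hC (s, z) ⟨uIoc_subset_uIcc hs, Metric.ball_subset_closedBall hz⟩
  · exact intervalIntegrable_const
  · refine Eventually.of_forall fun s _ z hz => ?_
    have hzO : z ∈ O := hball (Metric.ball_subset_closedBall hz)
    have h1 : HasFDerivAt g (fderiv ℝ g (s, z)) (s, z) :=
      ((hg.contDiffAt (hop.mem_nhds ⟨mem_univ _, hzO⟩)).differentiableAt (by simp)).hasFDerivAt
    exact h1.comp z (hasFDerivAt_prodMk_right s z)

/-! ### The primitive of `φ^* lam - lam` for a Hamiltonian isotopy -/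

section Isotopy

variable {d : ℕ} {M : Type*} [TopologicalSpace M]
  [ChartedSpace (EuclideanSpace ℝ (Fin (2 * d))) M]
  {Ω : (x : M) → TangentSpace (𝓡 (2 * d)) x →L[ℝ] TangentSpace (𝓡 (2 * d)) x →L[ℝ] ℝ}
  {lam : (x : M) → TangentSpace (𝓡 (2 * d)) x →L[ℝ] ℝ}

local notation "𝔼" => EuclideanSpace ℝ (Fin (2 * d))

/-- A Hamiltonian isotopy, defined for all times, with its Hamiltonian vector fields `Y` and with
Hamiltonian functions supported in `K`. -/
structure IsHamIsotopy
    (Ω : (x : M) → TangentSpace (𝓡 (2 * d)) x →L[ℝ] TangentSpace (𝓡 (2 * d)) x →L[ℝ] ℝ)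
    (H : ℝ → M → ℝ) (Y : ℝ → (x : M) → TangentSpace (𝓡 (2 * d)) x) (Φ : ℝ → M → M)
    (K : Set M) : Prop where
  smooth_ham : ContMDiff (𝓘(ℝ, ℝ).prod (𝓡 (2 * d))) 𝓘(ℝ, ℝ) ∞ (fun p : ℝ × M => H p.1 p.2)
  smooth : ContMDiff (𝓘(ℝ, ℝ).prod (𝓡 (2 * d))) (𝓡 (2 * d)) ∞ (fun p : ℝ × M => Φ p.1 p.2)
  zero : ∀ x, Φ 0 x = x
  support : ∀ t, ∀ x ∉ K, H t x = 0
  ham : ∀ t, IsHamiltonianField Ω (H t) (Y t)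
  flow : ∀ t x, HasMFDerivAt 𝓘(ℝ, ℝ) (𝓡 (2 * d)) (fun s => Φ s x) t (velocity (Y t (Φ t x)))

/-- The function whose composition with `Φ_t` is the time derivative of the primitive of
`Φ_t^* lam - lam`. -/
def primitiveRate (lam : (x : M) → TangentSpace (𝓡 (2 * d)) x →L[ℝ] ℝ) (H : ℝ → M → ℝ)
    (Y : ℝ → (x : M) → TangentSpace (𝓡 (2 * d)) x) (t : ℝ) (x : M) : ℝ :=
  lam x (Y t x) + H t x

/-- The function `A_t` with `Φ_t^* lam - lam = dA_t`. -/
def primitive (lam : (x : M) → TangentSpace (𝓡 (2 * d)) x →L[ℝ] ℝ) (H : ℝ → M → ℝ)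
    (Y : ℝ → (x : M) → TangentSpace (𝓡 (2 * d)) x) (Φ : ℝ → M → M) (t : ℝ) (x : M) : ℝ :=
  ∫ s in (0 : ℝ)..t, primitiveRate lam H Y s (Φ s x)

variable [IsManifold (𝓡 (2 * d)) ∞ M] {H : ℝ → M → ℝ}
  {Y : ℝ → (x : M) → TangentSpace (𝓡 (2 * d)) x} {Φ : ℝ → M → M} {K : Set M}

omit [IsManifold (𝓡 (2 * d)) ∞ M] in
lemma fderiv_comp_apply {V : Type*} [NormedAddCommGroup V] [NormedSpace ℝ V] {σ : V → M}
    {A : M → ℝ} {z : V} (hA : MDifferentiableAt (𝓡 (2 * d)) 𝓘(ℝ, ℝ) A (σ z))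
    (hσ : MDifferentiableAt 𝓘(ℝ, V) (𝓡 (2 * d)) σ z) (w : V) :
    fderiv ℝ (fun z => A (σ z)) z w =
      differential A (σ z) (mfderiv 𝓘(ℝ, V) (𝓡 (2 * d)) σ z w) := by
  rw [← mfderiv_eq_fderiv]
  exact mfderiv_comp_apply z hA hσ w

/-- The rate along the isotopy is smooth in time and space jointly. -/
lemma IsHamIsotopy.contDiffOn_primitiveRate (hΩ : IsExactSymplectic Ω lam)
    (h : IsHamIsotopy Ω H Y Φ K) {c : OpenPartialHomeomorph M 𝔼} (hc : c ∈ atlas 𝔼 M) :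
    ContDiffOn ℝ ∞ (fun z : ℝ × 𝔼 => primitiveRate lam H Y z.1 (Φ z.1 (c.symm z.2)))
      (univ ×ˢ c.target) := by
  rintro ⟨t, y⟩ ⟨-, hy⟩
  refine ContDiffAt.contDiffWithinAt ?_
  have hσ := contMDiffAt_family h.smooth hc hy (t := t)
  have h1 : ContDiffAt ℝ ∞ (fun z : ℝ × 𝔼 => pullOneForm lam
      (fun z : ℝ × 𝔼 => Φ z.1 (c.symm z.2)) z ((1 : ℝ), (0 : 𝔼))) (t, y) :=
    (contDiffAt_pullOneForm hΩ hσ).clm_apply contDiffAt_const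
  have h2 : ContDiffAt ℝ ∞ (fun z : ℝ × 𝔼 => H z.1 (Φ z.1 (c.symm z.2))) (t, y) := by
    have ht : ContMDiffAt 𝓘(ℝ, ℝ × 𝔼) 𝓘(ℝ, ℝ) ∞ (fun z : ℝ × 𝔼 => z.1) (t, y) :=
      contDiff_fst.contMDiff.contMDiffAt
    exact contMDiffAt_iff_contDiffAt.1 (h.smooth_ham.contMDiffAt.comp (t, y) (ht.prodMk hσ))
  refine (h1.add h2).congr_of_eventuallyEq ?_
  filter_upwards [(isOpen_univ.prod c.open_target).mem_nhds
    (show (t, y) ∈ univ ×ˢ c.target from ⟨mem_univ _, hy⟩)] with z hz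
  rw [primitiveRate, pullOneForm_apply]
  congr 1
  exact oneForm_congr lam rfl (mfderiv_family_time h.smooth hc hz.2 (h.flow z.1 _)).symm

/-- Cartan's formula for `d/dt Φ_t^* lam`, integrated and in coordinates. -/
lemma IsHamIsotopy.hasFDerivAt_primitive_chart (hΩ : IsExactSymplectic Ω lam)
    (h : IsHamIsotopy Ω H Y Φ K) {c : OpenPartialHomeomorph M 𝔼} (hc : c ∈ atlas 𝔼 M) (t : ℝ)
    {y : 𝔼} (hy : y ∈ c.target) :
    HasFDerivAt (fun z => primitive lam H Y Φ t (c.symm z))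
      (pullOneForm lam (fun z : ℝ × 𝔼 => Φ z.1 (c.symm z.2)) (t, y) ∘L .inr ℝ ℝ 𝔼 -
        pullOneForm lam c.symm y) y := by
  set σ : ℝ × 𝔼 → M := fun z => Φ z.1 (c.symm z.2) with hσdef
  set g : ℝ × 𝔼 → ℝ := fun z => primitiveRate lam H Y z.1 (σ z) with hg
  have hgs : ContDiffOn ℝ ∞ g (univ ×ˢ c.target) := h.contDiffOn_primitiveRate hΩ hc
  have hop : IsOpen ((univ : Set ℝ) ×ˢ c.target) := isOpen_univ.prod c.open_target
  have hmain := hasFDerivAt_intervalIntegral_param c.open_target (hgs.of_le (by norm_cast)) hy 0 t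
  refine hmain.congr_fderiv ?_
  have hσ : ∀ s, ContMDiffAt 𝓘(ℝ, ℝ × 𝔼) (𝓡 (2 * d)) ∞ σ (s, y) := fun s =>
    contMDiffAt_family h.smooth hc hy
  have hl : ∀ s, ContDiffAt ℝ ∞ (pullOneForm lam σ) (s, y) := fun s =>
    contDiffAt_pullOneForm hΩ (hσ s)
  have hcont : Continuous fun s : ℝ => fderiv ℝ g (s, y) ∘L .inr ℝ ℝ 𝔼 :=
    ((hgs.continuousOn_fderiv_of_isOpen hop (by simp)).comp_continuous (by fun_prop)
      fun s => ⟨mem_univ _, hy⟩).clm_comp continuous_const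
  have hderiv : ∀ s, HasDerivAt (fun r => pullOneForm lam σ (r, y) ∘L .inr ℝ ℝ 𝔼)
      (fderiv ℝ g (s, y) ∘L .inr ℝ ℝ 𝔼) s := by
    intro s
    have hd : HasFDerivAt (pullOneForm lam σ) (fderiv ℝ (pullOneForm lam σ) (s, y)) (s, y) :=
      ((hl s).differentiableAt (by simp)).hasFDerivAt
    have h1 : HasDerivAt (fun r : ℝ => pullOneForm lam σ (r, y))
        (fderiv ℝ (pullOneForm lam σ) (s, y) (1, 0)) s := by
      exact hd.comp_hasDerivAt s ((hasDerivAt_id s).prodMk (hasDerivAt_const s y))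
    have h2 := h1.clm_comp (hasDerivAt_const s (ContinuousLinearMap.inr ℝ ℝ 𝔼))
    refine h2.congr_deriv ?_
    ext w
    have hcartan := twoForm_eq_fderiv_pullOneForm hΩ (hσ s) ((1 : ℝ), (0 : 𝔼)) ((0 : ℝ), w)
    -- the differential of the Hamiltonian, evaluated on `∂σ/∂w`
    have hH : Ω (σ (s, y)) (mfderiv 𝓘(ℝ, ℝ × 𝔼) (𝓡 (2 * d)) σ (s, y) ((1 : ℝ), (0 : 𝔼)))
        (mfderiv 𝓘(ℝ, ℝ × 𝔼) (𝓡 (2 * d)) σ (s, y) ((0 : ℝ), w)) =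
        fderiv ℝ (fun z : 𝔼 => H s (σ (s, z))) y w := by
      rw [mfderiv_family_time h.smooth hc hy (h.flow s _), h.ham s]
      have hHs : MDifferentiableAt (𝓡 (2 * d)) 𝓘(ℝ, ℝ) (H s) (σ (s, y)) :=
        (h.smooth_ham.comp (contMDiff_const.prodMk contMDiff_id)).mdifferentiable (by simp) _
      have h3 : MDifferentiableAt 𝓘(ℝ, ℝ × 𝔼) (𝓡 (2 * d)) σ (s, y) :=
        (hσ s).mdifferentiableAt (by simp)
      have h4 : HasFDerivAt (fun z => H s (σ z)) (fderiv ℝ (fun z => H s (σ z)) (s, y)) (s, y) :=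
        (mdifferentiableAt_iff_differentiableAt.1 (hHs.comp (s, y) h3)).hasFDerivAt
      have h5 := (h4.comp y (hasFDerivAt_prodMk_right s y)).fderiv
      refine (fderiv_comp_apply hHs h3 ((0 : ℝ), w)).symm.trans ?_
      exact (congrArg (fun L : 𝔼 →L[ℝ] ℝ => L w) h5).symm
    have hgw : fderiv ℝ g (s, y) ((0 : ℝ), w) =
        fderiv ℝ (pullOneForm lam σ) (s, y) ((0 : ℝ), w) ((1 : ℝ), (0 : 𝔼)) +
          fderiv ℝ (fun z : 𝔼 => H s (σ (s, z))) y w := by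
      have hgd : HasFDerivAt g (fderiv ℝ g (s, y)) (s, y) :=
        ((hgs.contDiffAt (hop.mem_nhds ⟨mem_univ _, hy⟩)).differentiableAt (by simp)).hasFDerivAt
      have h5 := hgd.comp y (hasFDerivAt_prodMk_right s y)
      have h6 : HasFDerivAt (fun z : 𝔼 => pullOneForm lam σ (s, z) ((1 : ℝ), (0 : 𝔼))) _ y :=
        (hd.comp y (hasFDerivAt_prodMk_right s y)).clm_apply (hasFDerivAt_const _ y)
      have h7 : DifferentiableAt ℝ (fun z : 𝔼 => H s (σ (s, z))) y := by
        have hin : ContMDiffAt 𝓘(ℝ, 𝔼) 𝓘(ℝ, ℝ × 𝔼) ∞ (fun z : 𝔼 => (s, z)) y :=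
          (contDiff_const.prodMk contDiff_id).contMDiff.contMDiffAt
        have := (h.smooth_ham.comp (contMDiff_const.prodMk contMDiff_id) :
          ContMDiff (𝓡 (2 * d)) 𝓘(ℝ, ℝ) ∞ (H s)).contMDiffAt.comp y ((hσ s).comp y hin)
        exact (contMDiffAt_iff_contDiffAt.1 this).differentiableAt (by simp)
      have h8 := h6.add h7.hasFDerivAt
      have heq : (fun z : 𝔼 => g (s, z)) =ᶠ[𝓝 y]
          fun z => pullOneForm lam σ (s, z) ((1 : ℝ), (0 : 𝔼)) + H s (σ (s, z)) := by
        filter_upwards [c.open_target.mem_nhds hy] with z hz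
        simp only [hg, primitiveRate, pullOneForm_apply]
        congr 1
        exact oneForm_congr lam rfl (mfderiv_family_time h.smooth hc hz (h.flow s _)).symm
      have h9 := congrArg (fun L : 𝔼 →L[ℝ] ℝ => L w)
        (h5.unique (h8.congr_of_eventuallyEq heq))
      simpa using h9
    rw [hH] at hcartan
    simp
    linarith
  rw [intervalIntegral.integral_eq_sub_of_hasDerivAt (fun s _ => hderiv s)
    (hcont.intervalIntegrable _ _)]
  congr 1
  ext w
  have h0 : ∀ z, σ (0, z) = c.symm z := fun z => h.zero _
  refine oneForm_congr lam (h0 y) ((mfderiv_family_space h.smooth hc hy w).trans ?_)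
  have : Φ 0 = id := funext h.zero
  rw [this, mfderiv_id]
  rfl

lemma IsHamIsotopy.contDiffOn_primitive_chart (hΩ : IsExactSymplectic Ω lam)
    (h : IsHamIsotopy Ω H Y Φ K) {c : OpenPartialHomeomorph M 𝔼} (hc : c ∈ atlas 𝔼 M) (t : ℝ) :
    ContDiffOn ℝ ∞ (fun z => primitive lam H Y Φ t (c.symm z)) c.target := by
  rw [contDiffOn_infty_iff_fderiv_of_isOpen c.open_target]
  refine ⟨fun y hy => (h.hasFDerivAt_primitive_chart hΩ hc t
    hy).differentiableAt.differentiableWithinAt, ?_⟩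
  refine ContDiffOn.congr (f := fun y => pullOneForm lam
    (fun z : ℝ × 𝔼 => Φ z.1 (c.symm z.2)) (t, y) ∘L .inr ℝ ℝ 𝔼 - pullOneForm lam c.symm y)
    ?_ fun y hy => (h.hasFDerivAt_primitive_chart hΩ hc t hy).fderiv
  intro y hy
  refine ContDiffAt.contDiffWithinAt (ContDiffAt.sub (ContDiffAt.clm_comp ?_ contDiffAt_const)
    (contDiffAt_pullOneForm hΩ (contMDiffAt_atlas_symm hc hy)))
  exact (contDiffAt_pullOneForm hΩ (contMDiffAt_family h.smooth hc hy)).comp y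
    (contDiffAt_const.prodMk contDiffAt_id)

/-- The primitive is smooth, because its differential is. -/
theorem IsHamIsotopy.contMDiff_primitive (hΩ : IsExactSymplectic Ω lam)
    (h : IsHamIsotopy Ω H Y Φ K) (t : ℝ) :
    ContMDiff (𝓡 (2 * d)) 𝓘(ℝ, ℝ) ∞ (primitive lam H Y Φ t) := by
  intro x
  have hc := chart_mem_atlas 𝔼 x
  have hx := mem_chart_source 𝔼 x
  set c := chartAt 𝔼 x
  have h1 : ContMDiffAt (𝓡 (2 * d)) 𝓘(ℝ, ℝ) ∞
      (fun z => primitive lam H Y Φ t (c.symm z)) (c x) :=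
    contMDiffAt_iff_contDiffAt.2 ((h.contDiffOn_primitive_chart hΩ hc t).contDiffAt
      (c.open_target.mem_nhds (c.map_source hx)))
  have h2 : ContMDiffAt (𝓡 (2 * d)) (𝓡 (2 * d)) ∞ c x :=
    contMDiffAt_of_mem_maximalAtlas (IsManifold.subset_maximalAtlas hc) hx
  refine (h1.comp x h2).congr_of_eventuallyEq ?_
  filter_upwards [c.open_source.mem_nhds hx] with z hz
  simp [c.left_inv hz]

/-- `Φ_t^* lam = lam + dA_t`. -/
theorem IsHamIsotopy.lam_comp_mfderiv (hΩ : IsExactSymplectic Ω lam)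
    (h : IsHamIsotopy Ω H Y Φ K) (t : ℝ) (x : M) (v : TangentSpace (𝓡 (2 * d)) x) :
    lam (Φ t x) (mfderiv (𝓡 (2 * d)) (𝓡 (2 * d)) (Φ t) x v) =
      lam x v + differential (primitive lam H Y Φ t) x v := by
  obtain ⟨c, hc, y, hy, rfl⟩ := exists_chart_symm_eq (d := d) x
  obtain ⟨(w : 𝔼), rfl⟩ := mfderiv_atlas_symm_surjective hc hy v
  have hA := (h.contMDiff_primitive hΩ t).mdifferentiable (by simp) (c.symm y)
  have h1 := fderiv_comp_apply hA ((contMDiffAt_atlas_symm hc hy).mdifferentiableAt (by simp)) w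
  rw [(h.hasFDerivAt_primitive_chart hΩ hc t hy).fderiv] at h1
  have h3 := oneForm_congr lam (rfl : Φ t (c.symm y) = _)
    (mfderiv_family_space h.smooth hc hy w (t := t))
  refine h3.symm.trans (Eq.trans ?_ (congrArg (lam (c.symm y) (mfderiv (𝓡 (2 * d)) (𝓡 (2 * d))
    c.symm y w) + ·) h1))
  exact (add_sub_cancel _ _).symm

/-- The maps of a Hamiltonian isotopy are symplectic. -/
theorem IsHamIsotopy.twoForm_comp_mfderiv (hΩ : IsExactSymplectic Ω lam)
    (h : IsHamIsotopy Ω H Y Φ K) (t : ℝ) (x : M) (u v : TangentSpace (𝓡 (2 * d)) x) :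
    Ω (Φ t x) (mfderiv (𝓡 (2 * d)) (𝓡 (2 * d)) (Φ t) x u)
      (mfderiv (𝓡 (2 * d)) (𝓡 (2 * d)) (Φ t) x v) = Ω x u v := by
  rw [Calabi.twoForm_comp_mfderiv (a := 1) hΩ (contMDiff_slice h.smooth t x)
    (h.contMDiff_primitive hΩ t x) (Eventually.of_forall fun x' v => ?_), one_mul]
  rw [one_mul]
  exact h.lam_comp_mfderiv hΩ t x' v

end Isotopy

/-! ### The flow of the Liouville vector field -/

section Liouville

variable {d : ℕ} {M : Type*} [TopologicalSpace M]
  [ChartedSpace (EuclideanSpace ℝ (Fin (2 * d))) M] [IsManifold (𝓡 (2 * d)) ∞ M]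
  {Ω : (x : M) → TangentSpace (𝓡 (2 * d)) x →L[ℝ] TangentSpace (𝓡 (2 * d)) x →L[ℝ] ℝ}
  {lam : (x : M) → TangentSpace (𝓡 (2 * d)) x →L[ℝ] ℝ}

local notation "𝔼" => EuclideanSpace ℝ (Fin (2 * d))

lemma lam_liouvilleField (hΩ : IsExactSymplectic Ω lam)
    {X : (x : M) → TangentSpace (𝓡 (2 * d)) x} (hX : IsLiouvilleField Ω lam X) (x : M) :
    lam x (X x) = 0 := by
  rw [← hX, twoForm_self hΩ]

/-- `μ_t^* lam = e^t lam` along the trajectories of the Liouville vector field. The flow is only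
assumed to be the one of the Liouville vector field on the open set `W`. -/
theorem lam_comp_mfderiv_liouvilleFlow (hΩ : IsExactSymplectic Ω lam)
    {X Z : (x : M) → TangentSpace (𝓡 (2 * d)) x} (hX : IsLiouvilleField Ω lam X) {μ : ℝ → M → M}
    (hμ : IsFlow Z μ) {W : Set M} (hW : IsOpen W) (hZX : ∀ x ∈ W, Z x = X x) {t : ℝ} {x : M}
    (hx : ∀ s ∈ uIcc 0 t, μ s x ∈ W) (v : TangentSpace (𝓡 (2 * d)) x) :
    lam (μ t x) (mfderiv (𝓡 (2 * d)) (𝓡 (2 * d)) (μ t) x v) = Real.exp t * lam x v := by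
  obtain ⟨c, hc, y, hy, rfl⟩ := exists_chart_symm_eq (d := d) x
  obtain ⟨(w : 𝔼), rfl⟩ := mfderiv_atlas_symm_surjective hc hy v
  set σ : ℝ × 𝔼 → M := fun z => μ z.1 (c.symm z.2) with hσdef
  have hσ : ∀ s, ContMDiffAt 𝓘(ℝ, ℝ × 𝔼) (𝓡 (2 * d)) ∞ σ (s, y) := fun s =>
    contMDiffAt_family hμ.smooth hc hy
  have hd : ∀ s, HasFDerivAt (pullOneForm lam σ) (fderiv ℝ (pullOneForm lam σ) (s, y)) (s, y) :=
    fun s => ((contDiffAt_pullOneForm hΩ (hσ s)).differentiableAt (by simp)).hasFDerivAt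
  set f : ℝ → ℝ := fun s => pullOneForm lam σ (s, y) ((0 : ℝ), w) with hf
  have hfd : ∀ s ∈ uIcc 0 t, HasDerivAt f (f s) s := by
    intro s hs
    have h1 : HasDerivAt (fun r : ℝ => pullOneForm lam σ (r, y))
        (fderiv ℝ (pullOneForm lam σ) (s, y) (1, 0)) s := by
      have h0 := hd s
      exact h0.comp_hasDerivAt s ((hasDerivAt_id s).prodMk (hasDerivAt_const s y))
    have h2 := h1.clm_apply (hasDerivAt_const s ((0 : ℝ), w))
    refine h2.congr_deriv ?_
    have hcartan := twoForm_eq_fderiv_pullOneForm hΩ (hσ s) ((1 : ℝ), (0 : 𝔼)) ((0 : ℝ), w)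
    rw [mfderiv_family_time hμ.smooth hc hy (hμ.deriv _ s), hZX _ (hx s hs), hX] at hcartan
    -- `lam` vanishes on the velocity of the flow
    have h3 : fderiv ℝ (pullOneForm lam σ) (s, y) ((0 : ℝ), w) ((1 : ℝ), (0 : 𝔼)) = 0 := by
      have h4 := ((hd s).comp y (hasFDerivAt_prodMk_right s y)).clm_apply
        (hasFDerivAt_const ((1 : ℝ), (0 : 𝔼)) y)
      have h5 : (fun z : 𝔼 => pullOneForm lam σ (s, z) ((1 : ℝ), (0 : 𝔼))) =ᶠ[𝓝 y]
          fun _ => 0 := by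
        have hWs : ∀ᶠ z in 𝓝 y, σ (s, z) ∈ W :=
          ((hσ s).continuousAt.comp (by fun_prop : ContinuousAt (fun z : 𝔼 => (s, z)) y)).eventually
            (hW.mem_nhds (hx s hs))
        filter_upwards [c.open_target.mem_nhds hy, hWs] with z hz hzW
        refine (oneForm_congr lam rfl
          (mfderiv_family_time hμ.smooth hc hz (hμ.deriv _ s))).trans ?_
        rw [hZX _ hzW]
        exact lam_liouvilleField hΩ hX _
      have h6 := congrArg (fun L : 𝔼 →L[ℝ] ℝ => L w)
        (h4.unique ((hasFDerivAt_const (0 : ℝ) y).congr_of_eventuallyEq h5))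
      simpa using h6
    rw [h3, sub_zero] at hcartan
    simp only [hf, map_zero, add_zero]
    exact hcartan.symm
  have hconst : Real.exp (-t) * f t = Real.exp (-0) * f 0 := by
    have h1 : ∀ s ∈ uIcc 0 t, HasDerivWithinAt (fun s => Real.exp (-s) * f s) 0 (uIcc 0 t) s := by
      intro s hs
      have h2 := ((hasDerivAt_neg s).exp).mul (hfd s hs)
      exact (h2.congr_deriv (by ring)).hasDerivWithinAt
    have h2 := (convex_uIcc (0 : ℝ) t).norm_image_sub_le_of_norm_hasDerivWithin_le (C := 0)
      h1 (by simp) left_mem_uIcc right_mem_uIcc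
    rw [zero_mul, norm_le_zero_iff, sub_eq_zero] at h2
    exact h2
  have hft : f t = Real.exp t * f 0 := by
    rw [neg_zero, Real.exp_zero, one_mul] at hconst
    rw [← hconst, ← mul_assoc, ← Real.exp_add, add_neg_cancel, Real.exp_zero, one_mul]
  have h0 : f 0 = lam (c.symm y) (mfderiv (𝓡 (2 * d)) (𝓡 (2 * d)) c.symm y w) := by
    refine oneForm_congr lam (hμ.zero _) ((mfderiv_family_space hμ.smooth hc hy w).trans ?_)
    rw [show μ 0 = id from funext hμ.zero, mfderiv_id]
    rfl
  rw [← h0, ← hft]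
  exact (oneForm_congr lam rfl (mfderiv_family_space hμ.smooth hc hy w (t := t))).symm

/-- `μ_t^* Ω = e^t Ω` along the trajectories of the Liouville vector field. -/
theorem twoForm_comp_mfderiv_liouvilleFlow (hΩ : IsExactSymplectic Ω lam)
    {X Z : (x : M) → TangentSpace (𝓡 (2 * d)) x} (hX : IsLiouvilleField Ω lam X) {μ : ℝ → M → M}
    (hμ : IsFlow Z μ) {W : Set M} (hW : IsOpen W) (hZX : ∀ x ∈ W, Z x = X x) {t : ℝ}
    {U : Set M} (hU : IsOpen U) (hUW : ∀ x ∈ U, ∀ s ∈ uIcc 0 t, μ s x ∈ W) {x : M} (hx : x ∈ U)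
    (u v : TangentSpace (𝓡 (2 * d)) x) :
    Ω (μ t x) (mfderiv (𝓡 (2 * d)) (𝓡 (2 * d)) (μ t) x u)
      (mfderiv (𝓡 (2 * d)) (𝓡 (2 * d)) (μ t) x v) = Real.exp t * Ω x u v := by
  refine twoForm_comp_mfderiv (A := fun _ => 0) hΩ (hμ.contMDiff t x) contMDiffAt_const ?_ u v
  filter_upwards [hU.mem_nhds hx] with x' hx' v
  rw [lam_comp_mfderiv_liouvilleFlow hΩ hX hμ hW hZX (hUW x' hx') v, differential, mfderiv_const]
  exact (add_zero _).symm

end Liouville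

/-! ### Vector fields dual to one-forms -/

section Dual

variable {d : ℕ} {M : Type*} [TopologicalSpace M]
  [ChartedSpace (EuclideanSpace ℝ (Fin (2 * d))) M]
  {Ω : (x : M) → TangentSpace (𝓡 (2 * d)) x →L[ℝ] TangentSpace (𝓡 (2 * d)) x →L[ℝ] ℝ}
  {lam : (x : M) → TangentSpace (𝓡 (2 * d)) x →L[ℝ] ℝ}

local notation "𝔼" => EuclideanSpace ℝ (Fin (2 * d))

/-- A nondegenerate bilinear form identifies a finite-dimensional space with its dual. -/
lemma isInvertible_of_nondegenerate {V : Type*} [NormedAddCommGroup V] [NormedSpace ℝ V]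
    [FiniteDimensional ℝ V] (B : V →L[ℝ] V →L[ℝ] ℝ) (hB : ∀ u, (∀ v, B u v = 0) → u = 0) :
    B.IsInvertible := by
  have hinj : Function.Injective (B : V →ₗ[ℝ] V →L[ℝ] ℝ) := by
    rw [← LinearMap.ker_eq_bot, LinearMap.ker_eq_bot']
    exact fun u hu => hB u fun v => congrArg (fun L : V →L[ℝ] ℝ => L v) hu
  have hrank : Module.finrank ℝ V = Module.finrank ℝ (V →L[ℝ] ℝ) := by
    rw [← (LinearMap.toContinuousLinearMap (𝕜 := ℝ) (E := V) (F' := ℝ)).finrank_eq]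
    exact Subspace.dual_finrank_eq.symm
  exact ⟨(LinearEquiv.ofInjectiveOfFinrankEq _ hinj hrank).toContinuousLinearEquiv, by ext; rfl⟩

lemma exists_dualField (hΩ : IsExactSymplectic Ω lam)
    (α : (x : M) → TangentSpace (𝓡 (2 * d)) x →L[ℝ] ℝ) :
    ∃ Z : (x : M) → TangentSpace (𝓡 (2 * d)) x, ∀ x v, Ω x (Z x) v = α x v := by
  have h : ∀ x, ∃ u : TangentSpace (𝓡 (2 * d)) x, ∀ v, Ω x u v = α x v := by
    intro x
    obtain ⟨e, he⟩ := isInvertible_of_nondegenerate (V := 𝔼) (Ω x) (hΩ.nondegenerate x)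
    refine ⟨e.symm (α x), fun v => ?_⟩
    have h1 : (Ω x : 𝔼 →L[ℝ] 𝔼 →L[ℝ] ℝ) (e.symm (α x)) = α x := by
      rw [← he]; exact e.apply_symm_apply _
    exact congrArg (fun L : 𝔼 →L[ℝ] ℝ => L v) h1
  choose Z hZ using h
  exact ⟨Z, hZ⟩

variable [IsManifold (𝓡 (2 * d)) ∞ M]

/-- The vector field that corresponds to a smooth 1-form under `Ω` is smooth. -/
theorem contMDiff_dualField (hΩ : IsExactSymplectic Ω lam)
    {α : (x : M) → TangentSpace (𝓡 (2 * d)) x →L[ℝ] ℝ}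
    (hα : ∀ c ∈ atlas 𝔼 M, ContDiffOn ℝ ∞ (coordOneForm α c) c.target)
    {Z : (x : M) → TangentSpace (𝓡 (2 * d)) x} (hZ : ∀ x v, Ω x (Z x) v = α x v) :
    ContMDiff (𝓡 (2 * d)) (𝓡 (2 * d)).tangent ∞
      (fun x => (⟨x, Z x⟩ : TangentBundle (𝓡 (2 * d)) M)) := by
  intro x₀
  have hc := chart_mem_atlas 𝔼 x₀
  have hx₀ := mem_chart_source 𝔼 x₀
  set c := chartAt 𝔼 x₀
  have hcm : c.MDifferentiable (𝓡 (2 * d)) (𝓡 (2 * d)) := mdifferentiable_of_mem_atlas hc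
  set B : 𝔼 → 𝔼 →L[ℝ] 𝔼 →L[ℝ] ℝ := fun y =>
    fderiv ℝ (coordOneForm lam c) y - (fderiv ℝ (coordOneForm lam c) y).flip with hB
  have hBΩ : ∀ y ∈ c.target, ∀ u v, B y u v = coordTwoForm Ω c y u v := fun y hy u v =>
    (hΩ.eq_d c hc y hy u v).symm
  have hBinv : ∀ y ∈ c.target, (B y).IsInvertible := by
    intro y hy
    refine isInvertible_of_nondegenerate _ fun u hu => ?_
    have h1 := hΩ.nondegenerate (c.symm y) (mfderiv (𝓡 (2 * d)) (𝓡 (2 * d)) c.symm y u) fun v => by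
      obtain ⟨w, rfl⟩ := mfderiv_atlas_symm_surjective hc hy v
      exact (hBΩ y hy u w).symm.trans (hu w)
    exact hcm.symm.mfderiv_injective hy (h1.trans (map_zero _).symm)
  have hBs : ContDiffAt ℝ ∞ B (c x₀) := by
    have h1 : ContDiffAt ℝ ∞ (fderiv ℝ (coordOneForm lam c)) (c x₀) :=
      ((hΩ.smooth c hc).contDiffAt (c.open_target.mem_nhds (c.map_source hx₀))).fderiv_right
        (m := ∞) (by simp)
    have h2 : ContDiff ℝ ∞ fun L : 𝔼 →L[ℝ] 𝔼 →L[ℝ] ℝ => L.flip :=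
      IsBoundedLinearMap.contDiff ⟨⟨fun _ _ => rfl, fun _ _ => rfl⟩, 1, one_pos, fun L => by
        rw [one_mul]; exact L.opNorm_flip.le⟩
    exact h1.sub (h2.contDiffAt.comp _ h1)
  set Zc : 𝔼 → 𝔼 := fun y => (B y).inverse (coordOneForm α c y) with hZc
  have hZcs : ContDiffAt ℝ ∞ Zc (c x₀) := by
    have h1 : ContDiffAt ℝ ∞ (fun y => (B y).inverse) (c x₀) :=
      ((hBinv _ (c.map_source hx₀)).contDiffAt_map_inverse).comp (c x₀) hBs
    exact h1.clm_apply ((hα c hc).contDiffAt (c.open_target.mem_nhds (c.map_source hx₀)))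
  have hinv : (mfderiv (𝓡 (2 * d)) (𝓡 (2 * d)) c x₀).IsInvertible := ⟨hcm.mfderiv hx₀, rfl⟩
  have hpull := ContMDiffAt.mpullback_vectorField_preimage (n := ∞) (m := ∞)
    (V := fun y : 𝔼 => (Zc y : TangentSpace (𝓡 (2 * d)) y))
    (contMDiffAt_vectorSpace_iff_contDiffAt.2 hZcs)
    (contMDiffAt_of_mem_maximalAtlas (IsManifold.subset_maximalAtlas hc) hx₀) hinv (by simp)
  refine hpull.congr_of_eventuallyEq ?_
  filter_upwards [c.open_source.mem_nhds hx₀] with x hx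
  have hy := c.map_source hx
  have h1 : Zc (c x) = mfderiv (𝓡 (2 * d)) (𝓡 (2 * d)) c x (Z x) := by
    obtain ⟨e, he⟩ := hBinv (c x) hy
    have h2 : B (c x) (mfderiv (𝓡 (2 * d)) (𝓡 (2 * d)) c x (Z x)) = coordOneForm α c (c x) := by
      ext v
      refine (hBΩ _ hy _ _).trans ?_
      have h3 : (mfderiv (𝓡 (2 * d)) (𝓡 (2 * d)) c.symm (c x)
          (mfderiv (𝓡 (2 * d)) (𝓡 (2 * d)) c x (Z x)) : 𝔼) = Z x :=
        congrArg (fun L : 𝔼 →L[ℝ] 𝔼 => L (Z x)) (hcm.symm_comp_deriv hx)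
      refine (twoForm_congr Ω (c.left_inv hx) h3 rfl).trans ((hZ x _).trans ?_)
      exact oneForm_congr α (c.left_inv hx).symm rfl
    rw [hZc]
    simp only
    rw [← h2, ← he, ContinuousLinearMap.inverse_equiv]
    exact e.symm_apply_apply _
  have hix : (mfderiv (𝓡 (2 * d)) (𝓡 (2 * d)) c x).IsInvertible := ⟨hcm.mfderiv hx, rfl⟩
  have h2 : Z x = VectorField.mpullback (𝓡 (2 * d)) (𝓡 (2 * d)) c
      (fun y : 𝔼 => (Zc y : TangentSpace (𝓡 (2 * d)) y)) x := by
    change (Z x : 𝔼) = (mfderiv (𝓡 (2 * d)) (𝓡 (2 * d)) c x : 𝔼 →L[ℝ] 𝔼).inverse (Zc (c x))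
    rw [h1]
    exact (congrArg (fun L => L (Z x)) hix.inverse_comp_self).symm
  rw [h2]

/-- The coordinate expression of the differential of a smooth function is smooth. -/
lemma contDiffOn_coordOneForm_differential {A : M → ℝ}
    (hA : ContMDiff (𝓡 (2 * d)) 𝓘(ℝ, ℝ) ∞ A) {c : OpenPartialHomeomorph M 𝔼}
    (hc : c ∈ atlas 𝔼 M) :
    ContDiffOn ℝ ∞ (coordOneForm (fun x => differential A x) c) c.target := by
  have h1 : ContDiffOn ℝ ∞ (fun y => A (c.symm y)) c.target := fun y hy =>
    (contMDiffAt_iff_contDiffAt.1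
      (hA.contMDiffAt.comp y (contMDiffAt_atlas_symm hc hy))).contDiffWithinAt
  refine (h1.fderiv_of_isOpen (m := ∞) c.open_target (by simp)).congr fun y hy => ?_
  ext w
  exact (fderiv_comp_apply (hA.mdifferentiable (by simp) _)
    ((contMDiffAt_atlas_symm hc hy).mdifferentiableAt (by simp)) w).symm

lemma contMDiff_liouvilleField (hΩ : IsExactSymplectic Ω lam)
    {X : (x : M) → TangentSpace (𝓡 (2 * d)) x} (hX : IsLiouvilleField Ω lam X) :
    ContMDiff (𝓡 (2 * d)) (𝓡 (2 * d)).tangent ∞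
      (fun x => (⟨x, X x⟩ : TangentBundle (𝓡 (2 * d)) M)) :=
  contMDiff_dualField hΩ hΩ.smooth hX

lemma contMDiff_hamiltonianField (hΩ : IsExactSymplectic Ω lam) {A : M → ℝ}
    (hA : ContMDiff (𝓡 (2 * d)) 𝓘(ℝ, ℝ) ∞ A)
    {Z : (x : M) → TangentSpace (𝓡 (2 * d)) x} (hZ : IsHamiltonianField Ω A Z) :
    ContMDiff (𝓡 (2 * d)) (𝓡 (2 * d)).tangent ∞
      (fun x => (⟨x, Z x⟩ : TangentBundle (𝓡 (2 * d)) M)) :=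
  contMDiff_dualField hΩ (fun _ hc => contDiffOn_coordOneForm_differential hA hc) hZ

omit [IsManifold (𝓡 (2 * d)) ∞ M] in
lemma differential_eq_zero_of_eventuallyEq {A : M → ℝ} {x : M} {a : ℝ} (h : A =ᶠ[𝓝 x] fun _ => a) :
    differential (d := d) A x = 0 := by
  rw [differential, h.mfderiv_eq, mfderiv_const]
  rfl

omit [IsManifold (𝓡 (2 * d)) ∞ M] in
/-- A Hamiltonian vector field vanishes off the closed sets off which the Hamiltonian does. -/
lemma hamiltonianField_eq_zero (hΩ : IsExactSymplectic Ω lam) {A : M → ℝ}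
    {Z : (x : M) → TangentSpace (𝓡 (2 * d)) x} (hZ : IsHamiltonianField Ω A Z) {K : Set M}
    (hK : IsClosed K) (hA : ∀ x ∉ K, A x = 0) {x : M} (hx : x ∉ K) : Z x = 0 := by
  refine hΩ.nondegenerate x _ fun v => ?_
  have h1 : A =ᶠ[𝓝 x] fun _ => 0 := by
    filter_upwards [hK.isOpen_compl.mem_nhds hx] with z hz using hA z hz
  rw [hZ]
  exact congrArg (fun L : 𝔼 →L[ℝ] ℝ => L v) (differential_eq_zero_of_eventuallyEq h1)

end Dual

/-! ### Curves with zero velocity -/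

section Constancy

variable {E : Type} [NormedAddCommGroup E] [NormedSpace ℝ E]
  {M : Type*} [TopologicalSpace M] [ChartedSpace E M] [IsManifold 𝓘(ℝ, E) ∞ M]

lemma eventually_eq_of_velocity_eq_zero {γ : ℝ → M} {J : Set ℝ} (hJ : Convex ℝ J) {s₀ : ℝ}
    (hs₀ : s₀ ∈ J) (h : ∀ᶠ s in 𝓝[J] s₀,
      HasMFDerivWithinAt 𝓘(ℝ, ℝ) 𝓘(ℝ, E) γ J s (velocity (0 : TangentSpace 𝓘(ℝ, E) (γ s)))) :
    ∀ᶠ s in 𝓝[J] s₀, γ s = γ s₀ := by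
  have hc := chart_mem_atlas E (γ s₀)
  have hs := mem_chart_source E (γ s₀)
  set c := chartAt E (γ s₀)
  have hγc : ContinuousWithinAt γ J s₀ := (h.self_of_nhdsWithin hs₀).continuousWithinAt
  have h1 : ∀ᶠ s in 𝓝[J] s₀, γ s ∈ c.source :=
    hγc.eventually (c.open_source.mem_nhds hs)
  obtain ⟨r, hr, hball⟩ := Metric.mem_nhdsWithin_iff.1 (h.and h1)
  have hconv : Convex ℝ (Metric.ball s₀ r ∩ J) := (convex_ball _ _).inter hJ
  have hder : ∀ s ∈ Metric.ball s₀ r ∩ J,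
      HasDerivWithinAt (fun s => c (γ s)) 0 (Metric.ball s₀ r ∩ J) s := by
    intro s hs
    obtain ⟨h2, h3⟩ := hball hs
    have h4 := (mdifferentiableAt_atlas (I := 𝓘(ℝ, E)) hc h3).hasMFDerivAt.comp_hasMFDerivWithinAt
      s h2
    set L : E →L[ℝ] E := mfderiv 𝓘(ℝ, E) 𝓘(ℝ, E) c (γ s)
    have h5 : HasFDerivWithinAt (fun s => c (γ s)) (L ∘L (1 : ℝ →L[ℝ] ℝ).smulRight (0 : E)) J s :=
      hasMFDerivWithinAt_iff_hasFDerivWithinAt.1 h4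
    exact (h5.hasDerivWithinAt.mono inter_subset_right).congr_deriv (by simp)
  filter_upwards [inter_mem_nhdsWithin J (Metric.ball_mem_nhds s₀ hr)] with s hs'
  have hs2 : s ∈ Metric.ball s₀ r ∩ J := ⟨hs'.2, hs'.1⟩
  have h2 := hconv.norm_image_sub_le_of_norm_hasDerivWithin_le (C := 0) hder (by simp)
    ⟨Metric.mem_ball_self hr, hs₀⟩ hs2
  rw [zero_mul, norm_le_zero_iff, sub_eq_zero] at h2
  exact c.injOn (hball hs2).2 hs h2

/-- A curve which has zero velocity whenever it is close to `p` stays at `p`. -/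
theorem eq_of_velocity_eq_zero [T2Space M] {γ : ℝ → M} {J : Set ℝ} (hJ : Convex ℝ J) {p : M}
    (hγ : ContinuousOn γ J)
    (h : ∀ s ∈ J, γ s = p → ∀ᶠ r in 𝓝[J] s,
      HasMFDerivWithinAt 𝓘(ℝ, ℝ) 𝓘(ℝ, E) γ J r (velocity (0 : TangentSpace 𝓘(ℝ, E) (γ r))))
    {s₀ : ℝ} (hs₀ : s₀ ∈ J) (hp : γ s₀ = p) {s : ℝ} (hs : s ∈ J) : γ s = p := by
  refine hJ.isPreconnected.induction₂' (fun a b => γ a = p → γ b = p) (fun a ha => ?_)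
    (fun a b c _ _ _ hab hbc hac => hbc (hab hac)) hs₀ hs hp
  by_cases hap : γ a = p
  · filter_upwards [eventually_eq_of_velocity_eq_zero hJ ha (h a ha hap)] with b hb
    exact ⟨fun _ => hb.trans hap, fun _ => hap⟩
  · filter_upwards [(hγ a ha).eventually (isOpen_compl_singleton.mem_nhds hap)] with b hb
    exact ⟨fun h => absurd h hap, fun h => absurd h hb⟩

end Constancy

/-! ### Integrals of compactly supported families -/

lemma integrable_of_eq_zero_off_compact {P : Type*} [TopologicalSpace P] [MeasurableSpace P]
    [BorelSpace P] [T2Space P] {ν : Measure P} [IsFiniteMeasureOnCompacts ν] {f : P → ℝ}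
    (hf : Continuous f) {K : Set P} (hK : IsCompact K) (h0 : ∀ x ∉ K, f x = 0) :
    Integrable f ν :=
  hf.integrable_of_hasCompactSupport (HasCompactSupport.intro hK fun x hx => h0 x hx)

/-- Differentiation under the integral sign for functions supported in a common compact set. -/
lemma hasDerivAt_integral_of_eq_zero_off_compact {P : Type*} [TopologicalSpace P]
    [MeasurableSpace P] [BorelSpace P] [T2Space P] {ν : Measure P} [IsFiniteMeasureOnCompacts ν]
    {h h' : ℝ → P → ℝ} (hh : ∀ t, Continuous (h t)) (hh' : Continuous fun p : ℝ × P => h' p.1 p.2)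
    (hd : ∀ t x, HasDerivAt (fun s => h s x) (h' t x) t) {K : Set P} (hK : IsCompact K)
    (h0 : ∀ t, ∀ x ∉ K, h t x = 0) (t : ℝ) :
    HasDerivAt (fun s => ∫ x, h s x ∂ν) (∫ x, h' t x ∂ν) t := by
  have h0' : ∀ s, ∀ x ∉ K, h' s x = 0 := by
    intro s x hx
    have h1 : (fun s => h s x) = fun _ => 0 := funext fun s => h0 s x hx
    have h2 := hd s x
    rw [h1] at h2
    exact h2.unique (hasDerivAt_const s 0)
  have hint : ∀ s, Integrable (h s) ν := fun s => integrable_of_eq_zero_off_compact (hh s) hK (h0 s)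
  have hint' : Integrable (h' t) ν :=
    integrable_of_eq_zero_off_compact (hh'.comp (by fun_prop : Continuous fun x : P => (t, x))) hK
      (h0' t)
  obtain ⟨C, hC⟩ := (isCompact_Icc.prod hK).exists_bound_of_continuousOn
    (s := Icc (t - 1) (t + 1) ×ˢ K) hh'.continuousOn
  refine (hasDerivAt_integral_of_dominated_loc_of_deriv_le (s := Icc (t - 1) (t + 1))
    (F := h) (F' := h') (bound := K.indicator fun _ => C)
    (Icc_mem_nhds (by linarith) (by linarith)) (Eventually.of_forall fun s =>
    (hint s).aestronglyMeasurable) (hint t) hint'.aestronglyMeasurable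
    (Eventually.of_forall fun x s hs => ?_) ?_ (Eventually.of_forall fun x s _ => hd s x)).2
  · by_cases hx : x ∈ K
    · rw [indicator_of_mem hx]
      exact hC (s, x) ⟨hs, hx⟩
    · rw [indicator_of_notMem hx, h0' s x hx, norm_zero]
  · rw [integrable_indicator_iff hK.measurableSet]
    exact integrableOn_const hK.measure_ne_top

/-! ### The divergence of Liouville and Hamiltonian vector fields -/

section Divergence

variable {d : ℕ} {M : Type*} [TopologicalSpace M]
  [ChartedSpace (EuclideanSpace ℝ (Fin (2 * d))) M]
  {Ω : (x : M) → TangentSpace (𝓡 (2 * d)) x →L[ℝ] TangentSpace (𝓡 (2 * d)) x →L[ℝ] ℝ}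
  {lam : (x : M) → TangentSpace (𝓡 (2 * d)) x →L[ℝ] ℝ}

local notation "𝔼" => EuclideanSpace ℝ (Fin (2 * d))

lemma hasDerivAt_comp_curve {γ : ℝ → M} {t : ℝ} {v : TangentSpace (𝓡 (2 * d)) (γ t)}
    (hγ : HasMFDerivAt 𝓘(ℝ, ℝ) (𝓡 (2 * d)) γ t (velocity v)) {A : M → ℝ}
    (hA : MDifferentiableAt (𝓡 (2 * d)) 𝓘(ℝ, ℝ) A (γ t)) :
    HasDerivAt (fun s => A (γ s)) (differential A (γ t) v) t := by
  have h1 : HasFDerivAt (fun s => A (γ s))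
      ((1 : ℝ →L[ℝ] ℝ).smulRight (differential A (γ t) v)) t :=
    hasMFDerivAt_iff_hasFDerivAt.1 (hγ.comp_velocity hA)
  exact h1.hasDerivAt.congr_deriv (one_smul ℝ (differential A (γ t) v : ℝ))

variable [IsManifold (𝓡 (2 * d)) ∞ M]

lemma contMDiff_timeDeriv {h : ℝ → M → ℝ}
    (hh : ContMDiff (𝓘(ℝ, ℝ).prod (𝓡 (2 * d))) 𝓘(ℝ, ℝ) ∞ (fun p : ℝ × M => h p.1 p.2)) :
    ContMDiff (𝓘(ℝ, ℝ).prod (𝓡 (2 * d))) 𝓘(ℝ, ℝ) ∞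
      (fun p : ℝ × M => deriv (fun s => h s p.2) p.1) := by
  rintro ⟨t₀, x₀⟩
  have hc := chart_mem_atlas 𝔼 x₀
  have hx₀ := mem_chart_source 𝔼 x₀
  set c := chartAt 𝔼 x₀
  set g : ℝ × 𝔼 → ℝ := fun z => h z.1 (c.symm z.2) with hg
  have hgs : ∀ t, ∀ y ∈ c.target, ContDiffAt ℝ ∞ g (t, y) := by
    intro t y hy
    have h1 : ContMDiffAt 𝓘(ℝ, ℝ × 𝔼) 𝓘(ℝ, ℝ) ∞ (fun z : ℝ × 𝔼 => z.1) (t, y) :=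
      contDiff_fst.contMDiff.contMDiffAt
    have h2 : ContMDiffAt 𝓘(ℝ, ℝ × 𝔼) 𝓘(ℝ, 𝔼) ∞ (fun z : ℝ × 𝔼 => z.2) (t, y) :=
      contDiff_snd.contMDiff.contMDiffAt
    have h3 : ContMDiffAt 𝓘(ℝ, ℝ × 𝔼) (𝓡 (2 * d)) ∞ (fun z : ℝ × 𝔼 => c.symm z.2) (t, y) :=
      (contMDiffAt_atlas_symm hc hy).comp (t, y) h2
    exact contMDiffAt_iff_contDiffAt.1 (hh.contMDiffAt.comp (t, y) (h1.prodMk h3))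
  have h1 : ContDiffAt ℝ ∞ (fun z => fderiv ℝ g z ((1 : ℝ), (0 : 𝔼))) (t₀, c x₀) :=
    ((hgs t₀ _ (c.map_source hx₀)).fderiv_right (m := ∞) (by simp)).clm_apply contDiffAt_const
  have h2 : ContMDiffAt (𝓘(ℝ, ℝ).prod (𝓡 (2 * d))) 𝓘(ℝ, ℝ × 𝔼) ∞
      (fun p : ℝ × M => (p.1, c p.2)) (t₀, x₀) :=
    contMDiffAt_fst.prodMk_space ((contMDiffAt_of_mem_maximalAtlas
      (IsManifold.subset_maximalAtlas hc) hx₀).comp (t₀, x₀) contMDiffAt_snd)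
  refine ((contMDiffAt_iff_contDiffAt.2 h1).comp (t₀, x₀) h2).congr_of_eventuallyEq ?_
  filter_upwards [(continuous_snd.tendsto (t₀, x₀)).eventually (c.open_source.mem_nhds hx₀)]
    with p hp
  have h3 := ((hgs p.1 _ (c.map_source hp)).differentiableAt (by simp)).hasFDerivAt.comp_hasDerivAt
    p.1 ((hasDerivAt_id p.1).prodMk (hasDerivAt_const p.1 (c p.2)))
  refine (HasDerivAt.congr_of_eventuallyEq h3 (Eventually.of_forall fun s => ?_)).deriv
  simp [hg, c.left_inv hp]

/-- Data for the Liouville flow near `C`: `μ` is the flow of a compactly supported vector field `Z`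
that agrees with `X` on `W`, and `μ` maps the neighbourhood `V` of `C` into `W` for short times. -/
structure IsCutoffFlow (X : (x : M) → TangentSpace (𝓡 (2 * d)) x) (C : Set M)
    (Z : (x : M) → TangentSpace (𝓡 (2 * d)) x) (μ : ℝ → M → M) (S W V : Set M) (ε : ℝ) : Prop where
  isFlow : IsFlow Z μ
  isCompact : IsCompact S
  eq_self : ∀ x ∉ S, ∀ t, μ t x = x
  isOpen_agree : IsOpen W
  agree : ∀ x ∈ W, Z x = X x
  isOpen : IsOpen V
  subset : C ⊆ V
  pos : 0 < ε
  mapsTo : ∀ s, |s| < ε → ∀ x ∈ V, μ s x ∈ W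

/-- Near a compact set, a smooth vector field has a smooth flow for short times: it is multiplied by
a bump function, and the product has a complete flow. -/
theorem exists_isCutoffFlow [T2Space M] [SecondCountableTopology M]
    {X : (x : M) → TangentSpace (𝓡 (2 * d)) x}
    (hX : ContMDiff (𝓡 (2 * d)) (𝓡 (2 * d)).tangent ∞
      (fun x => (⟨x, X x⟩ : TangentBundle (𝓡 (2 * d)) M))) {C : Set M} (hC : IsCompact C) :
    ∃ Z μ S W V ε, IsCutoffFlow X C Z μ S W V ε := by
  have : LocallyCompactSpace M := Manifold.locallyCompact_of_finiteDimensional (𝓡 (2 * d))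
  obtain ⟨S, hS, hCS⟩ := exists_compact_superset hC
  obtain ⟨χ, hχ0, hχ1, -⟩ := exists_contMDiffMap_zero_one_nhds_of_isClosed (𝓡 (2 * d)) (n := ⊤)
    (isOpen_interior (s := S)).isClosed_compl hC.isClosed
    (by rwa [← subset_compl_iff_disjoint_left, compl_compl])
  obtain ⟨W, hW, hCW, hχW⟩ := mem_nhdsSet_iff_exists.1 hχ1
  have hZS : ∀ x ∉ S, (χ x • X x : TangentSpace (𝓡 (2 * d)) x) = 0 := by
    intro x hx
    rw [hχ0.self_of_nhdsSet x fun h => hx (interior_subset h), zero_smul]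
  obtain ⟨μ, hμ, hμS⟩ := exists_isFlow (χ.contMDiff.smul_section hX) hS hZS
  -- the tube lemma gives the neighbourhood of `C` and the time for which it stays in `W`
  have hopen : IsOpen {q : ℝ × M | μ q.1 q.2 ∈ W} := hW.preimage hμ.smooth.continuous
  obtain ⟨I, V, hI, hV, h0I, hCV, hIV⟩ := generalized_tube_lemma
    (isCompact_singleton (x := (0 : ℝ))) hC hopen (by
      rintro ⟨s, x⟩ ⟨hs, hx⟩
      change μ s x ∈ W
      rw [show s = 0 from hs, hμ.zero]
      exact hCW hx)
  obtain ⟨ε, hε, hεI⟩ := Metric.isOpen_iff.1 hI 0 (singleton_subset_iff.1 h0I)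
  refine ⟨_, μ, S, W, V, ε, hμ, hS, hμS, hW, fun x hx => ?_, hV, hCV, hε, fun s hs x hx => ?_⟩
  · have h1 : χ x = 1 := hχW hx
    simp [h1]
  · exact hIV (show (s, x) ∈ I ×ˢ V from ⟨hεI (by simpa using hs), hx⟩)

section Cutoff

variable {X : (x : M) → TangentSpace (𝓡 (2 * d)) x} {C : Set M}
  {Z : (x : M) → TangentSpace (𝓡 (2 * d)) x} {μ : ℝ → M → M} {S W V : Set M} {ε : ℝ}

omit [IsManifold (𝓡 (2 * d)) ∞ M] in
lemma IsCutoffFlow.mem_agree (h : IsCutoffFlow X C Z μ S W V ε) {x : M} (hx : x ∈ V) : x ∈ W := by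
  rw [← h.isFlow.zero x]
  exact h.mapsTo 0 (by simpa using h.pos) x hx

omit [IsManifold (𝓡 (2 * d)) ∞ M] in
lemma IsCutoffFlow.mapsTo_uIcc (h : IsCutoffFlow X C Z μ S W V ε) {t : ℝ} (ht : |t| < ε) {x : M}
    (hx : x ∈ V) : ∀ s ∈ uIcc 0 t, μ s x ∈ W := fun s hs => by
  refine h.mapsTo s (lt_of_le_of_lt ?_ ht) x hx
  simpa using abs_sub_left_of_mem_uIcc hs

omit [IsManifold (𝓡 (2 * d)) ∞ M] in
/-- The backward trajectory from `μ t x` to `x ∈ V` stays in `W`. -/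
lemma IsCutoffFlow.mapsTo_uIcc_neg (h : IsCutoffFlow X C Z μ S W V ε) {t : ℝ} (ht : |t| < ε)
    {x : M} (hx : x ∈ V) : ∀ s ∈ uIcc 0 (-t), μ s (μ t x) ∈ W := fun s hs => by
  rw [← h.isFlow.add]
  refine h.mapsTo_uIcc ht hx _ ?_
  rw [mem_uIcc] at hs ⊢
  rcases hs with hs | hs
  · exact Or.inr ⟨by linarith, by linarith⟩
  · exact Or.inl ⟨by linarith, by linarith⟩

end Cutoff

variable [T2Space M] [SecondCountableTopology M]

/-- The derivative of a compactly supported function along the Liouville vector field, as a time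
derivative along the flow of a cut off field. -/
lemma exists_flow_deriv_eq_differential (hΩ : IsExactSymplectic Ω lam)
    {X : (x : M) → TangentSpace (𝓡 (2 * d)) x} (hX : IsLiouvilleField Ω lam X) {f : M → ℝ}
    (hf : ContMDiff (𝓡 (2 * d)) 𝓘(ℝ, ℝ) ∞ f) {C : Set M} (hC : IsCompact C)
    (h0 : ∀ x ∉ C, f x = 0) :
    ∃ Z μ S W V ε, IsCutoffFlow X C Z μ S W V ε ∧
      ContMDiff (𝓘(ℝ, ℝ).prod (𝓡 (2 * d))) 𝓘(ℝ, ℝ) ∞ (fun p : ℝ × M => f (μ p.1 p.2)) ∧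
      ∀ x, HasDerivAt (fun s => f (μ s x)) (differential f x (X x)) 0 := by
  obtain ⟨Z, μ, S, W, V, ε, h⟩ := exists_isCutoffFlow (contMDiff_liouvilleField hΩ hX) hC
  refine ⟨Z, μ, S, W, V, ε, h, hf.comp h.isFlow.smooth, fun x => ?_⟩
  have h1 := hasDerivAt_comp_curve (h.isFlow.deriv x 0) (hf.mdifferentiable (by simp) _)
  refine h1.congr_deriv ?_
  refine (oneForm_congr (differential f) (h.isFlow.zero x)
    (congrArg (fun y => (Z y : 𝔼)) (h.isFlow.zero x))).trans ?_
  by_cases hx : x ∈ C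
  · rw [h.agree x (h.mem_agree (h.subset hx))]
  · have h2 : differential (d := d) f x = 0 := differential_eq_zero_of_eventuallyEq (a := 0)
      (by filter_upwards [hC.isClosed.isOpen_compl.mem_nhds hx] with z hz using h0 z hz)
    rw [h2]
    rfl

lemma contMDiff_differential_liouvilleField (hΩ : IsExactSymplectic Ω lam)
    {X : (x : M) → TangentSpace (𝓡 (2 * d)) x} (hX : IsLiouvilleField Ω lam X) {f : M → ℝ}
    (hf : ContMDiff (𝓡 (2 * d)) 𝓘(ℝ, ℝ) ∞ f) {C : Set M} (hC : IsCompact C)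
    (h0 : ∀ x ∉ C, f x = 0) :
    ContMDiff (𝓡 (2 * d)) 𝓘(ℝ, ℝ) ∞ (fun x => (differential f x (X x) : ℝ)) := by
  obtain ⟨Z, μ, S, W, V, ε, -, hs, hd⟩ := exists_flow_deriv_eq_differential hΩ hX hf hC h0
  have h1 := (contMDiff_timeDeriv (h := fun t x => f (μ t x)) hs).comp
    (contMDiff_const (c := (0 : ℝ)) |>.prodMk (contMDiff_id (I := 𝓡 (2 * d)) (M := M)))
  exact h1.congr fun x => ((hd x).deriv).symm

variable [MeasurableSpace M] [BorelSpace M]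

/-- The Liouville vector field has divergence `d` with respect to `Ω ^ d`. -/
theorem integral_differential_liouvilleField (hΩ : IsExactSymplectic Ω lam)
    {X : (x : M) → TangentSpace (𝓡 (2 * d)) x} (hX : IsLiouvilleField Ω lam X) {f : M → ℝ}
    (hf : ContMDiff (𝓡 (2 * d)) 𝓘(ℝ, ℝ) ∞ f) {C : Set M} (hC : IsCompact C)
    (h0 : ∀ x ∉ C, f x = 0) :
    ∫ x, (differential f x (X x) : ℝ) ∂(liouvilleMeasure Ω) =
      -(d : ℝ) * ∫ x, f x ∂(liouvilleMeasure Ω) := by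
  have := isFiniteMeasureOnCompacts_liouvilleMeasure hΩ
  obtain ⟨Z, μ, S, W, V, ε, h, hs, hd⟩ := exists_flow_deriv_eq_differential hΩ hX hf hC h0
  have hflow := h.isFlow
  -- `∫ f ∘ μ_t = e ^ (- d t) ∫ f`
  have hscale : ∀ t, |t| < ε → ∫ x, f (μ t x) ∂(liouvilleMeasure Ω) =
      Real.exp (-(t * d)) * ∫ x, f x ∂(liouvilleMeasure Ω) := by
    intro t ht
    have h1 := integral_comp_diffeo (Ω := Ω) (hflow.diffeo t) (Real.exp_pos t) (U := μ t ⁻¹' V)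
      (f := f) (h.isOpen.preimage (hflow.contMDiff t).continuous) (fun x hx u v => ?_)
      (fun x hx => h0 _ fun hxC => hx (h.subset hxC))
    · have h2 : ∫ x, f (hflow.diffeo t x) ∂(liouvilleMeasure Ω) =
        ∫ x, f (μ t x) ∂(liouvilleMeasure Ω) := rfl
      rw [h1, h2, ← Real.exp_nat_mul, ← mul_assoc, ← Real.exp_add]
      rw [mul_comm (d : ℝ) t, neg_add_cancel, Real.exp_zero, one_mul]
    · refine twoForm_comp_mfderiv_liouvilleFlow hΩ hX hflow h.isOpen_agree h.agree
        (h.isOpen.preimage (hflow.contMDiff t).continuous) (fun x hx s hs => ?_) hx u v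
      have h3 : |s - t| ≤ |t| := by
        rw [abs_sub_comm]
        simpa using abs_sub_right_of_mem_uIcc hs
      have h4 := h.mapsTo (s - t) (h3.trans_lt ht) _ hx
      rwa [← hflow.add, sub_add_cancel] at h4
  have hd1 : HasDerivAt (fun t => ∫ x, f (μ t x) ∂(liouvilleMeasure Ω))
      (∫ x, (differential f x (X x) : ℝ) ∂(liouvilleMeasure Ω)) 0 := by
    have h1 := hasDerivAt_integral_of_eq_zero_off_compact (ν := liouvilleMeasure Ω)
      (h := fun t x => f (μ t x)) (h' := fun t x => deriv (fun s => f (μ s x)) t)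
      (fun t => hf.continuous.comp (hflow.contMDiff t).continuous)
      (contMDiff_timeDeriv (h := fun t x => f (μ t x)) hs).continuous (fun t x => ?_)
      (hC.union h.isCompact) (fun t x hx => ?_) 0
    · refine h1.congr_deriv (integral_congr_ae (Eventually.of_forall fun x => (hd x).deriv))
    · exact (hasDerivAt_comp_curve (hflow.deriv x t)
        (hf.mdifferentiable (by simp) _)).differentiableAt.hasDerivAt
    · rw [h.eq_self x fun hxS => hx (Or.inr hxS)]
      exact h0 x fun hxC => hx (Or.inl hxC)
  have hd2 : HasDerivAt (fun t : ℝ => Real.exp (-(t * d)) * ∫ x, f x ∂(liouvilleMeasure Ω))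
      (-(d : ℝ) * ∫ x, f x ∂(liouvilleMeasure Ω)) 0 := by
    have h1 := ((((hasDerivAt_id (0 : ℝ)).mul_const (d : ℝ)).neg).exp).mul_const
      (∫ x, f x ∂(liouvilleMeasure Ω))
    exact h1.congr_deriv (by simp)
  refine hd1.unique (hd2.congr_of_eventuallyEq ?_)
  filter_upwards [Metric.ball_mem_nhds (0 : ℝ) h.pos] with t ht
  exact hscale t (by simpa using ht)

omit [SecondCountableTopology M] [MeasurableSpace M] [BorelSpace M] in
lemma exists_isHamIsotopy_autonomous (hΩ : IsExactSymplectic Ω lam) {A : M → ℝ}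
    (hA : ContMDiff (𝓡 (2 * d)) 𝓘(ℝ, ℝ) ∞ A)
    {Z : (x : M) → TangentSpace (𝓡 (2 * d)) x} (hZ : IsHamiltonianField Ω A Z) {C : Set M}
    (hC : IsCompact C) (h0 : ∀ x ∉ C, A x = 0) :
    ∃ μ, IsFlow Z μ ∧ (∀ x ∉ C, ∀ t, μ t x = x) ∧
      IsHamIsotopy Ω (fun _ => A) (fun _ => Z) μ C := by
  obtain ⟨μ, hμ, hμC⟩ := exists_isFlow (contMDiff_hamiltonianField hΩ hA hZ) hC
    fun x hx => hamiltonianField_eq_zero hΩ hZ hC.isClosed h0 hx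
  exact ⟨μ, hμ, hμC, hA.comp contMDiff_snd, hμ.smooth, hμ.zero, fun _ => h0, fun _ => hZ,
    fun t x => hμ.deriv x t⟩

/-- Hamiltonian vector fields are divergence free. -/
theorem integral_differential_hamiltonianField (hΩ : IsExactSymplectic Ω lam) {A f : M → ℝ}
    (hA : ContMDiff (𝓡 (2 * d)) 𝓘(ℝ, ℝ) ∞ A)
    {Z : (x : M) → TangentSpace (𝓡 (2 * d)) x} (hZ : IsHamiltonianField Ω A Z) {C : Set M}
    (hC : IsCompact C) (hA0 : ∀ x ∉ C, A x = 0)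
    (hf : ContMDiff (𝓡 (2 * d)) 𝓘(ℝ, ℝ) ∞ f) (hf0 : ∀ x ∉ C, f x = 0) :
    ∫ x, (differential f x (Z x) : ℝ) ∂(liouvilleMeasure Ω) = 0 := by
  have := isFiniteMeasureOnCompacts_liouvilleMeasure hΩ
  obtain ⟨μ, hμ, hμC, hiso⟩ := exists_isHamIsotopy_autonomous hΩ hA hZ hC hA0
  have hconst : ∀ t, ∫ x, f (μ t x) ∂(liouvilleMeasure Ω) = ∫ x, f x ∂(liouvilleMeasure Ω) := by
    intro t
    have h1 := integral_comp_diffeo (Ω := Ω) (hμ.diffeo t) one_pos (U := univ) (f := f) isOpen_univ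
      (fun x _ u v => (hiso.twoForm_comp_mfderiv hΩ t x u v).trans (one_mul _).symm)
      (fun x hx => absurd (mem_univ x) hx)
    rw [one_pow, one_mul] at h1
    exact h1.symm
  have hd1 : HasDerivAt (fun t => ∫ x, f (μ t x) ∂(liouvilleMeasure Ω))
      (∫ x, deriv (fun s => f (μ s x)) 0 ∂(liouvilleMeasure Ω)) 0 :=
    hasDerivAt_integral_of_eq_zero_off_compact (ν := liouvilleMeasure Ω)
      (h := fun t x => f (μ t x)) (h' := fun t x => deriv (fun s => f (μ s x)) t)
      (fun t => hf.continuous.comp (hμ.contMDiff t).continuous)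
      (contMDiff_timeDeriv (h := fun t x => f (μ t x)) (hf.comp hμ.smooth)).continuous
      (fun t x => (hasDerivAt_comp_curve (hμ.deriv x t)
        (hf.mdifferentiable (by simp) _)).differentiableAt.hasDerivAt) hC
      (fun t x hx => by rw [hμC x hx]; exact hf0 x hx) 0
  rw [funext hconst] at hd1
  rw [← hd1.unique (hasDerivAt_const _ _)]
  refine integral_congr_ae (Eventually.of_forall fun x => ?_)
  have h1 := (hasDerivAt_comp_curve (hμ.deriv x 0) (hf.mdifferentiable (by simp) _)).deriv
  refine Eq.trans ?_ h1.symm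
  exact oneForm_congr (differential f) (hμ.zero x).symm
    (congrArg (fun y => (Z y : 𝔼)) (hμ.zero x).symm)

end Divergence

/-! ### The integral of the primitive -/

section Isotopy

variable {d : ℕ} {M : Type*} [TopologicalSpace M]
  [ChartedSpace (EuclideanSpace ℝ (Fin (2 * d))) M] [IsManifold (𝓡 (2 * d)) ∞ M] [T2Space M]
  {Ω : (x : M) → TangentSpace (𝓡 (2 * d)) x →L[ℝ] TangentSpace (𝓡 (2 * d)) x →L[ℝ] ℝ}
  {lam : (x : M) → TangentSpace (𝓡 (2 * d)) x →L[ℝ] ℝ}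
  {H : ℝ → M → ℝ} {Y : ℝ → (x : M) → TangentSpace (𝓡 (2 * d)) x} {Φ : ℝ → M → M} {K : Set M}

local notation "𝔼" => EuclideanSpace ℝ (Fin (2 * d))

lemma smulRight_one_comp_smulRight_one {V : Type*} [NormedAddCommGroup V] [NormedSpace ℝ V]
    (v : V) (r : ℝ) : (1 : ℝ →L[ℝ] ℝ).smulRight v ∘L (1 : ℝ →L[ℝ] ℝ).smulRight r =
      (1 : ℝ →L[ℝ] ℝ).smulRight (r • v) := by
  ext
  simp

lemma contMDiff_slice_real {h : ℝ → M → ℝ}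
    (hh : ContMDiff (𝓘(ℝ, ℝ).prod (𝓡 (2 * d))) 𝓘(ℝ, ℝ) ∞ (fun p : ℝ × M => h p.1 p.2)) (t : ℝ) :
    ContMDiff (𝓡 (2 * d)) 𝓘(ℝ, ℝ) ∞ (h t) :=
  hh.comp (contMDiff_const.prodMk contMDiff_id)

lemma IsHamIsotopy.field_eq_zero (hΩ : IsExactSymplectic Ω lam) (h : IsHamIsotopy Ω H Y Φ K)
    (hK : IsCompact K) (t : ℝ) {x : M} (hx : x ∉ K) : Y t x = 0 :=
  hamiltonianField_eq_zero hΩ (h.ham t) hK.isClosed (h.support t) hx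

/-- Off the compact set `K` the velocity vanishes, so that the isotopy fixes the points there. -/
lemma IsHamIsotopy.eq_self (hΩ : IsExactSymplectic Ω lam) (h : IsHamIsotopy Ω H Y Φ K)
    (hK : IsCompact K) {x : M} (hx : x ∉ K) (t : ℝ) : Φ t x = x := by
  have hcont : Continuous fun s => Φ s x :=
    h.smooth.continuous.comp (by fun_prop : Continuous fun s : ℝ => (s, x))
  refine eq_of_velocity_eq_zero (E := 𝔼) (γ := fun s => Φ s x) convex_univ hcont.continuousOn
    (fun s _ (hs : Φ s x = x) => ?_) (mem_univ 0) (h.zero x) (mem_univ t)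
  have h1 : ∀ᶠ r in 𝓝 s, Φ r x ∉ K :=
    hcont.continuousAt.eventually (hK.isClosed.isOpen_compl.mem_nhds
      (show Φ s x ∈ Kᶜ by rw [hs]; exact hx))
  rw [nhdsWithin_univ]
  filter_upwards [h1] with r hr
  have h2 := (h.flow r x).hasMFDerivWithinAt (s := univ)
  rwa [h.field_eq_zero hΩ hK r hr] at h2

lemma IsHamIsotopy.primitive_eq_zero (hΩ : IsExactSymplectic Ω lam) (h : IsHamIsotopy Ω H Y Φ K)
    (hK : IsCompact K) {x : M} (hx : x ∉ K) (t : ℝ) : primitive lam H Y Φ t x = 0 := by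
  have h1 : ∀ s, primitiveRate lam H Y s (Φ s x) = 0 := by
    intro s
    rw [h.eq_self hΩ hK hx, primitiveRate, h.field_eq_zero hΩ hK s hx, map_zero,
      h.support s x hx, add_zero]
  simp [primitive, h1]

/-- `dΦ_t` maps the Hamiltonian field of `H_t ∘ Φ_t` to the one of `H_t`. -/
lemma IsHamIsotopy.mfderiv_hamiltonianField (hΩ : IsExactSymplectic Ω lam)
    (h : IsHamIsotopy Ω H Y Φ K) (t : ℝ) {Z : (x : M) → TangentSpace (𝓡 (2 * d)) x}
    (hZ : IsHamiltonianField Ω (fun x => H t (Φ t x)) Z) (x : M) :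
    mfderiv (𝓡 (2 * d)) (𝓡 (2 * d)) (Φ t) x (Z x) = Y t (Φ t x) := by
  set L : 𝔼 →L[ℝ] 𝔼 := mfderiv (𝓡 (2 * d)) (𝓡 (2 * d)) (Φ t) x with hL
  set B : 𝔼 →L[ℝ] 𝔼 →L[ℝ] ℝ := Ω (Φ t x) with hB
  have hsymp : ∀ u v, B (L u) (L v) = (Ω x : 𝔼 →L[ℝ] 𝔼 →L[ℝ] ℝ) u v :=
    h.twoForm_comp_mfderiv hΩ t x
  -- a symplectic linear map is injective, hence surjective
  have hinj : Function.Injective (L : 𝔼 →ₗ[ℝ] 𝔼) := by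
    rw [← LinearMap.ker_eq_bot, LinearMap.ker_eq_bot']
    intro u hu
    refine hΩ.nondegenerate x u fun v => (hsymp u v).symm.trans ?_
    rw [show L u = 0 from hu, map_zero]
    rfl
  have hsurj : Function.Surjective L := LinearMap.injective_iff_surjective.1 hinj
  have hdiff : ∀ u : 𝔼, (differential (fun x => H t (Φ t x)) x : 𝔼 →L[ℝ] ℝ) u =
      (differential (H t) (Φ t x) : 𝔼 →L[ℝ] ℝ) (L u) := fun u =>
    mfderiv_comp_apply x ((contMDiff_slice_real h.smooth_ham t).mdifferentiable (by simp) _)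
      ((contMDiff_slice h.smooth t).mdifferentiable (by simp) _) u
  set y : 𝔼 := Y t (Φ t x) with hy
  have hzero : ∀ v, B (L (Z x) - y) v = 0 := by
    intro v
    obtain ⟨u, rfl⟩ := hsurj v
    have h1 : B y (L u) = (differential (H t) (Φ t x) : 𝔼 →L[ℝ] ℝ) (L u) :=
      h.ham t _ _
    have h2 : B (L (Z x)) (L u) = (differential (fun x => H t (Φ t x)) x : 𝔼 →L[ℝ] ℝ) u :=
      (hsymp _ _).trans (hZ x u)
    rw [map_sub, _root_.sub_apply, h1, h2, hdiff, sub_self]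
  exact sub_eq_zero.1 (hΩ.nondegenerate (Φ t x) _ hzero)

lemma IsHamIsotopy.continuous_primitiveRate (hΩ : IsExactSymplectic Ω lam)
    (h : IsHamIsotopy Ω H Y Φ K) :
    Continuous fun p : ℝ × M => primitiveRate lam H Y p.1 (Φ p.1 p.2) := by
  rw [continuous_iff_continuousAt]
  rintro ⟨t, x⟩
  have hx := mem_chart_source 𝔼 x
  have hc := chart_mem_atlas 𝔼 x
  set c := chartAt 𝔼 x
  have h1 := ((h.contDiffOn_primitiveRate hΩ hc).contDiffAt
    ((isOpen_univ.prod c.open_target).mem_nhds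
      (show (t, c x) ∈ univ ×ˢ c.target from ⟨mem_univ _, c.map_source hx⟩))).continuousAt
  have h2 : ContinuousAt (fun p : ℝ × M => (p.1, c p.2)) (t, x) :=
    continuousAt_fst.prodMk (ContinuousAt.comp (x := (t, x)) (c.continuousAt hx) continuousAt_snd)
  refine (ContinuousAt.comp (x := (t, x)) h1 h2).congr ?_
  filter_upwards [(continuous_snd.tendsto (t, x)).eventually (c.open_source.mem_nhds hx)] with p hp
  simp [c.left_inv hp]

lemma IsHamIsotopy.hasDerivAt_primitive (hΩ : IsExactSymplectic Ω lam)
    (h : IsHamIsotopy Ω H Y Φ K) (t : ℝ) (x : M) :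
    HasDerivAt (fun s => primitive lam H Y Φ s x) (primitiveRate lam H Y t (Φ t x)) t := by
  have h1 : Continuous fun s => primitiveRate lam H Y s (Φ s x) :=
    (h.continuous_primitiveRate hΩ).comp (by fun_prop : Continuous fun s : ℝ => (s, x))
  exact (h1.integral_hasStrictDerivAt 0 t).hasDerivAt

/-- The rate is `H_t - dH_t(X)`, where `X` is the Liouville vector field. -/
lemma primitiveRate_eq (hΩ : IsExactSymplectic Ω lam) (h : IsHamIsotopy Ω H Y Φ K)
    {X : (x : M) → TangentSpace (𝓡 (2 * d)) x} (hX : IsLiouvilleField Ω lam X) (t : ℝ) (x : M) :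
    primitiveRate lam H Y t x = H t x - differential (H t) x (X x) := by
  rw [primitiveRate, ← hX, twoForm_antisymm hΩ, h.ham t]
  exact neg_add_eq_sub _ _

variable [SecondCountableTopology M] [MeasurableSpace M] [BorelSpace M]

/-- The maps of a Hamiltonian isotopy preserve integrals. -/
theorem IsHamIsotopy.integral_comp (hΩ : IsExactSymplectic Ω lam) (h : IsHamIsotopy Ω H Y Φ K)
    (hK : IsCompact K) {f : M → ℝ} (hf : ContMDiff (𝓡 (2 * d)) 𝓘(ℝ, ℝ) ∞ f)
    (hf0 : ∀ x ∉ K, f x = 0) (t : ℝ) :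
    ∫ x, f (Φ t x) ∂(liouvilleMeasure Ω) = ∫ x, f x ∂(liouvilleMeasure Ω) := by
  have := isFiniteMeasureOnCompacts_liouvilleMeasure hΩ
  have hcurve : ∀ t x, HasDerivAt (fun s => f (Φ s x))
      (differential f (Φ t x) (Y t (Φ t x))) t := fun t x =>
    hasDerivAt_comp_curve (h.flow t x) (hf.mdifferentiable (by simp) _)
  have hoff : ∀ {g : M → ℝ}, (∀ x ∉ K, g x = 0) → ∀ t, ∀ x ∉ K, g (Φ t x) = 0 :=
    fun hg t x hx => by rw [h.eq_self hΩ hK hx]; exact hg x hx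
  have hd : ∀ t, HasDerivAt (fun t => ∫ x, f (Φ t x) ∂(liouvilleMeasure Ω)) 0 t := by
    intro t
    have h1 := hasDerivAt_integral_of_eq_zero_off_compact (ν := liouvilleMeasure Ω)
      (h := fun t x => f (Φ t x)) (h' := fun t x => deriv (fun s => f (Φ s x)) t)
      (fun t => hf.continuous.comp (contMDiff_slice h.smooth t).continuous)
      (contMDiff_timeDeriv (h := fun t x => f (Φ t x)) (hf.comp h.smooth)).continuous
      (fun t x => (hcurve t x).differentiableAt.hasDerivAt) hK (hoff hf0) t
    refine h1.congr_deriv ?_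
    obtain ⟨Z, hZ⟩ := exists_dualField hΩ (fun x => differential (fun x => H t (Φ t x)) x)
    have hHs := contMDiff_slice_real h.smooth_ham t
    have hΦs := contMDiff_slice h.smooth t
    rw [← integral_differential_hamiltonianField hΩ (hHs.comp hΦs) hZ hK
      (hoff (h.support t) t) (hf.comp hΦs) (hoff hf0 t)]
    refine integral_congr_ae (Eventually.of_forall fun x => (hcurve t x).deriv.trans ?_)
    have h2 := mfderiv_comp_apply x (hf.mdifferentiable (by simp) (Φ t x))
      (hΦs.mdifferentiable (by simp) x) (Z x)
    refine Eq.trans ?_ h2.symm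
    exact oneForm_congr (differential f) rfl (h.mfderiv_hamiltonianField hΩ t hZ x).symm
  have hconst := is_const_of_deriv_eq_zero (fun s => (hd s).differentiableAt)
    (fun s => (hd s).deriv) t 0
  simpa only [h.zero] using hconst

theorem IsHamIsotopy.integral_primitiveRate (hΩ : IsExactSymplectic Ω lam)
    (h : IsHamIsotopy Ω H Y Φ K) (hK : IsCompact K)
    {X : (x : M) → TangentSpace (𝓡 (2 * d)) x} (hX : IsLiouvilleField Ω lam X) (t : ℝ) :
    ∫ x, primitiveRate lam H Y t (Φ t x) ∂(liouvilleMeasure Ω) =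
      ((d : ℝ) + 1) * ∫ x, H t x ∂(liouvilleMeasure Ω) := by
  have := isFiniteMeasureOnCompacts_liouvilleMeasure hΩ
  have hHs := contMDiff_slice_real h.smooth_ham t
  have hXH := contMDiff_differential_liouvilleField hΩ hX hHs hK (h.support t)
  have hXH0 : ∀ x ∉ K, (differential (H t) x (X x) : ℝ) = 0 := by
    intro x hx
    refine (h.ham t x (X x)).symm.trans ?_
    rw [h.field_eq_zero hΩ hK t hx, map_zero]
    rfl
  have heq := funext (primitiveRate_eq hΩ h hX t)
  rw [h.integral_comp hΩ hK (f := primitiveRate lam H Y t) (by rw [heq]; exact hHs.sub hXH)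
    (fun x hx => by
      rw [primitiveRate_eq hΩ h hX, hXH0 x hx, h.support t x hx, sub_zero]), heq,
    integral_sub (integrable_of_eq_zero_off_compact hHs.continuous hK (h.support t))
      (integrable_of_eq_zero_off_compact hXH.continuous hK hXH0),
    integral_differential_liouvilleField hΩ hX hHs hK (h.support t)]
  ring

/-- The integral of the primitive of `φ^* lam - lam` is `d + 1` times the Calabi invariant. -/
theorem IsHamIsotopy.integral_primitive (hΩ : IsExactSymplectic Ω lam)
    (h : IsHamIsotopy Ω H Y Φ K) (hK : IsCompact K)
    {X : (x : M) → TangentSpace (𝓡 (2 * d)) x} (hX : IsLiouvilleField Ω lam X) :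
    ∫ x, primitive lam H Y Φ 1 x ∂(liouvilleMeasure Ω) = ((d : ℝ) + 1) * calabiIntegral Ω H := by
  have := isFiniteMeasureOnCompacts_liouvilleMeasure hΩ
  have hd : ∀ t, HasDerivAt (fun t => ∫ x, primitive lam H Y Φ t x ∂(liouvilleMeasure Ω))
      (((d : ℝ) + 1) * ∫ x, H t x ∂(liouvilleMeasure Ω)) t := fun t =>
    (hasDerivAt_integral_of_eq_zero_off_compact (ν := liouvilleMeasure Ω)
      (fun t => (h.contMDiff_primitive hΩ t).continuous) (h.continuous_primitiveRate hΩ)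
      (h.hasDerivAt_primitive hΩ) hK (fun t x hx => h.primitive_eq_zero hΩ hK hx t) t).congr_deriv
      (h.integral_primitiveRate hΩ hK hX t)
  have hcont : Continuous fun t => ∫ x, H t x ∂(liouvilleMeasure Ω) := by
    rw [← continuousOn_univ]
    exact continuousOn_integral_of_compact_support hK h.smooth_ham.continuous.continuousOn
      fun t x _ hx => h.support t x hx
  have h1 := intervalIntegral.integral_eq_sub_of_hasDerivAt (a := 0) (b := 1) (fun t _ => hd t)
    ((continuous_const.mul hcont).intervalIntegrable _ _)
  rw [intervalIntegral.integral_const_mul] at h1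
  rw [calabiIntegral, h1]
  simp [primitive]

/-- A Hamiltonian isotopy with `t ∈ [0, 1]` can be reparametrized to one which is defined for all
times and has the same time one map and the same Calabi integral. -/
theorem Generates.exists_isHamIsotopy (hΩ : IsExactSymplectic Ω lam) (h : Generates Ω 1 H Φ) :
    ∃ H' Y' Φ' K, IsCompact K ∧ IsHamIsotopy Ω H' Y' Φ' K ∧ (∀ x, Φ' 1 x = Φ 1 x) ∧
      calabiIntegral Ω H' = calabiIntegral Ω H := by
  have := isFiniteMeasureOnCompacts_liouvilleMeasure hΩ
  obtain ⟨K, hK, hHK⟩ := h.compact_support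
  obtain ⟨Y, hY, hflow⟩ := h.flow
  set ρ : ℝ → ℝ := Real.smoothTransition
  have hρ : ContDiff ℝ ∞ ρ := Real.smoothTransition.contDiff
  have hρ1 : ∀ t, ρ t ∈ Icc (0 : ℝ) 1 := fun t =>
    ⟨Real.smoothTransition.nonneg t, Real.smoothTransition.le_one t⟩
  have hρ0 : ρ 0 = 0 := Real.smoothTransition.zero_of_nonpos le_rfl
  have hρ11 : ρ 1 = 1 := Real.smoothTransition.one_of_one_le le_rfl
  have hρd : ∀ t, HasDerivAt ρ (deriv ρ t) t := fun t =>
    (hρ.differentiable (by simp) t).hasDerivAt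
  have hρ' : ContDiff ℝ ∞ (deriv ρ) := (contDiff_infty_iff_deriv.1 hρ).2
  have hsupp : ∀ t ∈ Icc (0 : ℝ) 1, ∀ x ∉ K, H t x = 0 := fun t ht x hx =>
    image_eq_zero_of_notMem_tsupport fun hx' => hx (hHK t ht hx')
  have hreparam : ContMDiff (𝓘(ℝ, ℝ).prod (𝓡 (2 * d))) (𝓘(ℝ, ℝ).prod (𝓡 (2 * d))) ∞
      (fun p : ℝ × M => (ρ p.1, p.2)) := (hρ.contMDiff.comp contMDiff_fst).prodMk contMDiff_snd
  have hmem : ∀ p : ℝ × M, (ρ p.1, p.2) ∈ Icc (0 : ℝ) 1 ×ˢ (univ : Set M) :=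
    fun p => ⟨hρ1 _, mem_univ _⟩
  refine ⟨fun t x => deriv ρ t * H (ρ t) x, fun t x => deriv ρ t • Y (ρ t) x,
    fun t x => Φ (ρ t) x, K, hK, ⟨?_, ?_, ?_, ?_, ?_, ?_⟩, fun x => congrArg (Φ · x) hρ11, ?_⟩
  · exact (hρ'.contMDiff.comp contMDiff_fst).mul (h.smooth_ham.comp_contMDiff hreparam hmem)
  · exact h.smooth_isotopy.comp_contMDiff hreparam hmem
  · intro x
    simp only [hρ0]
    exact h.initial x
  · intro t x hx
    rw [hsupp _ (hρ1 t) x hx, mul_zero]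
  · intro t x v
    have hs : ContMDiff (𝓡 (2 * d)) 𝓘(ℝ, ℝ) ∞ (H (ρ t)) :=
      h.smooth_ham.comp_contMDiff (contMDiff_const.prodMk contMDiff_id)
        fun x => ⟨hρ1 t, mem_univ _⟩
    have h1 := (((hs.mdifferentiable (by simp) x).hasMFDerivAt).const_smul (deriv ρ t)).mfderiv
    have h2 := congrArg (fun L : 𝔼 →L[ℝ] ℝ => L v) h1
    refine Eq.trans ?_ h2.symm
    rw [map_smul]
    exact congrArg (deriv ρ t * ·) (hY (ρ t) (hρ1 t) x v)
  · intro t x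
    have h1 : HasMFDerivWithinAt 𝓘(ℝ, ℝ) 𝓘(ℝ, ℝ) ρ univ t
      ((1 : ℝ →L[ℝ] ℝ).smulRight (deriv ρ t)) := (hρd t).hasFDerivAt.hasMFDerivAt.hasMFDerivWithinAt
    have h2 := (hflow (ρ t) (hρ1 t) x).comp t h1 fun s _ => hρ1 s
    rw [hasMFDerivWithinAt_univ] at h2
    refine h2.congr_mfderiv ?_
    exact smulRight_one_comp_smulRight_one (V := 𝔼) _ _
  · have hcont : ContinuousOn (fun t => ∫ x, H t x ∂(liouvilleMeasure Ω)) (Icc 0 1) :=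
      continuousOn_integral_of_compact_support hK h.smooth_ham.continuousOn
        fun t x ht hx => hsupp t ht x hx
    have h1 := intervalIntegral.integral_comp_mul_deriv'' (a := 0) (b := 1) (f := ρ)
      (f' := deriv ρ) (g := fun t => ∫ x, H t x ∂(liouvilleMeasure Ω)) hρ.continuous.continuousOn
      (fun t _ => (hρd t).hasDerivWithinAt) hρ'.continuous.continuousOn
      (hcont.mono (image_subset_iff.2 fun t _ => hρ1 t))
    rw [hρ0, hρ11] at h1
    rw [calabiIntegral, calabiIntegral, ← h1]
    refine intervalIntegral.integral_congr fun t _ => ?_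
    simp only [Function.comp_apply]
    rw [integral_const_mul, mul_comm]

end Isotopy

/-! ### The Liouville flow and the cut off flow -/

section Velocity

variable {E : Type} [NormedAddCommGroup E] [NormedSpace ℝ E]
  {M : Type*} [TopologicalSpace M] [ChartedSpace E M]

/-- The velocity of a curve that moves in a family of maps. -/
lemma _root_.HasMFDerivWithinAt.velocity_family {Φ : ℝ → M → M}
    (hΦ : ContMDiff (𝓘(ℝ, ℝ).prod 𝓘(ℝ, E)) 𝓘(ℝ, E) ∞ (fun p : ℝ × M => Φ p.1 p.2))
    {γ : ℝ → M} {J : Set ℝ} {t : ℝ} {v : TangentSpace 𝓘(ℝ, E) (γ t)}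
    (hγ : HasMFDerivWithinAt 𝓘(ℝ, ℝ) 𝓘(ℝ, E) γ J t (velocity v))
    {y : TangentSpace 𝓘(ℝ, E) (Φ t (γ t))}
    (hy : HasMFDerivAt 𝓘(ℝ, ℝ) 𝓘(ℝ, E) (fun s => Φ s (γ t)) t (velocity y)) :
    HasMFDerivWithinAt 𝓘(ℝ, ℝ) 𝓘(ℝ, E) (fun s => Φ s (γ s)) J t
      (velocity (y + mfderiv 𝓘(ℝ, E) 𝓘(ℝ, E) (Φ t) (γ t) v)) := by
  have hd : MDifferentiableAt (𝓘(ℝ, ℝ).prod 𝓘(ℝ, E)) 𝓘(ℝ, E) (fun p : ℝ × M => Φ p.1 p.2)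
    (t, γ t) := hΦ.mdifferentiable (by simp) _
  set w : E := v
  have h1 := hd.hasMFDerivAt.comp_hasMFDerivWithinAt t ((hasMFDerivWithinAt_id J t).prodMk hγ)
  refine h1.congr_mfderiv ?_
  have h2 := mfderiv_prod_eq_add_apply (v := ((1 : ℝ), w)) hd
  have h3 : (mfderiv 𝓘(ℝ, ℝ) 𝓘(ℝ, E) (fun s => Φ s (γ t)) t : ℝ →L[ℝ] E) 1 = y := by
    rw [hy.mfderiv]
    exact one_smul ℝ (y : E)
  have h4 := h2.trans (congrArg (· + (mfderiv 𝓘(ℝ, E) 𝓘(ℝ, E) (Φ t) (γ t) : E →L[ℝ] E) w) h3)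
  set L : ℝ × E →L[ℝ] E :=
    mfderiv (𝓘(ℝ, ℝ).prod 𝓘(ℝ, E)) 𝓘(ℝ, E) (fun p : ℝ × M => Φ p.1 p.2) (t, γ t)
  have h5 : L ∘L (ContinuousLinearMap.id ℝ ℝ).prod ((1 : ℝ →L[ℝ] ℝ).smulRight w) =
      (1 : ℝ →L[ℝ] ℝ).smulRight (L (1, w)) := by
    ext
    simp
  exact h5.trans (congrArg (fun e : E => (1 : ℝ →L[ℝ] ℝ).smulRight e) h4)

/-- A vector field is invariant under its flow. -/
lemma IsFlow.mfderiv_field {Z : (x : M) → TangentSpace 𝓘(ℝ, E) x} {μ : ℝ → M → M}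
    (h : IsFlow Z μ) (t : ℝ) (x : M) :
    mfderiv 𝓘(ℝ, E) 𝓘(ℝ, E) (μ t) x (Z x) = Z (μ t x) := by
  have h1 := (h.deriv x 0).comp_velocity ((h.contMDiff t).mdifferentiable (by simp) (μ 0 x))
  have h2 : HasMFDerivAt 𝓘(ℝ, ℝ) 𝓘(ℝ, E) (fun s => μ s (μ t x)) 0 (velocity (Z (μ 0 (μ t x)))) :=
    h.deriv (μ t x) 0
  have heq : (fun s => μ t (μ s x)) = fun s => μ s (μ t x) := by
    funext s
    rw [← h.add, ← h.add, add_comm]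
  rw [heq] at h1
  have h3 := congrArg (fun L : ℝ →L[ℝ] E => L 1) (hasMFDerivAt_unique h1 h2)
  have h4 := ((one_smul ℝ (_ : E)).symm.trans h3).trans (one_smul ℝ (_ : E))
  rw [h.zero, h.zero] at h4
  exact h4

/-- The derivative of a flow run backwards. -/
lemma IsFlow.deriv_neg {Z : (x : M) → TangentSpace 𝓘(ℝ, E) x} {μ : ℝ → M → M}
    (h : IsFlow Z μ) (x : M) (t : ℝ) :
    HasMFDerivAt 𝓘(ℝ, ℝ) 𝓘(ℝ, E) (fun s => μ (-s) x) t (velocity (-Z (μ (-t) x))) := by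
  have h1 : HasMFDerivAt 𝓘(ℝ, ℝ) 𝓘(ℝ, ℝ) (fun s : ℝ => -s) t
    ((1 : ℝ →L[ℝ] ℝ).smulRight (-1)) := (hasDerivAt_neg t).hasFDerivAt.hasMFDerivAt
  refine ((h.deriv x (-t)).comp t h1).congr_mfderiv ?_
  exact (smulRight_one_comp_smulRight_one (V := E) _ _).trans
    (congrArg (fun v : E => (1 : ℝ →L[ℝ] ℝ).smulRight v) (neg_one_smul ℝ (Z (μ (-t) x) : E)))

end Velocity

section Commutator

variable {d : ℕ} {M : Type*} [TopologicalSpace M]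
  [ChartedSpace (EuclideanSpace ℝ (Fin (2 * d))) M] [IsManifold (𝓡 (2 * d)) ∞ M] [T2Space M]
  {Ω : (x : M) → TangentSpace (𝓡 (2 * d)) x →L[ℝ] TangentSpace (𝓡 (2 * d)) x →L[ℝ] ℝ}
  {lam : (x : M) → TangentSpace (𝓡 (2 * d)) x →L[ℝ] ℝ}
  {X : (x : M) → TangentSpace (𝓡 (2 * d)) x} {Z : (x : M) → TangentSpace (𝓡 (2 * d)) x}
  {μ : ℝ → M → M} {S W V K : Set M} {ε : ℝ}

local notation "𝔼" => EuclideanSpace ℝ (Fin (2 * d))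

lemma IsFlow.mem_flowDomain (h : IsFlow Z μ) (hZX : ∀ x ∈ W, Z x = X x) {t : ℝ} {x : M}
    (hx : ∀ s ∈ uIcc 0 t, μ s x ∈ W) : x ∈ flowDomain X t :=
  ⟨fun s => μ s x, h.zero x, fun s hs => by
    rw [← hZX _ (hx s hs)]
    exact (h.deriv x s).hasMFDerivWithinAt⟩

/-- The flow of `X` agrees with the one of a vector field `Z` along the trajectories that stay in an
open set where `X` and `Z` agree. -/
theorem IsFlow.flow_eq (h : IsFlow Z μ) (hW : IsOpen W) (hZX : ∀ x ∈ W, Z x = X x) {t : ℝ} {x : M}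
    (hx : ∀ s ∈ uIcc 0 t, μ s x ∈ W) : flow X t x = μ t x := by
  have hex : ∃ γ : ℝ → M, γ 0 = x ∧ IsMIntegralCurveOn γ X (uIcc 0 t) :=
    h.mem_flowDomain hZX hx
  rw [flow, dif_pos hex]
  obtain ⟨h0, hγ⟩ := hex.choose_spec
  set γ := hex.choose
  have hback : ContMDiff (𝓘(ℝ, ℝ).prod (𝓡 (2 * d))) (𝓡 (2 * d)) ∞
      (fun p : ℝ × M => μ (-p.1) p.2) :=
    h.smooth.comp ((contDiff_neg.contMDiff.comp contMDiff_fst).prodMk contMDiff_snd)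
  have hinv : ∀ s y, μ (-s) y = x → y = μ s x := by
    rintro s y rfl
    rw [← h.add, add_neg_cancel, h.zero]
  have hvel : ∀ s ∈ uIcc 0 t, γ s ∈ W → HasMFDerivWithinAt 𝓘(ℝ, ℝ) (𝓡 (2 * d))
      (fun s => μ (-s) (γ s)) (uIcc 0 t) s
      (velocity (0 : TangentSpace (𝓡 (2 * d)) (μ (-s) (γ s)))) := by
    intro s hs hsW
    have h1 := HasMFDerivWithinAt.velocity_family hback (hγ s hs) (h.deriv_neg (γ s) s)
    rw [← hZX _ hsW, h.mfderiv_field, neg_add_cancel] at h1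
    exact h1
  have hcont : ContinuousOn (fun s => μ (-s) (γ s)) (uIcc 0 t) := fun s hs =>
    (HasMFDerivWithinAt.velocity_family hback (hγ s hs) (h.deriv_neg (γ s) s)).continuousWithinAt
  -- the curve `μ_{-s} (γ s)` is constant
  refine hinv t (γ t) (eq_of_velocity_eq_zero (E := 𝔼) (γ := fun s => μ (-s) (γ s))
    (convex_uIcc 0 t) (p := x) hcont (fun s hs hsx => ?_) left_mem_uIcc ?_ right_mem_uIcc)
  · have h1 : γ s ∈ W := by
      rw [hinv s _ hsx]
      exact hx s hs
    filter_upwards [(hγ s hs).continuousWithinAt.eventually (hW.mem_nhds h1),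
      self_mem_nhdsWithin] with r hr hr'
    exact hvel r hr' hr
  · rw [neg_zero, h.zero, h0]

/-- A compactly supported diffeomorphism `φ` with `φ^* lam = lam + dA`, where `A` is compactly
supported. -/
structure IsExactDiffeo (lam : (x : M) → TangentSpace (𝓡 (2 * d)) x →L[ℝ] ℝ)
    (φ : M ≃ₘ^∞⟮𝓡 (2 * d), 𝓡 (2 * d)⟯ M) (A : M → ℝ) (K : Set M) : Prop where
  isCompact : IsCompact K
  smooth : ContMDiff (𝓡 (2 * d)) 𝓘(ℝ, ℝ) ∞ A
  eq_zero : ∀ x ∉ K, A x = 0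
  eq_self : ∀ x ∉ K, φ x = x
  pullback : ∀ x v, lam (φ x) (mfderiv (𝓡 (2 * d)) (𝓡 (2 * d)) φ x v) =
    lam x v + differential A x v

section Exact

variable {φ : M ≃ₘ^∞⟮𝓡 (2 * d), 𝓡 (2 * d)⟯ M} {A : M → ℝ}

lemma IsExactDiffeo.symm_eq_self (h : IsExactDiffeo lam φ A K) {x : M} (hx : x ∉ K) :
    φ.symm x = x := by
  exact φ.injective ((φ.apply_symm_apply x).trans (h.eq_self x hx).symm)

lemma IsExactDiffeo.mem_of_superset (h : IsExactDiffeo lam φ A K) {U : Set M} (hU : K ⊆ U) {x : M}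
    (hx : x ∈ U) : φ x ∈ U := by
  by_cases hxK : φ x ∈ K
  · exact hU hxK
  · have h1 := h.symm_eq_self hxK
    rw [φ.symm_apply_apply] at h1
    rwa [← h1]

lemma IsExactDiffeo.mapSupport_subset (h : IsExactDiffeo lam φ A K) : mapSupport φ ⊆ K :=
  closure_minimal (fun x hx => by_contra fun hxK => hx (h.eq_self x hxK)) h.isCompact.isClosed

/-- The conjugate of `φ` by the time `t` map of a flow. -/
def conjDiffeo (hμ : IsFlow Z μ) (φ : M ≃ₘ^∞⟮𝓡 (2 * d), 𝓡 (2 * d)⟯ M) (t : ℝ) :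
    M ≃ₘ^∞⟮𝓡 (2 * d), 𝓡 (2 * d)⟯ M :=
  ((hμ.diffeo t).symm.trans φ).trans (hμ.diffeo t)

lemma conjDiffeo_apply (hμ : IsFlow Z μ) (t : ℝ) (z : M) :
    conjDiffeo hμ φ t z = μ t (φ (μ (-t) z)) := rfl

lemma mfderiv_conjDiffeo (hμ : IsFlow Z μ) (t : ℝ) (z : M) (v : TangentSpace (𝓡 (2 * d)) z) :
    mfderiv (𝓡 (2 * d)) (𝓡 (2 * d)) (conjDiffeo hμ φ t) z v =
      mfderiv (𝓡 (2 * d)) (𝓡 (2 * d)) (μ t) (φ (μ (-t) z))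
        (mfderiv (𝓡 (2 * d)) (𝓡 (2 * d)) φ (μ (-t) z)
          (mfderiv (𝓡 (2 * d)) (𝓡 (2 * d)) (μ (-t)) z v)) := by
  have h1 := fun t => (hμ.contMDiff t).mdifferentiable (by simp)
  have h2 := φ.contMDiff.mdifferentiable (by simp)
  have h3 := mfderiv_comp_apply (g := μ t) (f := fun z => φ (μ (-t) z)) z (h1 t _)
    ((h2 _).comp z (h1 (-t) z)) v
  have h4 := mfderiv_comp_apply (g := φ) (f := μ (-t)) z (h2 _) (h1 (-t) z) v
  exact h3.trans (congrArg (mfderiv (𝓡 (2 * d)) (𝓡 (2 * d)) (μ t) (φ (μ (-t) z))) h4)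

/-- The conjugate isotopy moves with the velocity `Z - ψ_* Z`. -/
lemma hasMFDerivAt_conjDiffeo (hμ : IsFlow Z μ) (t : ℝ) (z : M) :
    HasMFDerivAt 𝓘(ℝ, ℝ) (𝓡 (2 * d)) (fun s => conjDiffeo hμ φ s z) t
      (velocity (Z (conjDiffeo hμ φ t z) -
        mfderiv (𝓡 (2 * d)) (𝓡 (2 * d)) (conjDiffeo hμ φ t) z (Z z))) := by
  have h1 := (hμ.deriv_neg z t).comp_velocity (φ.contMDiff.mdifferentiable (by simp) (μ (-t) z))
  have h2 := HasMFDerivWithinAt.velocity_family hμ.smooth (h1.hasMFDerivWithinAt (s := univ))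
    (hμ.deriv _ t)
  refine (h2.hasMFDerivAt univ_mem).congr_mfderiv ?_
  have h3 := mfderiv_conjDiffeo (φ := φ) hμ t z (Z z)
  rw [hμ.mfderiv_field] at h3
  rw [h3, map_neg, map_neg]
  exact congrArg (fun e : 𝔼 => (1 : ℝ →L[ℝ] ℝ).smulRight e) (sub_eq_add_neg (_ : 𝔼) _).symm

/-- `ψ^* lam = lam + dG`, where `ψ` is the conjugate of `φ` and `G = e^t A ∘ μ_{-t}`. -/
lemma IsExactDiffeo.lam_comp_mfderiv_conjDiffeo (hΩ : IsExactSymplectic Ω lam)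
    (hX : IsLiouvilleField Ω lam X) (h : IsExactDiffeo lam φ A K)
    (hc : IsCutoffFlow X K Z μ S W V ε) {t : ℝ} (ht : |t| < ε) {z : M} (hz : μ (-t) z ∈ V)
    (v : TangentSpace (𝓡 (2 * d)) z) :
    lam (conjDiffeo hc.isFlow φ t z)
      (mfderiv (𝓡 (2 * d)) (𝓡 (2 * d)) (conjDiffeo hc.isFlow φ t) z v) =
      lam z v + differential (fun x => Real.exp t * A (μ (-t) x)) z v := by
  have hμ := hc.isFlow
  have hq := h.mem_of_superset hc.subset hz
  have h1 := lam_comp_mfderiv_liouvilleFlow hΩ hX hμ hc.isOpen_agree hc.agree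
    (hc.mapsTo_uIcc ht hq)
  have hback : ∀ s ∈ uIcc 0 (-t), μ s z ∈ W := by
    have h2 := hc.mapsTo_uIcc_neg ht hz
    rwa [← hμ.add, add_neg_cancel, hμ.zero] at h2
  have h2 := lam_comp_mfderiv_liouvilleFlow hΩ hX hμ hc.isOpen_agree hc.agree hback v
  have hAd : MDifferentiableAt (𝓡 (2 * d)) 𝓘(ℝ, ℝ) A (μ (-t) z) :=
    h.smooth.mdifferentiable (by simp) _
  have hμd : MDifferentiableAt (𝓡 (2 * d)) (𝓡 (2 * d)) (μ (-t)) z :=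
    (hμ.contMDiff (-t)).mdifferentiable (by simp) _
  have hdG : (differential (fun x => Real.exp t * A (μ (-t) x)) z v : ℝ) = Real.exp t *
      differential A (μ (-t) z) (mfderiv (𝓡 (2 * d)) (𝓡 (2 * d)) (μ (-t)) z v) := by
    have h3 := ((hAd.hasMFDerivAt.comp z hμd.hasMFDerivAt).const_smul (Real.exp t)).mfderiv
    exact congrArg (fun L : 𝔼 →L[ℝ] ℝ => L v) h3
  rw [mfderiv_conjDiffeo, hdG]
  refine (h1 _).trans ?_
  rw [h.pullback, h2, mul_add, ← mul_assoc, ← Real.exp_add, add_neg_cancel, Real.exp_zero, one_mul]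

/-- The velocity field of the conjugate isotopy is Hamiltonian: its contraction with `Ω` pulls back
to `dG`. -/
lemma IsExactDiffeo.twoForm_velocity_conjDiffeo (hΩ : IsExactSymplectic Ω lam)
    (hX : IsLiouvilleField Ω lam X) (h : IsExactDiffeo lam φ A K)
    (hc : IsCutoffFlow X K Z μ S W V ε) {t : ℝ} (ht : |t| < ε) (z : M)
    (u : TangentSpace (𝓡 (2 * d)) z) :
    Ω (conjDiffeo hc.isFlow φ t z) (Z (conjDiffeo hc.isFlow φ t z) -
        mfderiv (𝓡 (2 * d)) (𝓡 (2 * d)) (conjDiffeo hc.isFlow φ t) z (Z z))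
      (mfderiv (𝓡 (2 * d)) (𝓡 (2 * d)) (conjDiffeo hc.isFlow φ t) z u) =
      differential (fun x => Real.exp t * A (μ (-t) x)) z u := by
  have hμ := hc.isFlow
  have hμc : Continuous (μ (-t)) := (hμ.contMDiff (-t)).continuous
  have hGs : ContMDiff (𝓡 (2 * d)) 𝓘(ℝ, ℝ) ∞ (fun x => Real.exp t * A (μ (-t) x)) :=
    contMDiff_const.mul (h.smooth.comp (hμ.contMDiff (-t)))
  by_cases hz : μ (-t) z ∈ V
  · have hzW : z ∈ W := by
      have h1 := hc.mapsTo t ht _ hz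
      rwa [← hμ.add, add_neg_cancel, hμ.zero] at h1
    have hwW : conjDiffeo hμ φ t z ∈ W := hc.mapsTo t ht _ (h.mem_of_superset hc.subset hz)
    have hsymp := twoForm_comp_mfderiv (a := 1) hΩ (conjDiffeo hμ φ t).contMDiff.contMDiffAt
      hGs.contMDiffAt (by
        filter_upwards [(hc.isOpen.preimage hμc).mem_nhds hz] with z' hz' v
        rw [one_mul]
        exact h.lam_comp_mfderiv_conjDiffeo hΩ hX hc ht hz' v) (X z) u
    rw [hc.agree _ hzW, hc.agree _ hwW, map_sub, _root_.sub_apply, hsymp, hX, hX, one_mul,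
      h.lam_comp_mfderiv_conjDiffeo hΩ hX hc ht hz]
    exact add_sub_cancel_left _ _
  · -- near `z`, the conjugate is the identity
    have hzK : μ (-t) z ∉ K := fun hK => hz (hc.subset hK)
    have hnear : ∀ᶠ z' in 𝓝 z, μ (-t) z' ∉ K :=
      hμc.continuousAt.eventually (h.isCompact.isClosed.isOpen_compl.mem_nhds hzK)
    have hψ : (conjDiffeo hμ φ t : M → M) =ᶠ[𝓝 z] id := by
      filter_upwards [hnear] with z' hz'
      rw [conjDiffeo_apply, h.eq_self _ hz', ← hμ.add, add_neg_cancel, hμ.zero]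
      rfl
    have hG : (fun x => Real.exp t * A (μ (-t) x)) =ᶠ[𝓝 z] fun _ => 0 := by
      filter_upwards [hnear] with z' hz'
      rw [h.eq_zero _ hz', mul_zero]
    have hd : (mfderiv (𝓡 (2 * d)) (𝓡 (2 * d)) (conjDiffeo hμ φ t) z : 𝔼 →L[ℝ] 𝔼) =
        ContinuousLinearMap.id ℝ 𝔼 := by
      rw [hψ.mfderiv_eq, mfderiv_id]
      rfl
    have h1 : (Z (conjDiffeo hμ φ t z) : 𝔼) -
        (mfderiv (𝓡 (2 * d)) (𝓡 (2 * d)) (conjDiffeo hμ φ t) z : 𝔼 →L[ℝ] 𝔼) (Z z) = 0 := by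
      rw [hd, hψ.eq_of_nhds]
      exact sub_self _
    have h2 : differential (d := d) (fun x => Real.exp t * A (μ (-t) x)) z = 0 :=
      differential_eq_zero_of_eventuallyEq hG
    rw [h2]
    refine (twoForm_congr Ω (rfl : conjDiffeo hμ φ t z = _) h1 rfl).trans ?_
    rw [map_zero]
    rfl

end Exact
end Commutator

/-! ### The commutator isotopy and the Calabi invariant -/

section Main

variable {d : ℕ} {M : Type*} [TopologicalSpace M]
  [ChartedSpace (EuclideanSpace ℝ (Fin (2 * d))) M] [IsManifold (𝓡 (2 * d)) ∞ M] [T2Space M]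
  {Ω : (x : M) → TangentSpace (𝓡 (2 * d)) x →L[ℝ] TangentSpace (𝓡 (2 * d)) x →L[ℝ] ℝ}
  {lam : (x : M) → TangentSpace (𝓡 (2 * d)) x →L[ℝ] ℝ}
  {X : (x : M) → TangentSpace (𝓡 (2 * d)) x} {Z : (x : M) → TangentSpace (𝓡 (2 * d)) x}
  {μ : ℝ → M → M} {S W V K : Set M} {ε : ℝ} {φ : M ≃ₘ^∞⟮𝓡 (2 * d), 𝓡 (2 * d)⟯ M} {A : M → ℝ}

local notation "𝔼" => EuclideanSpace ℝ (Fin (2 * d))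

lemma IsCutoffFlow.flow_eq (hc : IsCutoffFlow X K Z μ S W V ε) {t : ℝ} (ht : |t| < ε) {x : M}
    (hx : x ∈ V) : flow X t x = μ t x :=
  hc.isFlow.flow_eq hc.isOpen_agree hc.agree (hc.mapsTo_uIcc ht hx)

lemma IsCutoffFlow.flow_neg_eq (hc : IsCutoffFlow X K Z μ S W V ε) {t : ℝ} (ht : |t| < ε) {x : M}
    (hx : x ∈ V) : flow X (-t) (μ t x) = x := by
  rw [hc.isFlow.flow_eq hc.isOpen_agree hc.agree (hc.mapsTo_uIcc_neg ht hx), ← hc.isFlow.add,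
    neg_add_cancel, hc.isFlow.zero]

lemma IsExactDiffeo.flowDefinedOnSupport (h : IsExactDiffeo lam φ A K)
    (hc : IsCutoffFlow X K Z μ S W V ε) {δ : ℝ} (hδ : δ < ε) : FlowDefinedOnSupport X φ δ := by
  intro t ht x hx
  have hxV := hc.subset (h.mapSupport_subset hx)
  have ht' : |t| < ε := by
    rw [abs_of_nonneg ht.1]
    exact ht.2.trans_lt hδ
  exact ⟨hc.isFlow.mem_flowDomain hc.agree (hc.mapsTo_uIcc ht' hxV),
    hc.isFlow.mem_flowDomain hc.agree (hc.mapsTo_uIcc (by rwa [abs_neg]) hxV)⟩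

/-- For short times, the commutator can be computed with the cut off flow. -/
lemma IsExactDiffeo.flowCommutator_eq (h : IsExactDiffeo lam φ A K)
    (hc : IsCutoffFlow X K Z μ S W V ε) {t : ℝ} (ht : |t| < ε) (x : M) :
    flowCommutator X φ t x = conjDiffeo hc.isFlow φ t (φ.symm x) := by
  have hSV : mapSupport φ ⊆ V := h.mapSupport_subset.trans hc.subset
  have himg : flow X t '' mapSupport φ = μ t '' mapSupport φ :=
    image_congr fun x hx => hc.flow_eq ht (hSV hx)
  rw [flowCommutator, flowConj, himg, conjDiffeo_apply]
  generalize φ.symm x = y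
  split_ifs with hy
  · obtain ⟨z, hz, rfl⟩ := hy
    rw [hc.flow_neg_eq ht (hSV hz), hc.flow_eq ht (h.mem_of_superset hc.subset (hSV hz)),
      ← hc.isFlow.add, neg_add_cancel, hc.isFlow.zero]
  · have h1 : φ (μ (-t) y) = μ (-t) y := by
      by_contra hne
      refine hy ⟨_, subset_closure hne, ?_⟩
      rw [← hc.isFlow.add, add_neg_cancel, hc.isFlow.zero]
    rw [h1, ← hc.isFlow.add, add_neg_cancel, hc.isFlow.zero]

/-- The velocity field `Z - ψ_* Z` of the conjugate isotopy `ψ`. -/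
def conjField (hμ : IsFlow Z μ) (φ : M ≃ₘ^∞⟮𝓡 (2 * d), 𝓡 (2 * d)⟯ M) (t : ℝ) (w : M) :
    TangentSpace (𝓡 (2 * d)) w :=
  let u : 𝔼 := mfderiv (𝓡 (2 * d)) (𝓡 (2 * d)) (conjDiffeo hμ φ t)
    ((conjDiffeo hμ φ t).symm w) (Z ((conjDiffeo hμ φ t).symm w))
  let v : 𝔼 := Z w
  v - u

lemma conjField_conjDiffeo (hμ : IsFlow Z μ) (t : ℝ) (z : M) :
    (conjField hμ φ t (conjDiffeo hμ φ t z) : 𝔼) = Z (conjDiffeo hμ φ t z) -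
      mfderiv (𝓡 (2 * d)) (𝓡 (2 * d)) (conjDiffeo hμ φ t) z (Z z) := by
  have h : ∀ y, y = z → (mfderiv (𝓡 (2 * d)) (𝓡 (2 * d)) (conjDiffeo hμ φ t) y (Z y) : 𝔼) =
      mfderiv (𝓡 (2 * d)) (𝓡 (2 * d)) (conjDiffeo hμ φ t) z (Z z) := by
    rintro y rfl
    rfl
  set w : 𝔼 := Z (conjDiffeo hμ φ t z) with hw
  exact congrArg (w - ·) (h _ ((conjDiffeo hμ φ t).symm_apply_apply z))

/-- The Hamiltonian function `e^t A ∘ φ⁻¹ ∘ μ_{-t}` of the commutator isotopy. -/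
def commutatorHam (φ : M ≃ₘ^∞⟮𝓡 (2 * d), 𝓡 (2 * d)⟯ M) (A : M → ℝ) (μ : ℝ → M → M) (t : ℝ)
    (x : M) : ℝ :=
  Real.exp t * A (φ.symm (μ (-t) x))

/-- The commutator isotopy is Hamiltonian for short times. -/
theorem IsExactDiffeo.generates_flowCommutator (hΩ : IsExactSymplectic Ω lam)
    (hX : IsLiouvilleField Ω lam X) (h : IsExactDiffeo lam φ A K)
    (hc : IsCutoffFlow X K Z μ S W V ε) {δ : ℝ} (hδ : δ < ε) :
    Generates Ω δ (commutatorHam φ A μ) (flowCommutator X φ) := by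
  have hμ := hc.isFlow
  have habs : ∀ t ∈ Icc 0 δ, |t| < ε := fun t ht => by
    rw [abs_of_nonneg ht.1]
    exact ht.2.trans_lt hδ
  have hback : ContMDiff (𝓘(ℝ, ℝ).prod (𝓡 (2 * d))) (𝓡 (2 * d)) ∞
      (fun p : ℝ × M => μ (-p.1) p.2) :=
    hμ.smooth.comp ((contDiff_neg.contMDiff.comp contMDiff_fst).prodMk contMDiff_snd)
  have hFs : ContMDiff (𝓘(ℝ, ℝ).prod (𝓡 (2 * d))) 𝓘(ℝ, ℝ) ∞
      (fun p : ℝ × M => commutatorHam φ A μ p.1 p.2) :=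
    (Real.contDiff_exp.contMDiff.comp contMDiff_fst).mul
      (h.smooth.comp (φ.symm.contMDiff.comp hback))
  have hψs : ContMDiff (𝓘(ℝ, ℝ).prod (𝓡 (2 * d))) (𝓡 (2 * d)) ∞
      (fun p : ℝ × M => conjDiffeo hμ φ p.1 (φ.symm p.2)) :=
    hμ.smooth.comp (contMDiff_fst.prodMk (φ.contMDiff.comp (hμ.smooth.comp
      ((contDiff_neg.contMDiff.comp contMDiff_fst).prodMk
        (φ.symm.contMDiff.comp contMDiff_snd)))))
  refine ⟨hFs.contMDiffOn, ?_, ?_, ?_, ?_⟩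
  · refine ⟨(fun p : ℝ × M => μ p.1 p.2) '' (Icc 0 δ ×ˢ K),
      (isCompact_Icc.prod h.isCompact).image hμ.smooth.continuous, fun t ht => ?_⟩
    refine closure_minimal (fun x hx => ?_)
      ((isCompact_Icc.prod h.isCompact).image hμ.smooth.continuous).isClosed
    have hxK : μ (-t) x ∈ K := by
      by_contra hxK
      refine hx ?_
      rw [commutatorHam, h.symm_eq_self hxK, h.eq_zero _ hxK, mul_zero]
    refine ⟨(t, μ (-t) x), ⟨ht, hxK⟩, ?_⟩
    simp only
    rw [← hμ.add, add_neg_cancel, hμ.zero]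
  · exact hψs.contMDiffOn.congr fun p hp => h.flowCommutator_eq hc (habs _ hp.1) _
  · intro x
    rw [h.flowCommutator_eq hc (by simpa using hc.pos), conjDiffeo_apply, neg_zero, hμ.zero,
      hμ.zero, φ.apply_symm_apply]
  · refine ⟨conjField hμ φ, fun t ht w v => ?_, fun t ht x => ?_⟩
    · set ψ := conjDiffeo hμ φ t with hψ
      obtain ⟨z, rfl⟩ := ψ.surjective w
      have hψd : MDifferentiableAt (𝓡 (2 * d)) (𝓡 (2 * d)) ψ z :=
        ψ.contMDiff.mdifferentiable (by simp) z
      obtain ⟨u, rfl⟩ := (ψ.mfderivToContinuousLinearEquiv (by simp) z).surjective v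
      have hFd : MDifferentiableAt (𝓡 (2 * d)) 𝓘(ℝ, ℝ) (commutatorHam φ A μ t) (ψ z) :=
        (contMDiff_slice_real hFs t).mdifferentiable (by simp) _
      have h1 := mfderiv_comp_apply z hFd hψd u
      have h2 : commutatorHam φ A μ t ∘ ψ = fun x => Real.exp t * A (μ (-t) x) := by
        funext x
        rw [Function.comp_apply, commutatorHam, hψ, conjDiffeo_apply, ← hμ.add, neg_add_cancel,
          hμ.zero, φ.symm_apply_apply]
      rw [h2] at h1
      refine Eq.trans ?_ ((h.twoForm_velocity_conjDiffeo hΩ hX hc (habs t ht) z u).trans h1)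
      exact twoForm_congr Ω (rfl : ψ z = _) (conjField_conjDiffeo hμ t z) rfl
    · have h1 := (hasMFDerivAt_conjDiffeo (φ := φ) hμ t (φ.symm x)).hasMFDerivWithinAt
        (s := Icc 0 δ)
      have heq : ∀ s ∈ Icc 0 δ, flowCommutator X φ s x = conjDiffeo hμ φ s (φ.symm x) :=
        fun s hs => h.flowCommutator_eq hc (habs s hs) x
      refine (h1.congr_mono heq (heq t ht) Subset.rfl).congr_mfderiv ?_
      refine congrArg (fun e : 𝔼 => (1 : ℝ →L[ℝ] ℝ).smulRight e) ?_
      refine (conjField_conjDiffeo hμ t (φ.symm x)).symm.trans ?_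
      exact congrArg (fun y => (conjField hμ φ t y : 𝔼)) (heq t ht).symm

variable [SecondCountableTopology M]

theorem IsExactDiffeo.exists_generates (hΩ : IsExactSymplectic Ω lam)
    (hX : IsLiouvilleField Ω lam X) (h : IsExactDiffeo lam φ A K) :
    ∃ δ : ℝ, 0 < δ ∧ FlowDefinedOnSupport X φ δ ∧ ∃ F, Generates Ω δ F (flowCommutator X φ) ∧
      ∀ x, F 0 x = A (φ.symm x) := by
  obtain ⟨Z, μ, S, W, V, ε, hc⟩ := exists_isCutoffFlow (contMDiff_liouvilleField hΩ hX) h.isCompact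
  have hε := hc.pos
  refine ⟨ε / 2, half_pos hε, h.flowDefinedOnSupport hc (half_lt_self hε), commutatorHam φ A μ,
    h.generates_flowCommutator hΩ hX hc (half_lt_self hε), fun x => ?_⟩
  rw [commutatorHam, Real.exp_zero, one_mul, neg_zero, hc.isFlow.zero]

variable [MeasurableSpace M] [BorelSpace M]

/-- Compactly supported functions with the same differential have the same integral, because the
Liouville vector field has nonzero divergence. -/
theorem integral_eq_of_differential_eq (hd : 1 ≤ d) (hΩ : IsExactSymplectic Ω lam)
    (hX : IsLiouvilleField Ω lam X) {f g : M → ℝ} (hf : ContMDiff (𝓡 (2 * d)) 𝓘(ℝ, ℝ) ∞ f)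
    (hg : ContMDiff (𝓡 (2 * d)) 𝓘(ℝ, ℝ) ∞ g) {C C' : Set M} (hC : IsCompact C)
    (hf0 : ∀ x ∉ C, f x = 0) (hC' : IsCompact C') (hg0 : ∀ x ∉ C', g x = 0)
    (hfg : ∀ x v, differential (d := d) f x v = differential g x v) :
    ∫ x, f x ∂(liouvilleMeasure Ω) = ∫ x, g x ∂(liouvilleMeasure Ω) := by
  have h1 := integral_differential_liouvilleField hΩ hX hf hC hf0
  have h2 := integral_differential_liouvilleField hΩ hX hg hC' hg0
  have h3 : (fun x => (differential f x (X x) : ℝ)) = fun x => differential g x (X x) :=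
    funext fun x => hfg x (X x)
  rw [h3, h2] at h1
  have hd' : -(d : ℝ) ≠ 0 := neg_ne_zero.2 (Nat.cast_ne_zero.2 (by omega))
  exact (mul_left_cancel₀ hd' h1).symm

/-- An exact diffeomorphism is symplectic, and hence preserves integrals. -/
lemma IsExactDiffeo.integral_comp_symm (hΩ : IsExactSymplectic Ω lam)
    (h : IsExactDiffeo lam φ A K) :
    ∫ x, A (φ.symm x) ∂(liouvilleMeasure Ω) = ∫ x, A x ∂(liouvilleMeasure Ω) := by
  have h1 := integral_comp_diffeo (Ω := Ω) φ one_pos (U := univ) (f := fun x => A (φ.symm x))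
    isOpen_univ (fun x _ u v => twoForm_comp_mfderiv hΩ φ.contMDiff.contMDiffAt
      h.smooth.contMDiffAt (Eventually.of_forall fun x v => ?_) u v)
    (fun x hx => absurd (mem_univ x) hx)
  · rw [one_pow, one_mul] at h1
    simpa only [φ.symm_apply_apply] using h1
  · rw [one_mul]
    exact h.pullback x v

/-- A compactly supported Hamiltonian diffeomorphism is exact, and the integral of the primitive of
`φ^* lam - lam` gives the Calabi integral of each of its generating functions. -/
theorem GeneratesDiffeo.exists_isExactDiffeo (hΩ : IsExactSymplectic Ω lam)
    (hX : IsLiouvilleField Ω lam X) {H : ℝ → M → ℝ} (hH : GeneratesDiffeo Ω H φ) :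
    ∃ A K, IsExactDiffeo lam φ A K ∧
      ∫ x, A x ∂(liouvilleMeasure Ω) = ((d : ℝ) + 1) * calabiIntegral Ω H := by
  obtain ⟨Φ, hΦ, hφ⟩ := hH
  obtain ⟨H', Y, Φ', K, hK, hiso, hΦ', hcal⟩ := hΦ.exists_isHamIsotopy hΩ
  have heq : Φ' 1 = φ := funext fun x => (hΦ' x).trans (hφ x)
  refine ⟨primitive lam H' Y Φ' 1, K, ⟨hK, hiso.contMDiff_primitive hΩ 1,
    fun x hx => hiso.primitive_eq_zero hΩ hK hx 1, fun x hx => ?_, fun x v => ?_⟩, ?_⟩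
  · rw [← heq]
    exact hiso.eq_self hΩ hK hx 1
  · rw [← heq]
    exact hiso.lam_comp_mfderiv hΩ 1 x v
  · rw [hiso.integral_primitive hΩ hK hX, hcal]

/-- The Calabi integral does not depend on the generating function. -/
theorem GeneratesDiffeo.calabiIntegral_eq (hd : 1 ≤ d) (hΩ : IsExactSymplectic Ω lam)
    (hX : IsLiouvilleField Ω lam X) {H H' : ℝ → M → ℝ} (hH : GeneratesDiffeo Ω H φ)
    (hH' : GeneratesDiffeo Ω H' φ) : calabiIntegral Ω H = calabiIntegral Ω H' := by
  obtain ⟨A, K, hA, hcal⟩ := hH.exists_isExactDiffeo hΩ hX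
  obtain ⟨A', K', hA', hcal'⟩ := hH'.exists_isExactDiffeo hΩ hX
  have h1 := integral_eq_of_differential_eq hd hΩ hX hA.smooth hA'.smooth hA.isCompact hA.eq_zero
    hA'.isCompact hA'.eq_zero fun x v =>
      add_left_cancel ((hA.pullback x v).symm.trans (hA'.pullback x v))
  rw [hcal, hcal'] at h1
  exact mul_left_cancel₀ (by positivity) h1

/-- The initial value of a generating function is determined up to a constant by the isotopy. -/
lemma Generates.differential_zero_eq {T T' : ℝ} (hT : 0 < T) (hT' : 0 < T') {F F' : ℝ → M → ℝ}
    {Φ : ℝ → M → M} (h : Generates Ω T F Φ) (h' : Generates Ω T' F' Φ) (x : M)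
    (v : TangentSpace (𝓡 (2 * d)) x) : differential (F 0) x v = differential (F' 0) x v := by
  obtain ⟨Y, hY, hf⟩ := h.flow
  obtain ⟨Y', hY', hf'⟩ := h'.flow
  have h0 : (0 : ℝ) ∈ Icc 0 T := left_mem_Icc.2 hT.le
  have h0' : (0 : ℝ) ∈ Icc 0 T' := left_mem_Icc.2 hT'.le
  have hmin : 0 < min T T' := lt_min hT hT'
  have hu : UniqueMDiffWithinAt 𝓘(ℝ, ℝ) (Icc 0 (min T T')) (0 : ℝ) :=
    uniqueMDiffWithinAt_iff_uniqueDiffWithinAt.2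
      (uniqueDiffOn_Icc hmin 0 (left_mem_Icc.2 hmin.le))
  have h1 := hu.eq ((hf 0 h0 x).mono (Icc_subset_Icc_right (min_le_left _ _)))
    ((hf' 0 h0' x).mono (Icc_subset_Icc_right (min_le_right _ _)))
  have h2 : Y 0 (Φ 0 x) = Y' 0 (Φ 0 x) :=
    ((one_smul ℝ (_ : 𝔼)).symm.trans (congrArg (fun L : ℝ →L[ℝ] 𝔼 => L 1) h1)).trans
      (one_smul ℝ (_ : 𝔼))
  rw [h.initial] at h2
  refine (hY 0 h0 x v).symm.trans (Eq.trans ?_ (hY' 0 h0' x v))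
  rw [h2]

lemma Generates.contMDiff_zero {T : ℝ} (hT : 0 < T) {F : ℝ → M → ℝ} {Φ : ℝ → M → M}
    (h : Generates Ω T F Φ) : ContMDiff (𝓡 (2 * d)) 𝓘(ℝ, ℝ) ∞ (F 0) :=
  h.smooth_ham.comp_contMDiff (contMDiff_const.prodMk contMDiff_id)
    fun _ => ⟨left_mem_Icc.2 hT.le, mem_univ _⟩

/-- The integral of the initial value of a generating function is determined by the isotopy. -/
theorem Generates.integral_zero_eq (hd : 1 ≤ d) (hΩ : IsExactSymplectic Ω lam)
    (hX : IsLiouvilleField Ω lam X) {T T' : ℝ} (hT : 0 < T) (hT' : 0 < T') {F F' : ℝ → M → ℝ}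
    {Φ : ℝ → M → M} (h : Generates Ω T F Φ) (h' : Generates Ω T' F' Φ) :
    ∫ x, F 0 x ∂(liouvilleMeasure Ω) = ∫ x, F' 0 x ∂(liouvilleMeasure Ω) := by
  obtain ⟨C, hC, hFC⟩ := h.compact_support
  obtain ⟨C', hC', hFC'⟩ := h'.compact_support
  exact integral_eq_of_differential_eq hd hΩ hX (h.contMDiff_zero hT) (h'.contMDiff_zero hT') hC
    (fun x hx => image_eq_zero_of_notMem_tsupport fun hx' =>
      hx (hFC 0 (left_mem_Icc.2 hT.le) hx')) hC'
    (fun x hx => image_eq_zero_of_notMem_tsupport fun hx' =>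
      hx (hFC' 0 (left_mem_Icc.2 hT'.le) hx')) (h.differential_zero_eq hT hT' h')

end Main

end Calabi

end

theorem lemma3p1p1 {d : ℕ} (hd : 1 ≤ d) {M : Type*} [TopologicalSpace M] [T2Space M]
    [SecondCountableTopology M] [ChartedSpace (EuclideanSpace ℝ (Fin (2 * d))) M]
    [IsManifold (𝓡 (2 * d)) ∞ M] [MeasurableSpace M] [BorelSpace M]
    (Ω : (x : M) → TangentSpace (𝓡 (2 * d)) x →L[ℝ] TangentSpace (𝓡 (2 * d)) x →L[ℝ] ℝ)
    (lam : (x : M) → TangentSpace (𝓡 (2 * d)) x →L[ℝ] ℝ)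
    (hΩ : Calabi.IsExactSymplectic Ω lam)
    (X : (x : M) → TangentSpace (𝓡 (2 * d)) x) (hX : Calabi.IsLiouvilleField Ω lam X)
    (φ : M ≃ₘ^∞⟮𝓡 (2 * d), 𝓡 (2 * d)⟯ M) (hφ : φ ∈ Calabi.HamC Ω) :
    (∀ H : ℝ → M → ℝ, Calabi.GeneratesDiffeo Ω H φ →
      Calabi.calabiIntegral Ω H = Calabi.cal Ω φ) ∧
    (∃ δ : ℝ, 0 < δ ∧ Calabi.FlowDefinedOnSupport X φ δ ∧
      ∃ F : ℝ → M → ℝ, Calabi.Generates Ω δ F (Calabi.flowCommutator X φ)) ∧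
    ∀ δ : ℝ, 0 < δ → Calabi.FlowDefinedOnSupport X φ δ →
      ∀ F : ℝ → M → ℝ, Calabi.Generates Ω δ F (Calabi.flowCommutator X φ) →
        Calabi.cal Ω φ = 1 / ((d : ℝ) + 1) * ∫ x, F 0 x ∂(Calabi.liouvilleMeasure Ω) := by
  have hex : ∃ H : ℝ → M → ℝ, Calabi.GeneratesDiffeo Ω H φ := hφ
  have hcal : ∀ H : ℝ → M → ℝ, Calabi.GeneratesDiffeo Ω H φ →
      Calabi.calabiIntegral Ω H = Calabi.cal Ω φ := by
    intro H hH
    rw [Calabi.cal, dif_pos hex]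
    exact hH.calabiIntegral_eq hd hΩ hX hex.choose_spec
  obtain ⟨H, hH⟩ := hex
  obtain ⟨A, K, hA, hint⟩ := hH.exists_isExactDiffeo hΩ hX
  obtain ⟨δ, hδ, hdef, F, hF, hF0⟩ := hA.exists_generates hΩ hX
  refine ⟨hcal, ⟨δ, hδ, hdef, F, hF⟩, fun δ' hδ' _ F' hF' => ?_⟩
  rw [hF'.integral_zero_eq hd hΩ hX hδ' hδ hF, funext hF0, hA.integral_comp_symm hΩ, hint,
    hcal H hH, ← mul_assoc, one_div, inv_mul_cancel₀ (by positivity), one_mul]
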